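/- Let $\Sigma$ be a compact oriented surface of genus one with one boundary component. Let $\mathrm{Mod}(\Sigma,\partial\Sigma)$ be its mapping class group, that is, the group of homeomorphisms of $\Sigma$ fixing $\partial\Sigma$ pointwise, up to homotopy (equivalently, isotopy) relative to $\partial\Sigma$. Let $x,y\in\mathrm{Mod}(\Sigma,\partial\Sigma)$ be the right-handed Dehn twists about two simple closed curves meeting transversally in exactly one point, with intersection number $+1$ when suitably oriented, and let $\delta$ be the right-handed Dehn twist about a curve parallel to $\partial\Sigma$. Call the open books $(\Sigma,\phi)$ and $(\Sigma,\psi)$ equal if $\psi=h\phi h^{-1}$ for some $h\in\mathrm{Mod}(\Sigma,\partial\Sigma)$. Let $\phi$ be a homeomorphism of $\Sigma$ fixing $\partial\Sigma$ pointwise whose mapping class is pseudo-Anosov; equivalently, the trace of the induced map $\phi_{\#}$ on $H_1(\Sigma;\mathbb{Z})\cong\mathbb{Z}^2$ satisfies $|\mathrm{trace}(\phi_{\#})|>2$. Then the open book $(\Sigma,\phi)$ is equal to an open book whose monodromy is of the form (I) $\delta^{k}\cdot x^{a_1}y^{-b_1}\cdots x^{a_n}y^{-b_n}$, if $\mathrm{trace}(\phi_{\#})>2$;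 (II) $\delta^{k}\cdot(xy)^3\cdot x^{a_1}y^{-b_1}\cdots x^{a_n}y^{-b_n}$, if $\mathrm{trace}(\phi_{\#})<-2$, for some $k\in\mathbb{Z}$, $n\ge 1$ and integers $a_i,b_j\ge 0$ with $a_i\neq 0$ for some $i$ and $b_j\neq 0$ for some $j$. -/

import Mathlib

namespace OnceHoledTorus

noncomputable section

/-- The torus `(ℝ/ℤ)²`, with coordinates `(s, t)` and the orientation `ds ∧ dt`. -/
abbrev Torus : Type := UnitAddCircle × UnitAddCircle

/-- The flat distance from a point of the torus to the origin: `‖·‖` on `ℝ/ℤ` is the distance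
to the nearest integer. -/
def radius (p : Torus) : ℝ := √(‖p.1‖ ^ 2 + ‖p.2‖ ^ 2)

/-- The surface `Σ` of genus one with one boundary component: the torus with the open round disc
of radius `1/4` about the origin removed. -/
abbrev Surface : Type := {p : Torus // 1 / 4 ≤ radius p}

/-- The boundary circle `∂Σ`. -/
def boundary : Set Surface := {p | radius p.1 = 1 / 4}

/-! ### The mapping class group -/

/-- The homeomorphisms of `Σ` that fix the boundary pointwise, under composition. (Since `Σ` is
connected with non-empty boundary, these preserve the orientation automatically.) -/
def BoundaryFixing : Subgroup (Surface ≃ₜ Surface) where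
  carrier := {f | ∀ p ∈ boundary, f p = p}
  mul_mem' := by
    intro f g hf hg p hp
    change f (g p) = p
    rw [hg p hp, hf p hp]
  one_mem' := fun _ _ => rfl
  inv_mem' := by
    intro f hf p hp
    change f.symm p = p
    rw [Homeomorph.symm_apply_eq, hf p hp]

/-- The underlying continuous map. -/
def toMap (f : BoundaryFixing) : C(Surface, Surface) := ⟨f.1, f.1.continuous⟩

/-- Composing a homotopy relative to the boundary with a boundary-fixing homeomorphism. -/
theorem homotopicRel_precomp {f g : C(Surface, Surface)}
    (h : f.HomotopicRel g boundary) (k : BoundaryFixing) :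
    (f.comp (toMap k)).HomotopicRel (g.comp (toMap k)) boundary := by
  obtain ⟨F⟩ := h
  refine ⟨⟨⟨⟨fun x => F (x.1, toMap k x.2), by fun_prop⟩, ?_, ?_⟩, ?_⟩⟩
  · intro x; simp
  · intro x; simp
  · intro t x hx
    have hk : toMap k x = x := k.2 x hx
    change F (t, toMap k x) = f (toMap k x)
    rw [hk]
    exact F.eq_fst t hx

/-- The boundary-fixing homeomorphisms that are homotopic to the identity relative to the
boundary. -/
def Trivial : Subgroup BoundaryFixing where
  carrier := {f | (toMap f).HomotopicRel (ContinuousMap.id Surface) boundary}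
  mul_mem' := by
    intro f g hf hg
    exact (hg.comp_continuousMap (toMap f)).trans hf
  one_mem' := ContinuousMap.HomotopicRel.refl _
  inv_mem' := by
    intro f hf
    have h := (hf.comp_continuousMap (toMap f⁻¹)).symm
    have e : (toMap f⁻¹).comp (toMap f) = ContinuousMap.id Surface := by
      ext1 p
      exact f.1.symm_apply_apply p
    rw [e] at h
    exact h

instance : Trivial.Normal where
  conj_mem := by
    intro f hf g
    have h := homotopicRel_precomp (hf.comp_continuousMap (toMap g)) g⁻¹
    have e : ((toMap g).comp (ContinuousMap.id Surface)).comp (toMap g⁻¹) =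
        ContinuousMap.id Surface := by
      ext1 p
      exact g.1.apply_symm_apply p
    rw [e] at h
    exact h

/-- The mapping class group of `Σ`: homeomorphisms that fix `∂Σ` pointwise, up to homotopy
relative to `∂Σ`. Two such homeomorphisms are homotopic relative to `∂Σ` if and only if they are
isotopic relative to `∂Σ`. The product is composition. -/
abbrev MappingClassGroup : Type := BoundaryFixing ⧸ Trivial

/-- The mapping class of a boundary-fixing homeomorphism. -/
def mappingClass (f : BoundaryFixing) : MappingClassGroup := QuotientGroup.mk f

/-- The open books with page `Σ` and monodromies `φ` and `ψ` are equal: some mapping class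
of the page carries one monodromy to the other. -/
def SameOpenBook (φ ψ : MappingClassGroup) : Prop := ∃ h : MappingClassGroup, h * φ * h⁻¹ = ψ

/-- The trace of the endomorphism of the singular homology group `H₁(Σ; ℤ) ≅ ℤ²` induced by a
boundary-fixing homeomorphism. -/
def homologyTrace (f : BoundaryFixing) : ℤ :=
  LinearMap.trace ℤ _
    (((AlgebraicTopology.singularHomologyFunctor (ModuleCat.{0} ℤ) 1).obj
      (ModuleCat.of ℤ ℤ)).map (TopCat.ofHom (toMap f))).hom

/-! ### Dehn twists -/

/-- The piecewise linear function equal to `0` for `u ≤ 0`, to `u` on `[0, 1]` and to `1` for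
`u ≥ 1`. -/
def ramp (u : ℝ) : ℝ := max 0 (min 1 u)

theorem ramp_of_nonpos {u : ℝ} (h : u ≤ 0) : ramp u = 0 :=
  max_eq_left ((min_le_right _ _).trans h)

theorem ramp_of_one_le {u : ℝ} (h : 1 ≤ u) : ramp u = 1 := by
  rw [ramp, min_eq_left h]; simp

theorem continuous_ramp : Continuous ramp := by unfold ramp; fun_prop

/-- The map of degree one of the circle `ℝ/ℤ` that is constant `0` on `[-1/4, 1/4]` and goes
linearly once around in the positive direction on `[1/4, 3/4]`. -/
def shear : UnitAddCircle → UnitAddCircle :=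
  AddCircle.liftIco 1 0 fun t : ℝ => (ramp (2 * t - 1 / 2) : UnitAddCircle)

theorem continuous_shear : Continuous shear := by
  apply AddCircle.liftIco_continuous
  · rw [ramp_of_nonpos (by norm_num), ramp_of_one_le (by norm_num)]
    simpa using (AddCircle.coe_period (1 : ℝ)).symm
  · exact ((AddCircle.continuous_mk' 1).comp (continuous_ramp.comp (by fun_prop))).continuousOn

theorem shear_eq_zero {t : UnitAddCircle} (h : ‖t‖ ≤ 1 / 4) : shear t = 0 := by
  obtain ⟨x, hx, rfl⟩ := AddCircle.eq_coe_Ico t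
  have hx' : x ∈ Set.Ico (0 : ℝ) (0 + 1) := by simpa using hx
  rw [shear, AddCircle.liftIco_coe_apply hx']
  rcases le_or_gt x (1 / 2) with h2 | h2
  · have : ‖(x : UnitAddCircle)‖ = |x| := by
      rw [AddCircle.norm_coe_eq_abs_iff 1 one_ne_zero, abs_of_nonneg hx.1]; simpa using h2
    rw [this, abs_of_nonneg hx.1] at h
    rw [ramp_of_nonpos (by linarith)]; rfl
  · have e : (x : UnitAddCircle) = ((x - 1 : ℝ) : UnitAddCircle) := by
      rw [AddCircle.coe_sub, AddCircle.coe_period, sub_zero]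
    have : ‖((x - 1 : ℝ) : UnitAddCircle)‖ = |x - 1| := by
      rw [AddCircle.norm_coe_eq_abs_iff 1 one_ne_zero, abs_of_neg (by linarith [hx.2])]
      norm_num; linarith
    rw [e, this, abs_of_neg (by linarith [hx.2])] at h
    rw [ramp_of_one_le (by linarith)]
    exact AddCircle.coe_period 1

theorem norm_fst_le_radius (p : Torus) : ‖p.1‖ ≤ radius p :=
  Real.le_sqrt_of_sq_le (by nlinarith [sq_nonneg ‖p.2‖])

theorem norm_snd_le_radius (p : Torus) : ‖p.2‖ ≤ radius p :=
  Real.le_sqrt_of_sq_le (by nlinarith [sq_nonneg ‖p.1‖])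

theorem continuous_radius : Continuous radius := by unfold radius; fun_prop

/-- A homeomorphism of the torus that is the identity on the closed disc of radius `1/4` about the
origin restricts to a boundary-fixing homeomorphism of `Σ`. -/
def restrict (F : Torus ≃ₜ Torus) (hF : ∀ p, radius p ≤ 1 / 4 → F p = p) : BoundaryFixing :=
  ⟨F.subtype (p := fun p => 1 / 4 ≤ radius p) (q := fun p => 1 / 4 ≤ radius p) (by
    intro p
    constructor
    · intro h
      by_contra! h'
      have := F.injective (hF (F p) h'.le)
      rw [this] at h'
      linarith
    · intro h
      by_contra! h'
      rw [hF p h'.le] at h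
      linarith),
  fun p hp => Subtype.ext (hF p.1 (le_of_eq hp))⟩

/-- The right-handed Dehn twist about the closed curve `x = {t = 1/2}`, oriented by increasing
`s`. It is supported in the annulus `1/4 ≤ t ≤ 3/4`. -/
def twistX : BoundaryFixing :=
  restrict
    { toFun := fun p => (p.1 + shear p.2, p.2)
      invFun := fun p => (p.1 - shear p.2, p.2)
      left_inv := fun p => by simp
      right_inv := fun p => by simp
      continuous_toFun := by have := continuous_shear; fun_prop
      continuous_invFun := by have := continuous_shear; fun_prop }
    (by
      intro p hp
      change (p.1 + shear p.2, p.2) = p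
      rw [shear_eq_zero ((norm_snd_le_radius p).trans hp), add_zero])

/-- The right-handed Dehn twist about the closed curve `y = {s = 1/2}`, oriented by increasing
`t`, so that the intersection number of `x` and `y` is `+1`. It is supported in the annulus
`1/4 ≤ s ≤ 3/4`. -/
def twistY : BoundaryFixing :=
  restrict
    { toFun := fun p => (p.1, p.2 - shear p.1)
      invFun := fun p => (p.1, p.2 + shear p.1)
      left_inv := fun p => by simp
      right_inv := fun p => by simp
      continuous_toFun := by have := continuous_shear; fun_prop
      continuous_invFun := by have := continuous_shear; fun_prop }
    (by
      intro p hp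
      change (p.1, p.2 - shear p.1) = p
      rw [shear_eq_zero ((norm_fst_le_radius p).trans hp), sub_zero])

/-- The representative in `[-1/2, 1/2)` of a point of `ℝ/ℤ`. -/
def rep (s : UnitAddCircle) : ℝ := AddCircle.equivIco 1 (-1 / 2) s

theorem coe_rep (s : UnitAddCircle) : (rep s : UnitAddCircle) = s := AddCircle.coe_equivIco

theorem rep_coe {u : ℝ} (h : |u| < 1 / 2) : rep (u : UnitAddCircle) = u := by
  rw [abs_lt] at h
  exact AddCircle.equivIco_coe_of_mem ⟨by linarith, by linarith⟩

theorem abs_rep (s : UnitAddCircle) : |rep s| = ‖s‖ := by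
  have h := (AddCircle.equivIco 1 (-1 / 2) s).2
  conv_rhs => rw [← coe_rep s]
  rw [eq_comm, AddCircle.norm_coe_eq_abs_iff 1 one_ne_zero, abs_le]
  unfold rep
  simp only [abs_one]
  constructor <;> linarith [h.1, h.2]

theorem continuousAt_rep {s : UnitAddCircle} (h : ‖s‖ < 1 / 2) : ContinuousAt rep s := by
  refine continuousAt_subtype_val.comp (AddCircle.continuousAt_equivIco 1 (-1 / 2) ?_)
  rintro rfl
  have : ‖((-1 / 2 : ℝ) : UnitAddCircle)‖ = |(-1 / 2 : ℝ)| := by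
    rw [AddCircle.norm_coe_eq_abs_iff 1 one_ne_zero]; norm_num [abs_div]
  rw [this] at h
  norm_num [abs_div] at h

theorem radius_eq (p : Torus) : radius p = √(rep p.1 ^ 2 + rep p.2 ^ 2) := by
  rw [radius, ← abs_rep, ← abs_rep, sq_abs, sq_abs]

/-- The angle of the `m`-fold twist along the circles about the origin. -/
def angle (m : ℤ) (p : Torus) : ℝ := m * (2 * Real.pi * ramp (8 * radius p - 2))

/-- On the disc of radius `1/2` about the origin, rotate the circle of radius `r` clockwise by
`m` times an angle that is `0` for `r ≤ 1/4`, increases linearly with `r`, and is `2π` for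
`r ≥ 3/8`; elsewhere this is the identity. -/
def rotate (m : ℤ) (p : Torus) : Torus :=
  (((rep p.1 * Real.cos (angle m p) + rep p.2 * Real.sin (angle m p) : ℝ) : UnitAddCircle),
   ((-rep p.1 * Real.sin (angle m p) + rep p.2 * Real.cos (angle m p) : ℝ) : UnitAddCircle))

theorem rotate_outer (m : ℤ) {p : Torus} (h : 3 / 8 ≤ radius p) : rotate m p = p := by
  have ha : angle m p = m * (2 * Real.pi) := by
    rw [angle, ramp_of_one_le (by linarith), mul_one]
  have hs : Real.sin (angle m p) = 0 := by
    rw [ha, show (m : ℝ) * (2 * Real.pi) = ((2 * m : ℤ) : ℝ) * Real.pi by push_cast; ring]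
    exact Real.sin_int_mul_pi _
  have hc : Real.cos (angle m p) = 1 := by rw [ha]; exact Real.cos_int_mul_two_pi m
  simp only [rotate, hs, hc, mul_zero, mul_one, add_zero, zero_add, coe_rep]

theorem rotate_inner (m : ℤ) {p : Torus} (h : radius p ≤ 1 / 4) : rotate m p = p := by
  have ha : angle m p = 0 := by rw [angle, ramp_of_nonpos (by linarith)]; ring
  simp only [rotate, ha, Real.sin_zero, Real.cos_zero, mul_zero, mul_one, add_zero, zero_add,
    coe_rep]

theorem rep_rotate (m : ℤ) {p : Torus} (h : radius p < 1 / 2) :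
    rep (rotate m p).1 = rep p.1 * Real.cos (angle m p) + rep p.2 * Real.sin (angle m p) ∧
    rep (rotate m p).2 = -rep p.1 * Real.sin (angle m p) + rep p.2 * Real.cos (angle m p) := by
  have hr : rep p.1 ^ 2 + rep p.2 ^ 2 < (1 / 2) ^ 2 := by
    rw [radius_eq, Real.sqrt_lt' (by norm_num)] at h; exact h
  have hcs := Real.sin_sq_add_cos_sq (angle m p)
  have key : (rep p.1 * Real.cos (angle m p) + rep p.2 * Real.sin (angle m p)) ^ 2 +
      (-rep p.1 * Real.sin (angle m p) + rep p.2 * Real.cos (angle m p)) ^ 2 =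
      rep p.1 ^ 2 + rep p.2 ^ 2 := by
    linear_combination (rep p.1 ^ 2 + rep p.2 ^ 2) * hcs
  constructor <;> refine rep_coe (abs_lt_of_sq_lt_sq ?_ (by norm_num)) <;> nlinarith

theorem radius_rotate (m : ℤ) (p : Torus) : radius (rotate m p) = radius p := by
  rcases le_or_gt (3 / 8) (radius p) with h | h
  · rw [rotate_outer m h]
  · obtain ⟨h1, h2⟩ := rep_rotate m (p := p) (by linarith)
    rw [radius_eq, radius_eq, h1, h2]
    congr 1
    linear_combination (rep p.1 ^ 2 + rep p.2 ^ 2) * Real.sin_sq_add_cos_sq (angle m p)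

theorem rotate_neg_rotate (m : ℤ) (p : Torus) : rotate (-m) (rotate m p) = p := by
  rcases le_or_gt (3 / 8) (radius p) with h | h
  · rw [rotate_outer m h, rotate_outer _ h]
  · obtain ⟨h1, h2⟩ := rep_rotate m (p := p) (by linarith)
    have ha : angle (-m) (rotate m p) = -angle m p := by
      rw [angle, angle, radius_rotate]; push_cast; ring
    have hcs := Real.sin_sq_add_cos_sq (angle m p)
    rw [rotate, ha, h1, h2, Real.cos_neg, Real.sin_neg]
    refine Prod.ext ?_ ?_
    · conv_rhs => rw [← coe_rep p.1]
      refine congrArg (fun u : ℝ => (u : UnitAddCircle)) ?_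
      linear_combination rep p.1 * hcs
    · conv_rhs => rw [← coe_rep p.2]
      refine congrArg (fun u : ℝ => (u : UnitAddCircle)) ?_
      linear_combination rep p.2 * hcs

theorem continuous_rotate (m : ℤ) : Continuous (rotate m) := by
  rw [continuous_iff_continuousAt]
  intro p
  rcases lt_or_ge (3 / 8) (radius p) with h | h
  · have ho : IsOpen {q : Torus | 3 / 8 < radius q} := isOpen_lt continuous_const continuous_radius
    refine continuousAt_id.congr (Filter.eventuallyEq_of_mem (ho.mem_nhds h) ?_)
    intro q hq
    exact (rotate_outer m (le_of_lt hq)).symm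
  · have c1 : ContinuousAt (fun q : Torus => rep q.1) p :=
      (continuousAt_rep (by linarith [norm_fst_le_radius p])).comp continuousAt_fst
    have c2 : ContinuousAt (fun q : Torus => rep q.2) p :=
      (continuousAt_rep (by linarith [norm_snd_le_radius p])).comp continuousAt_snd
    have ca : ContinuousAt (angle m) p := by
      have := continuous_radius
      have := continuous_ramp
      unfold angle
      fun_prop
    have cc := Real.continuous_cos.continuousAt.comp ca
    have cs := Real.continuous_sin.continuousAt.comp ca
    have cq : Continuous (fun u : ℝ => (u : UnitAddCircle)) := AddCircle.continuous_mk' 1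
    exact (cq.continuousAt.comp ((c1.mul cc).add (c2.mul cs))).prodMk
      (cq.continuousAt.comp ((c1.neg.mul cs).add (c2.mul cc)))

/-- The right-handed Dehn twist about the closed curve `δ`, the circle of radius `5/16` about the
origin, which is parallel to the boundary. It is supported in the annulus
`1/4 ≤ radius ≤ 3/8`. -/
def twistDelta : BoundaryFixing :=
  restrict
    { toFun := rotate 1
      invFun := rotate (-1)
      left_inv := rotate_neg_rotate 1
      right_inv := fun p => by simpa using rotate_neg_rotate (-1) p
      continuous_toFun := continuous_rotate 1
      continuous_invFun := continuous_rotate (-1) }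
    (fun _ hp => rotate_inner 1 hp)

/-- The mapping class of the right-handed Dehn twist about `x`. -/
def x : MappingClassGroup := mappingClass twistX

/-- The mapping class of the right-handed Dehn twist about `y`. -/
def y : MappingClassGroup := mappingClass twistY

/-- The mapping class of the right-handed Dehn twist about `δ`. -/
def δ : MappingClassGroup := mappingClass twistDelta

/-- The word `x ^ a₁ * y ^ (-b₁) * ⋯ * x ^ aₙ * y ^ (-bₙ)`. -/
def word {n : ℕ} (a b : Fin n → ℕ) : MappingClassGroup :=
  (List.ofFn fun i => x ^ a i * y ^ (-(b i : ℤ))).prod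

end

end OnceHoledTorus

/-! The proof has two halves: the mapping class group is shown to be a quotient of the braid group
on three strands, and conjugacy classes are then normalized algebraically.

Algebra. Put `S = x * y * x` and `T = x * y`. The braid relation gives `S ^ 2 = T ^ 3`, a central
element `z`, and modulo `z` the letters are `x = T ^ 2 * S` and `y⁻¹ = T * S`. Modulo the center, an
alternating word in `S` and `T ^ (±1)` is therefore a product of letters `x`, `y⁻¹` up to its two
ends, and cyclic rotation removes the ends (`braidNormalizable`) unless the word collapses to `S`,
`T` or `T ^ 2`. On homology `z` acts as `-1` and the letters act by the two elementary nonnegative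
matrices. Hence `S`, `T`, `T ^ 2` have trace of absolute value below `2`, and products of letters
have trace at least `2`, with equality if one letter is absent. The sign of the trace gives the
parity of the exponent of `z`, and `z ^ 2 = δ` (`exists_isConj_letterProd`).

Topology. The group acts faithfully on the free group `π₁(Σ)` and fixes the boundary commutator
(`mcgAct_injective`, `act_boundaryWord`). The images of the twists are explicit (`act_twistX`,
`act_twistY`, `act_twistDelta`), so the braid and chain relations reduce to computations with
automorphisms. Generation by `x` and `y` follows from Nielsen reduction: an endomorphism fixing the
commutator is a product of the two twist automorphisms and their inverses (`exists_mem_closure_eq`).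

The fundamental group is reached through `crush`, a homotopy equivalence from `Σ` to the quotient of
a convex thickening of the Cayley tree. Paths lift to the thickening and straight segments there are
homotopies; this gives holonomy, faithfulness, and, through singular chains modulo boundaries, the
identification of the homological trace with that of a matrix of exponent sums (`homologyTrace_eq`).
-/

/-! ### Conjugacy classes in quotients of the braid group on three strands -/

section Braid

variable {G : Type*} [Group G] {x y : G}

/-- The product of the letters `x` (for `true`) and `y⁻¹` (for `false`). -/
def letterProd (x y : G) (l : List Bool) : G := (l.map fun b => if b then x else y⁻¹).prod

theorem letterProd_nil : letterProd x y [] = 1 := rfl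

theorem letterProd_cons (e : Bool) (l : List Bool) :
    letterProd x y (e :: l) = (if e then x else y⁻¹) * letterProd x y l := by
  simp [letterProd]

variable (h : x * y * x = y * x * y)
include h

/-- The element is the square of the half twist `x * y * x`, and moving the half twist past `x` or
`y` interchanges the two. -/
theorem braid_center_left : Commute ((x * y) ^ 3) x := by
  have h1 : (x * y) ^ 3 = (x * y * x) * (x * y * x) := by
    conv_rhs => enter [2]; rw [h]
    simp only [pow_succ, pow_zero, one_mul, mul_assoc]
  have h2 : (x * y * x) * x = y * (x * y * x) := by
    conv_lhs => rw [h]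
    simp only [mul_assoc]
  have h3 : (x * y * x) * y = x * (x * y * x) := by
    simp only [mul_assoc] at h ⊢; rw [h]
  rw [Commute, SemiconjBy, h1, mul_assoc, h2, ← mul_assoc, h3, mul_assoc]

theorem braid_center_right : Commute ((x * y) ^ 3) y := by
  have h1 := braid_center_left h
  have h2 : Commute ((x * y) ^ 3) (x * y) := (Commute.refl (x * y)).pow_left 3
  have := h1.inv_right.mul_right h2
  simpa using this

theorem braid_half_sq : (x * y * x) * (x * y * x) = (x * y) ^ 3 := by
  conv_lhs => enter [2]; rw [h]
  simp only [pow_succ, pow_zero, one_mul, mul_assoc]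

theorem braid_letter_false : y⁻¹ = ((x * y) ^ 3)⁻¹ * ((x * y) ^ 1 * (x * y * x)) := by
  rw [eq_inv_mul_iff_mul_eq, ← braid_half_sq h, pow_one]
  conv_lhs => enter [1, 2]; rw [h]
  simp only [mul_assoc, mul_inv_cancel, mul_one]

/-- An element is *normalizable* if it is conjugate, up to a power of the central element
`(x * y) ^ 3`, to a product of letters `x` and `y⁻¹` or to an element of finite order modulo
the center. -/
def BraidNormalizable (x y g : G) : Prop :=
  ∃ (k : ℤ) (w : G), ((∃ l, w = letterProd x y l) ∨ w = x * y * x ∨ w = x * y ∨ w = (x * y) ^ 2) ∧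
    IsConj g (((x * y) ^ 3) ^ k * w)

omit h in
theorem BraidNormalizable.of_isConj {g g' : G} (hg : BraidNormalizable x y g)
    (hc : IsConj g' g) : BraidNormalizable x y g' := by
  obtain ⟨k, w, hw, hk⟩ := hg
  exact ⟨k, w, hw, hc.trans hk⟩

variable (hG : Subgroup.closure {x, y} = ⊤)
include hG

theorem braid_center (g : G) : Commute ((x * y) ^ 3) g := by
  have hg : g ∈ Subgroup.closure {x, y} := by rw [hG]; trivial
  induction hg using Subgroup.closure_induction with
  | mem a ha =>
    rcases ha with rfl | rfl
    · exact braid_center_left h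
    · exact braid_center_right h
  | one => exact Commute.one_right _
  | mul _ _ _ _ h1 h2 => exact h1.mul_right h2
  | inv _ _ h1 => exact h1.inv_right

theorem BraidNormalizable.center_mul {g : G} (hg : BraidNormalizable x y g) (k : ℤ) :
    BraidNormalizable x y (((x * y) ^ 3) ^ k * g) := by
  obtain ⟨k', w, hw, hk⟩ := hg
  refine ⟨k + k', w, hw, ?_⟩
  rw [isConj_iff] at hk ⊢
  obtain ⟨c, hc⟩ := hk
  refine ⟨c, ?_⟩
  rw [zpow_add, mul_assoc _ _ w, ← hc, ← mul_assoc, ← ((braid_center h hG c).zpow_left k).eq]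
  simp only [mul_assoc]

theorem braidNormalizable_of_center_mul {g g' : G} (k : ℤ) (hg : BraidNormalizable x y g)
    (hc : IsConj g' (((x * y) ^ 3) ^ k * g)) : BraidNormalizable x y g' :=
  (hg.center_mul h hG k).of_isConj hc

omit hG in
omit h in
theorem letterProd_append_singleton (l : List Bool) (b : Bool) :
    letterProd x y (l ++ [b]) = letterProd x y l * if b then x else y⁻¹ := by
  simp [letterProd]

-- A half twist after a letter turns it into a power of `x * y`. Read backwards, the letters are the
-- syllables of an alternating word in the half twist and `x * y`, modulo the center.
omit hG in
theorem letter_mul_half_twist (b : Bool) :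
    (if b then x else y⁻¹) * (x * y * x) = (x * y) ^ (if b then 2 else 1) := by
  cases b
  · rw [if_neg Bool.false_ne_true, if_neg Bool.false_ne_true, h]
    simp only [mul_assoc, inv_mul_cancel_left, pow_one]
  · simp only [if_true]
    rw [h, pow_two]
    simp only [mul_assoc]

omit hG in
theorem mul_half_twist : x * y * (x * y * x) = (x * y) ^ 3 * y⁻¹ := by
  rw [braid_letter_false h, mul_inv_cancel_left, pow_one]

omit hG h in
theorem sq_mul_half_twist : (x * y) ^ 2 * (x * y * x) = (x * y) ^ 3 * x := by
  simp only [pow_succ, pow_zero, one_mul, mul_assoc]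

/-- Cyclic reduction in a central quotient generated by an element of order two and one of order
three. A trailing half twist is absorbed by the last letter; a trailing power of `x * y` is carried
around to the first letter. Either the result is a product of letters, or the list gets shorter and
induction applies. -/
theorem braidNormalizable_letterProd (l : List Bool) :
    BraidNormalizable x y (letterProd x y l * (x * y * x)) ∧
    BraidNormalizable x y (letterProd x y l * (x * y)) ∧
    BraidNormalizable x y (letterProd x y l * (x * y) ^ 2) := by
  have hone : ∀ l, BraidNormalizable x y (letterProd x y l) := fun l =>
    ⟨0, _, Or.inl ⟨l, rfl⟩, by rw [zpow_zero, one_mul]⟩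
  induction hn : l.length using Nat.strong_induction_on generalizing l with
  | _ n ih =>
  subst hn
  -- The half twist case is proved for all lists up to the current length, because the other two
  -- cases fall back on it for the tail of `l`.
  have hS : ∀ l' : List Bool, l'.length ≤ l.length →
      BraidNormalizable x y (letterProd x y l' * (x * y * x)) := by
    intro l' hl'
    rcases List.eq_nil_or_concat l' with rfl | ⟨m, b, rfl⟩
    · exact ⟨0, x * y * x, by simp, by rw [zpow_zero, one_mul, letterProd_nil, one_mul]⟩
    rw [List.concat_eq_append] at hl' ⊢
    have hm : m.length < l.length := by simp at hl'; omega
    obtain ⟨-, h1, h2⟩ := ih _ hm m rfl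
    rw [letterProd_append_singleton, mul_assoc, letter_mul_half_twist h]
    cases b
    · simpa using h1
    · simpa using h2
  refine ⟨hS l le_rfl, ?_⟩
  rcases l with - | ⟨b, m⟩
  · exact ⟨⟨0, x * y, by simp, by rw [zpow_zero, one_mul, letterProd_nil, one_mul]⟩,
      ⟨0, (x * y) ^ 2, by simp, by rw [zpow_zero, one_mul, letterProd_nil, one_mul]⟩⟩
  have hconj : ∀ u v w : G, IsConj (u * v * w) (v * (w * u)) := fun u v w =>
    isConj_iff.2 ⟨u⁻¹, by group⟩
  have hm := hS m (by simp)
  rw [letterProd_cons]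
  constructor
  · refine BraidNormalizable.of_isConj ?_ (hconj _ _ _)
    -- Here `x * y * y⁻¹ = x` is a new last letter, whereas `x * y * x` is a half twist after the
    -- tail.
    cases b
    · have := hone (m ++ [true])
      rw [letterProd_append_singleton, if_pos rfl] at this
      simpa using this
    · rwa [if_pos rfl]
  · refine BraidNormalizable.of_isConj ?_ (hconj _ _ _)
    -- Here `(x * y) ^ 2 * y⁻¹` is a half twist, whereas `(x * y) ^ 2 * x` is central times the
    -- letter `y⁻¹`.
    cases b
    · rw [if_neg Bool.false_ne_true]
      simpa only [mul_assoc, pow_two, mul_inv_cancel, mul_one] using hm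
    · refine braidNormalizable_of_center_mul h hG 1 (hone (m ++ [false])) ?_
      rw [letterProd_append_singleton, if_pos rfl, if_neg Bool.false_ne_true, zpow_one,
        ← mul_assoc, (braid_center h hG _).eq, mul_assoc, mul_assoc, ← (braid_center h hG _).eq,
        ← mul_half_twist h, pow_two]
      simp only [mul_assoc, IsConj.refl]

/-- Every element is, up to a central factor, a product of letters between powers of the half
twist and of `x * y`. -/
theorem braid_factorization (g : G) : ∃ (k : ℤ) (i e : ℕ) (l : List Bool), i ≤ 1 ∧ e ≤ 2 ∧
    g = ((x * y) ^ 3) ^ k * ((x * y * x) ^ i * (letterProd x y l * (x * y) ^ e)) := by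
  have hz := braid_center h hG
  have hS2 := braid_half_sq h
  have hT3 : (x * y) ^ 2 * (x * y) = (x * y) ^ 3 := (pow_succ _ _).symm
  have hxS := sq_mul_half_twist (x := x) (y := y)
  have hyS := mul_half_twist h
  have hbS := letter_mul_half_twist h
  have hbe := letterProd_append_singleton (x := x) (y := y)
  set z : G := (x * y) ^ 3
  set P : G → Prop := fun g => ∃ (k : ℤ) (i e : ℕ) (l : List Bool), i ≤ 1 ∧ e ≤ 2 ∧
    g = z ^ k * ((x * y * x) ^ i * (letterProd x y l * (x * y) ^ e)) with hP
  have hc : ∀ (k : ℤ) (a : G), z ^ k * a = a * z ^ k := fun k a => (hz a).zpow_left k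
  -- The set of factorizable elements is stable under right multiplication by central powers, by `x
  -- * y` and by the half twist. These suffice to write each generator and its inverse.
  have hPz : ∀ g (k : ℤ), P g → P (g * z ^ k) := by
    rintro g k ⟨k', i, e, l, hi, he, rfl⟩
    exact ⟨k + k', i, e, l, hi, he, by
      rw [← hc, ← mul_assoc, ← zpow_add]⟩
  have hPT : ∀ g, P g → P (g * (x * y)) := by
    rintro g ⟨k, i, e, l, hi, he, rfl⟩
    rcases he.lt_or_eq with he | rfl
    · exact ⟨k, i, e + 1, l, hi, he, by rw [pow_succ (x * y) e]; simp only [mul_assoc]⟩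
    · refine ⟨k + 1, i, 0, l, hi, by omega, ?_⟩
      rw [zpow_add, zpow_one, mul_assoc (z ^ k) z, (hz _).eq, ← hT3, pow_zero, mul_one]
      simp only [mul_assoc]
  have hPS : ∀ g, P g → P (g * (x * y * x)) := by
    rintro g ⟨k, i, e, l, hi, he, rfl⟩
    have hcases : e = 0 ∨ e = 1 ∨ e = 2 := by omega
    rcases hcases with rfl | rfl | rfl
    · rcases List.eq_nil_or_concat l with rfl | ⟨m, b, rfl⟩
      · have hcases : i = 0 ∨ i = 1 := by omega
        rcases hcases with rfl | rfl
        · exact ⟨k, 1, 0, [], le_rfl, by omega, by simp [letterProd_nil]⟩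
        · refine ⟨k + 1, 0, 0, [], by omega, by omega, ?_⟩
          rw [letterProd_nil, pow_one, pow_zero, pow_zero, mul_one, mul_one, mul_assoc, hS2,
            zpow_add, zpow_one, mul_one, mul_one]
      · refine ⟨k, i, if b then 2 else 1, m, hi, by split_ifs <;> omega, ?_⟩
        rw [List.concat_eq_append, hbe, ← hbS]
        simp only [mul_assoc, pow_zero, one_mul]
    · refine ⟨k + 1, i, 0, l ++ [false], hi, by omega, ?_⟩
      rw [hbe, if_neg Bool.false_ne_true, zpow_add, zpow_one, mul_assoc (z ^ k) z, (hz _).eq,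
        pow_zero, mul_one, mul_assoc (_ ^ i), mul_assoc (letterProd x y l), ← (hz y⁻¹).eq, ← hyS,
        pow_one]
      simp only [mul_assoc]
    · refine ⟨k + 1, i, 0, l ++ [true], hi, by omega, ?_⟩
      rw [hbe, if_pos rfl, zpow_add, zpow_one, mul_assoc (z ^ k) z, (hz _).eq,
        pow_zero, mul_one, mul_assoc (_ ^ i), mul_assoc (letterProd x y l), ← (hz x).eq, ← hxS]
      simp only [mul_assoc]
  have hzi : z⁻¹ = z ^ (-1 : ℤ) := by simp
  have hx : x = x * y * (x * y) * (x * y * x) * z ^ (-1 : ℤ) := by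
    rw [← pow_two, hxS, ← hzi, (hz x).eq, mul_inv_cancel_right]
  have hx' : x⁻¹ = (x * y * x) * (x * y) * z ^ (-1 : ℤ) := by
    rw [← hzi, eq_mul_inv_iff_mul_eq, inv_mul_eq_iff_eq_mul, ← mul_assoc x]
    have := hbS true
    simp only [if_true] at this
    rw [this, hT3]
  have hy' : y⁻¹ = x * y * (x * y * x) * z ^ (-1 : ℤ) := by
    rw [hyS, ← hzi, (hz _).eq, mul_inv_cancel_right]
  have hy : y = (x * y * x) * (x * y) * (x * y) * z ^ (-1 : ℤ) := by
    rw [← hzi, eq_mul_inv_iff_mul_eq]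
    have e1 : (x * y * x) * (x * y) * (x * y) * (x * y * (x * y * x)) = z * z := by
      have e2 : (x * y * x) * (x * y) * (x * y) * (x * y * (x * y * x)) =
          (x * y * x) * (x * y) ^ 3 * (x * y * x) := by
        simp only [pow_succ, pow_zero, one_mul, mul_assoc]
      rw [e2]
      change (x * y * x) * z * (x * y * x) = z * z
      rw [← (hz _).eq, mul_assoc, hS2]
    rw [hyS, ← mul_assoc, ← (hz _).eq, mul_assoc, mul_left_cancel_iff, mul_inv_eq_iff_eq_mul] at e1
    rw [e1, (hz y).eq]
  have hg : g ∈ Subgroup.closure {x, y} := by rw [hG]; trivial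
  change P g
  induction hg using Subgroup.closure_induction_right with
  | one => exact ⟨0, 0, 0, [], by omega, by omega, by simp [letterProd_nil]⟩
  | mul_right u hu v hv ih =>
    rcases hv with hv | hv
    · rw [hv, hx, ← mul_assoc u, ← mul_assoc u, ← mul_assoc u]
      exact hPz _ _ (hPS _ (hPT _ (hPT _ ih)))
    · rw [Set.mem_singleton_iff.1 hv, hy, ← mul_assoc u, ← mul_assoc u, ← mul_assoc u]
      exact hPz _ _ (hPT _ (hPT _ (hPS _ ih)))
  | mul_inv_cancel u hu v hv ih =>
    rcases hv with hv | hv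
    · rw [hv, hx', ← mul_assoc u, ← mul_assoc u]
      exact hPz _ _ (hPT _ (hPS _ ih))
    · rw [Set.mem_singleton_iff.1 hv, hy', ← mul_assoc u, ← mul_assoc u]
      exact hPz _ _ (hPS _ (hPT _ ih))

/-- Every element is normalizable. -/
theorem braidNormalizable (g : G) : BraidNormalizable x y g := by
  obtain ⟨k, i, e, l, hi, he, rfl⟩ := braid_factorization h hG g
  refine BraidNormalizable.center_mul h hG ?_ k
  have hone : ∀ l, BraidNormalizable x y (letterProd x y l) := fun l =>
    ⟨0, _, Or.inl ⟨l, rfl⟩, by rw [zpow_zero, one_mul]⟩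
  obtain ⟨h1, h2, h3⟩ := braidNormalizable_letterProd h hG l
  have hcases : (i = 0 ∨ i = 1) ∧ (e = 0 ∨ e = 1 ∨ e = 2) := by omega
  -- The leading half twist is conjugated to the end. If it meets a power of `x * y` there, the two
  -- merge into one letter times the center.
  refine BraidNormalizable.of_isConj (g := letterProd x y l * (x * y) ^ e * (x * y * x) ^ i) ?_
    (isConj_iff.2 ⟨((x * y * x) ^ i)⁻¹, by group⟩)
  obtain ⟨rfl | rfl, rfl | rfl | rfl⟩ := hcases
  · simpa using hone l
  · simpa using h2
  · simpa using h3
  · simpa using h1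
  · refine braidNormalizable_of_center_mul h hG 1 (hone (l ++ [false])) ?_
    rw [pow_one, pow_one, mul_assoc, mul_half_twist h, letterProd_append_singleton,
      if_neg Bool.false_ne_true, zpow_one, ← mul_assoc, ← (braid_center h hG _).eq, mul_assoc]
  · refine braidNormalizable_of_center_mul h hG 1 (hone (l ++ [true])) ?_
    rw [pow_one, mul_assoc, sq_mul_half_twist, letterProd_append_singleton,
      if_pos rfl, zpow_one, ← mul_assoc, ← (braid_center h hG _).eq, mul_assoc]

end Braid

/-! ### Traces of the linear representation -/

section Trace

variable {G : Type*} [Group G] {x y : G} {ρ : G →* Matrix (Fin 2) (Fin 2) ℤ}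

theorem MonoidHom.map_zpow_eq_one {M : Type*} [Monoid M] {f : G →* M} {g : G} (hg : f g = 1)
    (m : ℤ) : f (g ^ m) = 1 := by
  have hn : ∀ n : ℕ, f (g ^ n) = 1 := fun n => by rw [map_pow, hg, one_pow]
  rcases m with n | n
  · simpa using hn n
  · rw [zpow_negSucc]
    have : f ((g ^ (n + 1))⁻¹) * f (g ^ (n + 1)) = 1 := by rw [← map_mul, inv_mul_cancel, map_one]
    rwa [hn, mul_one] at this

theorem Matrix.trace_map_of_isConj {g g' : G} (h : IsConj g g') :
    (ρ g).trace = (ρ g').trace := by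
  obtain ⟨c, rfl⟩ := isConj_iff.1 h
  rw [map_mul, Matrix.trace_mul_comm, ← map_mul, inv_mul_cancel_left]

variable (hx : ρ x = !![1, 1; 0, 1]) (hy : ρ y = !![1, 0; -1, 1])
include hy

theorem map_inv_lower : ρ y⁻¹ = !![1, 0; 1, 1] := by
  have h1 : ρ y⁻¹ * ρ y = 1 := by rw [← map_mul, inv_mul_cancel, map_one]
  have h2 : ρ y * !![1, 0; 1, 1] = 1 := by rw [hy]; decide
  calc ρ y⁻¹ = ρ y⁻¹ * (ρ y * !![1, 0; 1, 1]) := by rw [h2, mul_one]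
    _ = _ := by rw [← mul_assoc, h1, one_mul]

include hx

/-- Both letters act by elementary matrices with nonnegative entries, so entries never decrease
along a product. Products of a single letter stay unitriangular, which is the only reason for trace
two needed below. -/
theorem map_letterProd_entries (l : List Bool) :
    1 ≤ ρ (letterProd x y l) 0 0 ∧ 0 ≤ ρ (letterProd x y l) 0 1 ∧
    0 ≤ ρ (letterProd x y l) 1 0 ∧ 1 ≤ ρ (letterProd x y l) 1 1 ∧
    (true ∉ l → ρ (letterProd x y l) 0 1 = 0 ∧ (ρ (letterProd x y l)).trace = 2) ∧
    (false ∉ l → ρ (letterProd x y l) 1 0 = 0 ∧ (ρ (letterProd x y l)).trace = 2) := by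
  induction l with
  | nil => simp [letterProd_nil]
  | cons b l ih =>
    obtain ⟨h00, h01, h10, h11, ht, hf⟩ := ih
    rw [letterProd_cons, map_mul]
    simp only [Matrix.trace_fin_two] at ht hf ⊢
    set M := ρ (letterProd x y l)
    cases b
    · rw [if_neg Bool.false_ne_true, map_inv_lower hy]
      simp only [Matrix.mul_apply, Fin.sum_univ_two, Matrix.of_apply, Matrix.cons_val_zero,
        Matrix.cons_val_one, one_mul, zero_mul, add_zero]
      refine ⟨h00, h01, by omega, by omega, fun h => ?_, fun h => ?_⟩
      · have := ht (by simpa using h); omega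
      · simp at h
    · rw [if_pos rfl, hx]
      simp only [Matrix.mul_apply, Fin.sum_univ_two, Matrix.of_apply, Matrix.cons_val_zero,
        Matrix.cons_val_one, one_mul, zero_mul, zero_add]
      refine ⟨by omega, by omega, h10, h11, fun h => ?_, fun h => ?_⟩
      · simp at h
      · have := hf (by simpa using h); omega

theorem map_braid_center : ρ ((x * y) ^ 3) = -1 := by
  rw [map_pow, map_mul, hx, hy]; decide

/-- A monodromy of large trace is conjugate, up to the center, to a product of letters. -/
theorem exists_isConj_letterProd (h : x * y * x = y * x * y)
    (hG : Subgroup.closure {x, y} = ⊤) {d : G} (hd : (x * y) ^ 6 = d) (g : G) :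
    (2 < (ρ g).trace → ∃ (k : ℤ) (l : List Bool), true ∈ l ∧ false ∈ l ∧
      IsConj g (d ^ k * letterProd x y l)) ∧
    ((ρ g).trace < -2 → ∃ (k : ℤ) (l : List Bool), true ∈ l ∧ false ∈ l ∧
      IsConj g (d ^ k * (x * y) ^ 3 * letterProd x y l)) := by
  obtain ⟨k, w, hw, hk⟩ := braidNormalizable h hG g
  have hz := map_braid_center hx hy
  have hz2 : ((x * y) ^ 3) ^ (2 : ℤ) = d := by
    rw [← hd]; norm_cast; rw [← pow_mul]
  have hd1 : ∀ m : ℤ, ρ (d ^ m) = 1 := fun m => MonoidHom.map_zpow_eq_one (by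
    rw [← hz2]; norm_cast; rw [map_pow, hz]; decide) m
  rw [Matrix.trace_map_of_isConj hk]
  -- The exceptional representatives, torsion modulo the center, have traces `0`, `1` and `-1`.
  have hsmall : |(ρ w).trace| < 2 ∨ ∃ l, w = letterProd x y l := by
    rcases hw with hw | rfl | rfl | rfl
    · exact Or.inr hw
    all_goals
      left
      simp only [map_mul, map_pow, hx, hy]
      decide
  -- Since the square of the central element is `d`, an even exponent disappears into `d`; an odd
  -- one leaves a factor acting as `-1`, which flips the sign of the trace.
  obtain ⟨m, rfl | rfl⟩ : ∃ m, k = 2 * m ∨ k = 2 * m + 1 := ⟨k / 2, by omega⟩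
  · rw [zpow_mul, hz2] at hk ⊢
    rw [map_mul, hd1, one_mul]
    rcases hsmall with hsmall | ⟨l, rfl⟩
    · rw [abs_lt] at hsmall
      constructor <;> intro <;> omega
    · obtain ⟨h00, h01, h10, h11, ht, hf⟩ := map_letterProd_entries hx hy l
      constructor
      · intro htr
        refine ⟨m, l, ?_, ?_, hk⟩
        · by_contra hc; have := ht hc; omega
        · by_contra hc; have := hf hc; omega
      · intro htr
        rw [Matrix.trace_fin_two] at htr; omega
  · rw [zpow_add, zpow_mul, hz2, zpow_one] at hk ⊢
    rw [map_mul, map_mul, hd1, one_mul, hz, neg_one_mul, Matrix.trace_neg]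
    rcases hsmall with hsmall | ⟨l, rfl⟩
    · rw [abs_lt] at hsmall
      constructor <;> intro <;> omega
    · obtain ⟨h00, h01, h10, h11, ht, hf⟩ := map_letterProd_entries hx hy l
      constructor
      · intro htr
        rw [Matrix.trace_fin_two] at htr; omega
      · intro htr
        refine ⟨m, l, ?_, ?_, hk⟩
        · by_contra hc; have := ht hc; omega
        · by_contra hc; have := hf hc; omega

end Trace

namespace OnceHoledTorus

/-- Zero exponents are allowed, so each letter can be its own block, with exponent pair `(1, 0)` or
`(0, 1)`. -/
theorem exists_word_eq_letterProd (l : List Bool) (ht : true ∈ l) (hf : false ∈ l) :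
    ∃ (n : ℕ) (a b : Fin n → ℕ), (∃ i, a i ≠ 0) ∧ (∃ j, b j ≠ 0) ∧
      word a b = letterProd x y l := by
  refine ⟨l.length, fun i => if l[i] then 1 else 0, fun i => if l[i] then 0 else 1, ?_, ?_, ?_⟩
  · obtain ⟨i, hi, h⟩ := List.getElem_of_mem ht
    exact ⟨⟨i, hi⟩, by simp [h]⟩
  · obtain ⟨i, hi, h⟩ := List.getElem_of_mem hf
    exact ⟨⟨i, hi⟩, by simp [h]⟩
  · rw [word, letterProd]
    congr 1
    refine List.ext_getElem (by simp) fun i h1 h2 => ?_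
    simp only [List.getElem_ofFn, List.getElem_map, Fin.getElem_fin]
    split_ifs <;> simp

end OnceHoledTorus

/-! ### Nielsen reduction of pairs in a free group -/

namespace FreeGroup

variable {α : Type*}

theorem exists_common_prefix (A B : List α) : ∃ p A' B' : List α, A = p ++ A' ∧ B = p ++ B' ∧
    ∀ x ∈ A'.head?, ∀ y ∈ B'.head?, x ≠ y := by
  classical
  induction A generalizing B with
  | nil => exact ⟨[], [], B, rfl, rfl, by simp⟩
  | cons a A ih =>
    rcases B with - | ⟨b, B⟩
    · exact ⟨[], a :: A, [], rfl, rfl, by simp⟩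
    · by_cases hab : a = b
      · obtain ⟨p, A', B', rfl, rfl, h⟩ := ih B
        exact ⟨a :: p, A', B', rfl, by simp [hab], h⟩
      · exact ⟨[], a :: A, b :: B, rfl, rfl, by simpa using hab⟩

theorem exists_common_suffix (A B : List α) : ∃ r A' B' : List α, A = A' ++ r ∧ B = B' ++ r ∧
    ∀ x ∈ A'.getLast?, ∀ y ∈ B'.getLast?, x ≠ y := by
  obtain ⟨p, A', B', hA, hB, h⟩ := exists_common_prefix A.reverse B.reverse
  refine ⟨p.reverse, A'.reverse, B'.reverse, ?_, ?_, ?_⟩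
  · simpa using congrArg List.reverse hA
  · simpa using congrArg List.reverse hB
  · simpa using h

theorem isReduced_append_iff {A B : List (α × Bool)} : IsReduced (A ++ B) ↔
    IsReduced A ∧ IsReduced B ∧ ∀ x ∈ A.getLast?, ∀ y ∈ B.head?, x.1 = y.1 → x.2 = y.2 :=
  List.isChain_append

theorem IsReduced.invRev {A : List (α × Bool)} (h : IsReduced A) : IsReduced (invRev A) := by
  rw [isReduced_iff_not_step] at h ⊢
  intro L hL
  rw [← invRev_invRev (L₁ := L), Red.step_invRev_iff] at hL
  exact h _ hL

theorem getLast?_invRev (A : List (α × Bool)) :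
    (FreeGroup.invRev A).getLast? = A.head?.map fun g => (g.1, !g.2) := by
  simp [FreeGroup.invRev]

theorem head?_invRev (A : List (α × Bool)) :
    (FreeGroup.invRev A).head? = A.getLast?.map fun g => (g.1, !g.2) := by
  simp [FreeGroup.invRev]

/-- Cancellation at the junction of `A⁻¹` and `B` would require equal first letters. -/
theorem isReduced_invRev_append {A B : List (α × Bool)} (hA : IsReduced A) (hB : IsReduced B)
    (h : ∀ x ∈ A.head?, ∀ y ∈ B.head?, x ≠ y) : IsReduced (FreeGroup.invRev A ++ B) := by
  refine isReduced_append_iff.2 ⟨hA.invRev, hB, ?_⟩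
  rw [getLast?_invRev]
  rintro x hx y hy hxy
  obtain ⟨z, hz, rfl⟩ := Option.mem_map.1 hx
  have := h z hz y hy
  rcases z with ⟨z1, z2⟩
  rcases y with ⟨y1, y2⟩
  simp only at hxy
  subst hxy
  simp only [ne_eq, Prod.mk.injEq, true_and] at this ⊢
  revert this; cases z2 <;> cases y2 <;> simp

theorem isReduced_append_invRev {A B : List (α × Bool)} (hA : IsReduced A) (hB : IsReduced B)
    (h : ∀ x ∈ A.getLast?, ∀ y ∈ B.getLast?, x ≠ y) : IsReduced (A ++ FreeGroup.invRev B) := by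
  refine isReduced_append_iff.2 ⟨hA, hB.invRev, ?_⟩
  rw [head?_invRev]
  rintro x hx y hy hxy
  obtain ⟨z, hz, rfl⟩ := Option.mem_map.1 hy
  have := h x hx z hz
  rcases z with ⟨z1, z2⟩
  rcases x with ⟨x1, x2⟩
  simp only at hxy
  subst hxy
  simp only [ne_eq, Prod.mk.injEq, true_and] at this ⊢
  revert this; cases z2 <;> cases x2 <;> simp

theorem isCyclicallyReduced_of_append {A M B : List (α × Bool)} (hA : A ≠ []) (hB : B ≠ [])
    (h : IsReduced (A ++ M ++ B)) (hBA : IsReduced (B ++ A)) :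
    IsCyclicallyReduced (A ++ M ++ B) := by
  refine ⟨h, ?_⟩
  have := (isReduced_append_iff.1 hBA).2.2
  rw [List.getLast?_append_of_ne_nil _ hB, List.append_assoc, List.head?_append_of_ne_nil _ hA]
  exact this

variable [DecidableEq α]

theorem IsReduced.norm_mk {A : List (α × Bool)} (h : IsReduced A) : (mk A).norm = A.length := by
  rw [norm, toWord_mk, h.reduce_eq]

omit [DecidableEq α] in
theorem mk_pow (A : List (α × Bool)) (n : ℕ) : mk A ^ n = mk (List.replicate n A).flatten := by
  induction n with
  | zero => rfl
  | succ n ih => rw [pow_succ', ih, mul_mk, List.replicate_succ, List.flatten_cons]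

theorem norm_pow_le (g : FreeGroup α) (n : ℕ) : (g ^ n).norm ≤ n * g.norm := by
  induction n with
  | zero => simp
  | succ n ih =>
    rw [pow_succ]
    calc _ ≤ (g ^ n).norm + g.norm := norm_mul_le _ _
      _ ≤ _ := by rw [add_mul, one_mul]; omega

/-- A cyclically reduced word is of minimal length in its conjugacy class. -/
theorem IsCyclicallyReduced.length_le {A : List (α × Bool)} (h : IsCyclicallyReduced A)
    {g : FreeGroup α} (hg : IsConj g (mk A)) : A.length ≤ g.norm := by
  obtain ⟨c, hc⟩ := isConj_iff.1 hg
  by_contra! hlt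
  -- Conjugation changes the length of a power by at most `2 * c.norm`, while the length of powers
  -- of a cyclically reduced word grows linearly at full rate. This `n` is the first exponent for
  -- which a shorter conjugate is impossible.
  set n := 2 * c.norm + 1
  have h1 : (mk A ^ n).norm = n * A.length := by
    rw [mk_pow, (h.flatten_replicate n).isReduced.norm_mk]
    simp
  have h2 : (mk A ^ n).norm ≤ c.norm + n * g.norm + c.norm := by
    rw [← hc, conj_pow]
    refine (norm_mul_le _ _).trans ?_
    rw [norm_inv_eq]
    have := norm_mul_le c (g ^ n)
    have := norm_pow_le g n
    omega
  have h3 : n * (g.norm + 1) ≤ n * A.length := Nat.mul_le_mul_left _ hlt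
  rw [mul_add] at h3
  omega

/-- A set of pairs of elements of a free group that is closed under simultaneous conjugation and
under the elementary transformations that preserve the conjugacy class of the commutator. -/
structure NielsenClosed (O : FreeGroup α → FreeGroup α → Prop) : Prop where
  intro ::
  conj : ∀ {u v} (g), O u v → O (g * u * g⁻¹) (g * v * g⁻¹)
  right_mul : ∀ {u v}, O u v → O u (u * v)
  right_inv_mul : ∀ {u v}, O u v → O u (u⁻¹ * v)
  left_mul : ∀ {u v}, O u v → O (v * u) v
  left_inv_mul : ∀ {u v}, O u v → O (v⁻¹ * u) v

/-- A pair of minimal total length in a set of pairs. -/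
def MinimalIn (O : FreeGroup α → FreeGroup α → Prop) (u v : FreeGroup α) : Prop :=
  O u v ∧ ∀ u' v', O u' v' → u.norm + v.norm ≤ u'.norm + v'.norm

namespace NielsenClosed

variable {O : FreeGroup α → FreeGroup α → Prop}

omit [DecidableEq α] in
theorem right_mul_inv (hO : NielsenClosed O) {u v : FreeGroup α} (h : O u v) : O u (v * u⁻¹) := by
  have := hO.conj u (hO.right_inv_mul h)
  simpa [mul_assoc] using this

omit [DecidableEq α] in
theorem left_mul_inv (hO : NielsenClosed O) {u v : FreeGroup α} (h : O u v) : O (u * v⁻¹) v := by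
  have := hO.conj v (hO.left_inv_mul h)
  simpa [mul_assoc] using this

-- The quarter turn is a composite of the elementary moves: `(u, v)`, `(u, uv)`, `(v⁻¹, uv)`, `(v⁻¹,
-- v⁻¹uv)`, then conjugation by `v`. It preserves total length, so a statement about the first
-- letters of a minimal pair yields the same statement about its last letters.
omit [DecidableEq α] in
theorem rotate (hO : NielsenClosed O) {u v : FreeGroup α} (h : O u v) : O v⁻¹ u := by
  have h1 := hO.left_inv_mul (hO.right_mul h)
  have h2 := hO.conj v (hO.right_mul h1)
  simpa [mul_assoc] using h2

theorem minimal_rotate (hO : NielsenClosed O) {u v : FreeGroup α} (h : MinimalIn O u v) :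
    MinimalIn O v⁻¹ u := by
  refine ⟨hO.rotate h.1, fun u' v' h' => ?_⟩
  have := h.2 u' v' h'
  rw [norm_inv_eq]; omega

/-- Of the first letters of `u`, `v` and their inverses, no three coincide. -/
theorem head_last_of_minimal_conj {A B : List (α × Bool)}
    (hA : IsReduced A) (hB : IsReduced B)
    (h : ∀ g, (mk A).norm + (mk B).norm ≤ (g * mk A * g⁻¹).norm + (g * mk B * g⁻¹).norm)
    {l : α × Bool}
    (hAh : l ∈ A.head?) (hAl : (l.1, !l.2) ∈ A.getLast?)
    (hBh : l ∈ B.head? ∨ (l.1, !l.2) ∈ B.getLast?) : False := by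
  have hln : l ≠ (l.1, !l.2) := fun h => by
    have := congrArg Prod.snd h
    simp at this
  obtain ⟨A', rfl⟩ : ∃ A', A = l :: A' ++ [(l.1, !l.2)] := by
    rcases A with - | ⟨a, A⟩
    · simp at hAh
    obtain rfl : a = l := by simpa using hAh
    rcases List.eq_nil_or_concat A with rfl | ⟨A', b, rfl⟩
    · exact absurd (by simpa using hAl) hln
    · refine ⟨A', ?_⟩
      rw [List.concat_eq_append, ← List.cons_append, List.getLast?_append_of_ne_nil _ (by simp)]
        at hAl
      simp at hAl
      simp [hAl]
  have hl : mk [(l.1, !l.2)] = (mk [l])⁻¹ := by rw [inv_mk]; rfl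
  -- Conjugating by the inverse of the common letter strips both ends of `A`, saving two, and only
  -- rotates `B`, which does not lengthen it.
  have hmin := h (mk [l])⁻¹
  have e1 : (mk [l])⁻¹ * mk (l :: A' ++ [(l.1, !l.2)]) * (mk [l])⁻¹⁻¹ = mk A' := by
    have : mk (l :: A' ++ [(l.1, !l.2)]) = mk [l] * mk A' * (mk [l])⁻¹ := by
      rw [← hl, mul_mk, mul_mk]; rfl
    rw [this]; group
  have h1 : (mk A').norm ≤ A'.length := norm_mk_le
  rw [e1, hA.norm_mk, hB.norm_mk] at hmin
  have h2 : ((mk [l])⁻¹ * mk B * (mk [l])⁻¹⁻¹).norm ≤ B.length := by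
    rcases hBh with hBh | hBl
    · obtain ⟨B', rfl⟩ : ∃ B', B = l :: B' := by
        rcases B with - | ⟨b, B⟩
        · simp at hBh
        · exact ⟨B, by simpa using hBh⟩
      have : (mk [l])⁻¹ * mk (l :: B') * (mk [l])⁻¹⁻¹ = mk (B' ++ [l]) := by
        rw [show mk (l :: B') = mk [l] * mk B' by rw [mul_mk]; rfl, ← mul_mk]; group
      rw [this]
      exact norm_mk_le.trans (by simp)
    · obtain ⟨B', rfl⟩ : ∃ B', B = B' ++ [(l.1, !l.2)] := by
        rcases List.eq_nil_or_concat B with rfl | ⟨B', b, rfl⟩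
        · simp at hBl
        · exact ⟨B', by simpa using hBl⟩
      have : (mk [l])⁻¹ * mk (B' ++ [(l.1, !l.2)]) * (mk [l])⁻¹⁻¹ =
          mk ((l.1, !l.2) :: B') := by
        rw [← mul_mk, hl, show mk ((l.1, !l.2) :: B') = mk [(l.1, !l.2)] * mk B' by
          rw [mul_mk]; rfl, hl]
        group
      rw [this]
      exact norm_mk_le.trans (by simp)
  simp only [List.length_append, List.length_cons, List.length_nil] at hmin
  omega

/-- In a minimal pair with a common suffix, the remaining parts are nontrivial. -/
theorem minimal_suffix_ne_nil (hO : NielsenClosed O) {A B r : List (α × Bool)} (hr : r ≠ [])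
    (hA : IsReduced (A ++ r)) (hB : IsReduced (B ++ r))
    (h : MinimalIn O (mk (A ++ r)) (mk (B ++ r))) : A ≠ [] ∧ B ≠ [] := by
  have hr' := List.length_pos_iff.2 hr
  constructor
  · rintro rfl
    -- If one element were exactly the common suffix, dividing it out of the other would shorten the
    -- pair.
    have := h.2 _ _ (hO.right_mul_inv h.1)
    rw [hA.norm_mk, hB.norm_mk, ← mul_mk, List.nil_append, mul_inv_cancel_right] at this
    have h1 : (mk B).norm ≤ B.length := norm_mk_le
    simp at this
    omega
  · rintro rfl
    have := h.2 _ _ (hO.left_mul_inv h.1)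
    rw [hA.norm_mk, hB.norm_mk, ← mul_mk, List.nil_append, mul_inv_cancel_right] at this
    have h1 : (mk A).norm ≤ A.length := norm_mk_le
    simp at this
    omega

/-- A minimal pair with distinct first letters whose commutator is conjugate to an element of
length at most `4` has no common last letter. -/
theorem minimal_suffix_eq_nil (hO : NielsenClosed O) {c : FreeGroup α} (hc : c.norm ≤ 4)
    {A B r : List (α × Bool)}
    (hA : IsReduced (A ++ r)) (hB : IsReduced (B ++ r))
    (h : MinimalIn O (mk (A ++ r)) (mk (B ++ r)))
    (hcomm : IsConj c ((mk (A ++ r))⁻¹ * (mk (B ++ r))⁻¹ * mk (A ++ r) * mk (B ++ r)))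
    (hhead : ∀ x ∈ (A ++ r).head?, ∀ y ∈ (B ++ r).head?, x ≠ y)
    (hlast : ∀ x ∈ A.getLast?, ∀ y ∈ B.getLast?, x ≠ y) : r = [] := by
  by_contra hr
  obtain ⟨hAn, hBn⟩ := hO.minimal_suffix_ne_nil hr hA hB h
  have hA' := (isReduced_append_iff.1 hA).1
  have hB' := (isReduced_append_iff.1 hB).1
  have hr' := (isReduced_append_iff.1 hA).2.1
  have hinv : ∀ x y : α × Bool, x.1 = y.1 → (x.2 = y.2) ∨ x = (y.1, !y.2) := by
    rintro ⟨x1, x2⟩ ⟨y1, y2⟩ h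
    simp only at h
    subst h
    cases x2 <;> cases y2 <;> simp
  -- A cancellation between `r` and `A` would mean that `A ++ r` begins with a letter and ends with
  -- its inverse, an inverse that `B ++ r` also ends with. This is the triple coincidence excluded
  -- above.
  have hrA : IsReduced (r ++ A) := by
    refine isReduced_append_iff.2 ⟨hr', hA', fun x hx y hy hxy => ?_⟩
    rcases hinv x y hxy with h' | rfl
    · exact h'
    · exfalso
      refine head_last_of_minimal_conj hA hB (fun g => h.2 _ _ (hO.conj g h.1)) (l := y)
        ?_ ?_ (Or.inr ?_)
      · rwa [List.head?_append_of_ne_nil _ hAn]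
      · rwa [List.getLast?_append_of_ne_nil _ hr]
      · rwa [List.getLast?_append_of_ne_nil _ hr]
  have hrB : IsReduced (r ++ B) := by
    refine isReduced_append_iff.2 ⟨hr', hB', fun x hx y hy hxy => ?_⟩
    rcases hinv x y hxy with h' | rfl
    · exact h'
    · exfalso
      refine head_last_of_minimal_conj hB hA (l := y) (fun g => ?_) ?_ ?_ (Or.inr ?_)
      · have := h.2 _ _ (hO.conj g h.1)
        omega
      · rwa [List.head?_append_of_ne_nil _ hBn]
      · rwa [List.getLast?_append_of_ne_nil _ hr]
      · rwa [List.getLast?_append_of_ne_nil _ hr]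
  have hAB : IsReduced (FreeGroup.invRev B ++ A) := by
    refine isReduced_invRev_append hB' hA' ?_
    rw [List.head?_append_of_ne_nil _ hAn, List.head?_append_of_ne_nil _ hBn] at hhead
    exact fun x hx y hy => (hhead y hy x hx).symm
  have hBA : IsReduced (B ++ FreeGroup.invRev A) :=
    isReduced_append_invRev hB' hA' fun x hx y hy => (hlast y hy x hx).symm
  have hne : ∀ L : List (α × Bool), L ≠ [] → FreeGroup.invRev L ≠ [] := fun L hL h' => hL (by
    simpa using congrArg FreeGroup.invRev h')
  have hAr : IsReduced (FreeGroup.invRev A ++ FreeGroup.invRev r) := by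
    rw [← invRev_append]; exact hrA.invRev
  have hrB' : IsReduced (FreeGroup.invRev r ++ FreeGroup.invRev B) := by
    rw [← invRev_append]; exact hB.invRev
  -- After conjugation by `r`, the commutator becomes `A⁻¹ r⁻¹ B⁻¹ A r B`. It is cyclically reduced,
  -- so with all three pieces nonempty its length is at least six, against the bound of four.
  have hcyc : IsCyclicallyReduced (FreeGroup.invRev A ++
      (FreeGroup.invRev r ++ FreeGroup.invRev B ++ A ++ r) ++ B) := by
    refine isCyclicallyReduced_of_append (hne _ hAn) hBn ?_ hBA
    rw [← List.append_assoc, ← List.append_assoc, ← List.append_assoc]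
    refine IsReduced.append_overlap ?_ hrB hr
    refine IsReduced.append_overlap ?_ hA hAn
    refine IsReduced.append_overlap ?_ hAB (hne _ hBn)
    exact IsReduced.append_overlap hAr hrB' (hne _ hr)
  have hconj : IsConj c (mk (FreeGroup.invRev A ++
      (FreeGroup.invRev r ++ FreeGroup.invRev B ++ A ++ r) ++ B)) := by
    refine hcomm.trans (isConj_iff.2 ⟨mk r, ?_⟩)
    simp only [← mul_mk, ← inv_mk]
    group
  have := hcyc.length_le hconj
  have h1 := List.length_pos_iff.2 hr
  have h2 := List.length_pos_iff.2 hAn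
  have h3 := List.length_pos_iff.2 hBn
  simp at this
  omega

/-- The elements of a minimal pair whose commutator is conjugate to an element of length at most
`4` have no common first letter. -/
theorem minimal_head_ne (hO : NielsenClosed O) {c : FreeGroup α} (hc : c.norm ≤ 4)
    (hcomm : ∀ u v, O u v → IsConj c (u⁻¹ * v⁻¹ * u * v)) {A B : List (α × Bool)}
    (hA : IsReduced A) (hB : IsReduced B) (h : MinimalIn O (mk A) (mk B)) :
    ∀ x ∈ A.head?, ∀ y ∈ B.head?, x ≠ y := by
  rintro x hx _ hy rfl
  obtain ⟨p, A, B, rfl, rfl, hh⟩ := exists_common_prefix A B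
  have hp : p ≠ [] := by
    rintro rfl
    exact hh x hx x hy rfl
  have e : ∀ L, (mk p)⁻¹ * mk (p ++ L) * (mk p)⁻¹⁻¹ = mk (L ++ p) := fun L => by
    rw [← mul_mk, ← mul_mk]; group
  -- Conjugation carries the common prefix to the end, producing a common suffix in a pair whose
  -- first letters now differ.
  have h1 := hO.conj (mk p)⁻¹ h.1
  rw [e, e] at h1
  have h2 := h.2 _ _ h1
  rw [hA.norm_mk, hB.norm_mk] at h2
  -- The new words have the same total length as the minimal pair, so neither can reduce further,
  -- and the new pair is again minimal.
  have hred : ∀ L : List (α × Bool), L.length ≤ (mk L).norm → IsReduced L := fun L hL => by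
    refine IsReduced.of_reduce_eq ?_
    exact (reduce.red.sublist).eq_of_length_le (by rwa [norm, toWord_mk] at hL)
  have h3 : (mk (A ++ p)).norm ≤ (A ++ p).length := norm_mk_le
  have h4 : (mk (B ++ p)).norm ≤ (B ++ p).length := norm_mk_le
  simp only [List.length_append] at h2 h3 h4
  have hA' : IsReduced (A ++ p) := hred _ (by rw [List.length_append]; omega)
  have hB' : IsReduced (B ++ p) := hred _ (by rw [List.length_append]; omega)
  have hmin : MinimalIn O (mk (A ++ p)) (mk (B ++ p)) := by
    refine ⟨h1, fun u' v' h' => le_trans ?_ (h.2 u' v' h')⟩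
    rw [hA.norm_mk, hB.norm_mk]
    simp only [List.length_append]
    omega
  obtain ⟨hAn, hBn⟩ := hO.minimal_suffix_ne_nil hp hA' hB' hmin
  have hhead : ∀ x ∈ (A ++ p).head?, ∀ y ∈ (B ++ p).head?, x ≠ y := by
    rw [List.head?_append_of_ne_nil _ hAn, List.head?_append_of_ne_nil _ hBn]
    exact hh
  have hl : (A ++ p).getLast? = (B ++ p).getLast? := by
    rw [List.getLast?_append_of_ne_nil _ hp, List.getLast?_append_of_ne_nil _ hp]
  have hl' : (A ++ p).getLast? ≠ none := by simp [hp]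
  generalize A ++ p = A' at *
  generalize B ++ p = B' at *
  -- The maximal common suffix is empty by the preceding result, yet both words end with the
  -- nonempty `p`.
  obtain ⟨r, A, B, rfl, rfl, hlast⟩ := exists_common_suffix A' B'
  obtain rfl := hO.minimal_suffix_eq_nil hc hA' hB' hmin (hcomm _ _ hmin.1) hhead hlast
  rw [List.append_nil, List.append_nil] at hl
  rw [List.append_nil] at hl'
  obtain ⟨y, hy⟩ := Option.ne_none_iff_exists'.1 hl'
  exact hlast y hy y (hl ▸ hy) rfl

/-- A minimal pair whose commutator is conjugate to a nontrivial element of length at most `4`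
consists of letters. -/
theorem norm_add_norm_le (hO : NielsenClosed O) {c : FreeGroup α} (hc : c.norm ≤ 4) (hc1 : c ≠ 1)
    (hcomm : ∀ u v, O u v → IsConj c (u⁻¹ * v⁻¹ * u * v)) {u v : FreeGroup α}
    (h : MinimalIn O u v) : u.norm + v.norm ≤ 2 := by
  have key : ∀ u v : FreeGroup α, MinimalIn O u v →
      ∀ x ∈ u.toWord.head?, ∀ y ∈ v.toWord.head?, x ≠ y := fun u v h =>
    hO.minimal_head_ne hc hcomm isReduced_toWord isReduced_toWord (by rwa [mk_toWord, mk_toWord])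
  -- The four quarter turns of the pair control the four junctions of the cyclic word `u⁻¹ v⁻¹ u v`.
  have h1 := hO.minimal_rotate h
  have h2 := hO.minimal_rotate h1
  have h3 := hO.minimal_rotate h2
  rw [inv_inv] at h3
  have k0 := key _ _ h
  have k1 := key _ _ h1
  have k2 := key _ _ h2
  have k3 := key _ _ h3
  have hconj := hcomm u v h.1
  rw [toWord_inv] at k1 k2 k3
  rw [toWord_inv] at k2
  have hA : IsReduced u.toWord := isReduced_toWord
  have hB : IsReduced v.toWord := isReduced_toWord
  have hne : ∀ L : List (α × Bool), L ≠ [] → FreeGroup.invRev L ≠ [] := fun L hL h' => hL (by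
    simpa using congrArg FreeGroup.invRev h')
  have hu : u.toWord ≠ [] := by
    intro hu
    rw [toWord_eq_nil_iff] at hu
    subst hu
    simp at hconj
    exact hc1 hconj
  have hv : v.toWord ≠ [] := by
    intro hv
    rw [toWord_eq_nil_iff] at hv
    subst hv
    simp at hconj
    exact hc1 hconj
  have e : u⁻¹ * v⁻¹ * u * v = mk (FreeGroup.invRev u.toWord ++
      (FreeGroup.invRev v.toWord ++ u.toWord) ++ v.toWord) := by
    simp only [← mul_mk, ← inv_mk, mk_toWord, mul_assoc]
  rw [e] at hconj
  -- Without cancellation the commutator has length `2 * (u.norm + v.norm)`, which is minimal in its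
  -- conjugacy class and hence at most four.
  have hcyc : IsCyclicallyReduced (FreeGroup.invRev u.toWord ++
      (FreeGroup.invRev v.toWord ++ u.toWord) ++ v.toWord) := by
    refine isCyclicallyReduced_of_append (hne _ hu) hv ?_ ?_
    · rw [← List.append_assoc]
      refine IsReduced.append_overlap ?_ ?_ hu
      · refine IsReduced.append_overlap ?_ ?_ (hne _ hv)
        · exact isReduced_invRev_append hA hB.invRev fun x hx y hy => (k1 y hy x hx).symm
        · exact isReduced_invRev_append hB hA fun x hx y hy => (k0 y hy x hx).symm
      · have := isReduced_invRev_append hA.invRev hB fun x hx y hy => (k3 y hy x hx).symm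
        rwa [invRev_invRev] at this
    · have := isReduced_invRev_append hB.invRev hA.invRev fun x hx y hy => (k2 y hy x hx).symm
      rwa [invRev_invRev] at this
  have := hcyc.length_le hconj
  simp only [List.length_append, invRev_length] at this
  rw [norm, norm]
  omega

end NielsenClosed

theorem exists_minimalIn {O : FreeGroup α → FreeGroup α → Prop} {u v : FreeGroup α} (h : O u v) :
    ∃ u' v', MinimalIn O u' v' := by
  have hne : {n | ∃ u v, O u v ∧ u.norm + v.norm = n}.Nonempty := ⟨_, u, v, h, rfl⟩
  obtain ⟨u', v', h1, h2⟩ := Nat.sInf_mem hne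
  refine ⟨u', v', h1, fun u'' v'' h'' => ?_⟩
  rw [h2]
  exact Nat.sInf_le ⟨u'', v'', h'', rfl⟩

end FreeGroup

/-! ### Commuting elements of a free group -/

namespace FreeGroup

/-- Commuting elements of a free group are powers of a common element. -/
theorem exists_zpow_of_commute {α : Type*} {g h : FreeGroup α} (hgh : Commute g h) :
    ∃ (d : FreeGroup α) (m n : ℤ), g = d ^ m ∧ h = d ^ n := by
  set H : Subgroup (FreeGroup α) := Subgroup.closure {g, h} with hH
  have hcomm : ∀ u v : H, u * v = v * u := by
    have := Subgroup.isMulCommutative_closure (k := {g, h}) (by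
      rintro u (rfl | rfl) v (rfl | rfl)
      · rfl
      · exact hgh
      · exact hgh.symm
      · rfl)
    exact fun u v => this.is_comm.comm u v
  -- By the Nielsen–Schreier theorem the commutative subgroup is free; it remains to see that its
  -- rank is at most one.
  have : IsFreeGroup H := inferInstance
  let e := IsFreeGroup.toFreeGroup H
  have hsub : Subsingleton (IsFreeGroup.Generators H) := by
    refine ⟨fun i j => ?_⟩
    by_contra hij
    have h1 : e.symm (of i) * e.symm (of j) = e.symm (of j) * e.symm (of i) := hcomm _ _
    rw [← _root_.map_mul, ← _root_.map_mul] at h1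
    have h2 := e.symm.injective h1
    classical
    -- Two distinct free generators cannot commute, since they can be sent to noncommuting
    -- transpositions of three points.
    have h3 := congrArg (FreeGroup.lift fun k => if k = i then
      (Equiv.swap (0 : Fin 3) 1) else Equiv.swap (1 : Fin 3) 2) h2
    simp only [_root_.map_mul, lift_apply_of, if_true, if_neg (Ne.symm hij)] at h3
    exact absurd h3 (by decide)
  obtain ⟨d, hd⟩ : ∃ d : H, ∀ u : H, ∃ n : ℤ, u = d ^ n := by
    rcases isEmpty_or_nonempty (IsFreeGroup.Generators H) with he | ⟨⟨i⟩⟩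
    · refine ⟨1, fun u => ⟨0, ?_⟩⟩
      apply e.injective
      exact Subsingleton.elim _ _
    · refine ⟨e.symm (of i), fun u => ?_⟩
      obtain ⟨w, rfl⟩ := e.symm.surjective u
      induction w using FreeGroup.induction_on with
      | C1 => exact ⟨0, by simp⟩
      | of j => exact ⟨1, by rw [Subsingleton.elim j i]; simp⟩
      | inv_of j hj => exact ⟨-1, by rw [Subsingleton.elim j i]; simp⟩
      | mul u v hu hv =>
        obtain ⟨m, hm⟩ := hu
        obtain ⟨n, hn⟩ := hv
        exact ⟨m + n, by rw [_root_.map_mul, hm, hn, zpow_add]⟩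
  obtain ⟨m, hm⟩ := hd ⟨g, Subgroup.subset_closure (by simp)⟩
  obtain ⟨n, hn⟩ := hd ⟨h, Subgroup.subset_closure (by simp)⟩
  exact ⟨d, m, n, by simpa using congrArg Subtype.val hm, by simpa using congrArg Subtype.val hn⟩

end FreeGroup

/-! ### The Heisenberg group, a nilpotent quotient that detects the commutator -/

/-- The integral Heisenberg group. -/
@[ext]
structure Heisenberg where
  fst : ℤ
  snd : ℤ
  center : ℤ
deriving DecidableEq

namespace Heisenberg

instance : One Heisenberg := ⟨⟨0, 0, 0⟩⟩
instance : Mul Heisenberg :=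
  ⟨fun u v => ⟨u.fst + v.fst, u.snd + v.snd, u.center + v.center + u.fst * v.snd⟩⟩
instance : Inv Heisenberg := ⟨fun u => ⟨-u.fst, -u.snd, -u.center + u.fst * u.snd⟩⟩

theorem one_def : (1 : Heisenberg) = ⟨0, 0, 0⟩ := rfl
theorem mul_def (u v : Heisenberg) : u * v =
  ⟨u.fst + v.fst, u.snd + v.snd, u.center + v.center + u.fst * v.snd⟩ := rfl
theorem inv_def (u : Heisenberg) : u⁻¹ = ⟨-u.fst, -u.snd, -u.center + u.fst * u.snd⟩ := rfl

instance : Group Heisenberg :=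
  Group.ofLeftAxioms
    (fun u v w => by ext <;> simp only [mul_def] <;> ring)
    (fun u => by ext <;> simp [mul_def, one_def])
    (fun u => by ext <;> simp only [mul_def, inv_def, one_def] <;> ring)

theorem zpow_fst (u : Heisenberg) (n : ℤ) : (u ^ n).fst = n * u.fst := by
  let f : Heisenberg →* Multiplicative ℤ :=
    { toFun := fun u => Multiplicative.ofAdd u.fst, map_one' := rfl, map_mul' := fun _ _ => rfl }
  have := map_zpow f u n
  exact (congrArg Multiplicative.toAdd this).trans (by rw [toAdd_zpow, smul_eq_mul]; rfl)

theorem zpow_snd (u : Heisenberg) (n : ℤ) : (u ^ n).snd = n * u.snd := by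
  let f : Heisenberg →* Multiplicative ℤ :=
    { toFun := fun u => Multiplicative.ofAdd u.snd, map_one' := rfl, map_mul' := fun _ _ => rfl }
  have := map_zpow f u n
  exact (congrArg Multiplicative.toAdd this).trans (by rw [toAdd_zpow, smul_eq_mul]; rfl)

theorem zpow_center (k n : ℤ) : (⟨0, 0, k⟩ : Heisenberg) ^ n = ⟨0, 0, n * k⟩ := by
  let f : Multiplicative ℤ →* Heisenberg :=
    { toFun := fun k => ⟨0, 0, k.toAdd⟩, map_one' := rfl
      map_mul' := fun _ _ => by simp [mul_def] }
  have := map_zpow f (Multiplicative.ofAdd k) n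
  exact this.symm.trans (by simp [f])

theorem commute_center (k : ℤ) (u : Heisenberg) : u * ⟨0, 0, k⟩ = ⟨0, 0, k⟩ * u := by
  ext <;> simp [mul_def, add_comm]

end Heisenberg

/-! ### Automorphisms of the free group of rank two that fix the commutator -/

namespace OnceHoledTorus

open FreeGroup

/-- The free group of rank two. -/
abbrev F₂ : Type := FreeGroup (Fin 2)

/-- The first generator. -/
def genA : F₂ := of 0

/-- The second generator. -/
def genB : F₂ := of 1

/-- The commutator that represents the boundary. -/
def boundaryWord : F₂ := genA⁻¹ * genB⁻¹ * genA * genB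

/-- A homomorphism from the free group, by the images of the generators. -/
def homOf (u v : F₂) : F₂ →* F₂ := FreeGroup.lift ![u, v]

@[simp] theorem homOf_genA (u v : F₂) : homOf u v genA = u := by simp [homOf, genA]
@[simp] theorem homOf_genB (u v : F₂) : homOf u v genB = v := by simp [homOf, genB]

theorem hom_ext_gen {G : Type*} [Group G] {f g : F₂ →* G} (ha : f genA = g genA)
    (hb : f genB = g genB) : f = g := by
  ext i
  fin_cases i
  · exact ha
  · exact hb

theorem mulAut_ext_gen {f g : MulAut F₂} (ha : f genA = g genA) (hb : f genB = g genB) : f = g :=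
  MulEquiv.ext fun w => DFunLike.congr_fun (hom_ext_gen (f := f.toMonoidHom) (g := g.toMonoidHom) ha hb) w

/-- The automorphism `a ↦ a`, `b ↦ ab`. -/
def autX : MulAut F₂ :=
  MonoidHom.toMulEquiv (homOf genA (genA * genB)) (homOf genA (genA⁻¹ * genB))
    (hom_ext_gen (by simp) (by simp)) (hom_ext_gen (by simp) (by simp))

/-- The automorphism `a ↦ b⁻¹a`, `b ↦ b`. -/
def autY : MulAut F₂ :=
  MonoidHom.toMulEquiv (homOf (genB⁻¹ * genA) genB) (homOf (genB * genA) genB)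
    (hom_ext_gen (by simp) (by simp)) (hom_ext_gen (by simp) (by simp))

@[simp] theorem autX_genA : autX genA = genA := homOf_genA genA (genA * genB)
@[simp] theorem autX_genB : autX genB = genA * genB := homOf_genB genA (genA * genB)
@[simp] theorem autY_genA : autY genA = genB⁻¹ * genA := homOf_genA (genB⁻¹ * genA) genB
@[simp] theorem autY_genB : autY genB = genB := homOf_genB (genB⁻¹ * genA) genB
@[simp] theorem autX_inv_genA : autX⁻¹ genA = genA := homOf_genA genA (genA⁻¹ * genB)
@[simp] theorem autX_inv_genB : autX⁻¹ genB = genA⁻¹ * genB := homOf_genB genA (genA⁻¹ * genB)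
@[simp] theorem autY_inv_genA : autY⁻¹ genA = genB * genA := homOf_genA (genB * genA) genB
@[simp] theorem autY_inv_genB : autY⁻¹ genB = genB := homOf_genB (genB * genA) genB

theorem autX_mul_autY_mul_autX : autX * autY * autX = autY * autX * autY :=
  mulAut_ext_gen (by simp [mul_assoc]) (by simp [mul_assoc])

theorem autX_mul_autY_pow_six : (autX * autY) ^ 6 = MulAut.conj boundaryWord⁻¹ :=
  mulAut_ext_gen (by simp [pow_succ, boundaryWord, mul_assoc])
    (by simp [pow_succ, boundaryWord, mul_assoc])

theorem apply_boundaryWord_of_mem_closure {τ : MulAut F₂}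
    (hτ : τ ∈ Subgroup.closure {autX, autY}) : τ boundaryWord = boundaryWord := by
  have : Subgroup.closure {autX, autY} ≤ MulAction.stabilizer (MulAut F₂) boundaryWord := by
    rw [Subgroup.closure_le]
    rintro τ (rfl | rfl) <;> simp [MulAction.mem_stabilizer_iff, boundaryWord, mul_assoc]
  exact this hτ

/-- The homomorphism to the Heisenberg group. -/
def toHeisenberg : F₂ →* Heisenberg := FreeGroup.lift ![⟨1, 0, 0⟩, ⟨0, 1, 0⟩]

/-- The image generates the center, so the word is neither trivial nor a proper power, and the sign
of a commutator of letters is visible. -/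
theorem toHeisenberg_boundaryWord : toHeisenberg boundaryWord = ⟨0, 0, 1⟩ := by
  simp [toHeisenberg, boundaryWord, genA, genB]
  decide

theorem boundaryWord_ne_one : boundaryWord ≠ 1 := by
  intro h
  have := toHeisenberg_boundaryWord
  rw [h, _root_.map_one] at this
  exact absurd this (by decide)

theorem norm_boundaryWord_le : boundaryWord.norm ≤ 4 := by
  have : boundaryWord = mk [(0, false), (1, false), (0, true), (1, true)] := rfl
  rw [this]
  exact norm_mk_le

/-- The centralizer of the boundary word consists of its powers. -/
theorem exists_zpow_boundaryWord {g : F₂} (h : Commute g boundaryWord) :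
    ∃ n : ℤ, g = boundaryWord ^ n := by
  obtain ⟨d, m, n, rfl, hn⟩ := exists_zpow_of_commute h
  have h1 := congrArg toHeisenberg hn
  rw [toHeisenberg_boundaryWord, map_zpow] at h1
  have hn0 : n ≠ 0 := by
    rintro rfl
    exact absurd h1 (by rw [zpow_zero]; decide)
  -- A root of the boundary word has central image, and central coordinates are additive. The
  -- exponent therefore divides `1`.
  have e1 : (toHeisenberg d).fst = 0 := by
    have := congrArg Heisenberg.fst h1
    rw [Heisenberg.zpow_fst] at this
    simpa [hn0] using this.symm
  have e2 : (toHeisenberg d).snd = 0 := by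
    have := congrArg Heisenberg.snd h1
    rw [Heisenberg.zpow_snd] at this
    simpa [hn0] using this.symm
  have e3 : toHeisenberg d = ⟨0, 0, (toHeisenberg d).center⟩ := by ext <;> simp [e1, e2]
  rw [e3, Heisenberg.zpow_center] at h1
  have h2 : n * (toHeisenberg d).center = 1 := (congrArg Heisenberg.center h1).symm
  rcases Int.eq_one_or_neg_one_of_mul_eq_one h2 with rfl | rfl
  · exact ⟨m, by rw [hn, zpow_one]⟩
  · exact ⟨-m, by rw [hn]; simp⟩

end OnceHoledTorus

namespace FreeGroup

theorem exists_of_norm_eq_one {α : Type*} [DecidableEq α] {u : FreeGroup α} (h : u.norm = 1) :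
    ∃ l : α × Bool, u = mk [l] := by
  obtain ⟨l, hl⟩ := List.length_eq_one_iff.1 h
  exact ⟨l, by rw [← hl, mk_toWord]⟩

end FreeGroup

namespace OnceHoledTorus

open FreeGroup

/-- The pairs conjugate to the images of the generators under `ψ ∘ τ`, for `τ` generated by
`autX` and `autY`. -/
def NielsenOrbit (ψ : F₂ →* F₂) (u v : F₂) : Prop :=
  ∃ g : F₂, ∃ τ ∈ Subgroup.closure {autX, autY}, g * ψ (τ genA) * g⁻¹ = u ∧ g * ψ (τ genB) * g⁻¹ = v

theorem nielsenClosed_nielsenOrbit (ψ : F₂ →* F₂) : NielsenClosed (NielsenOrbit ψ) := by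
  have hX : autX ∈ Subgroup.closure {autX, autY} := Subgroup.subset_closure (by simp)
  have hY : autY ∈ Subgroup.closure {autX, autY} := Subgroup.subset_closure (by simp)
  constructor
  · rintro u v h ⟨g, τ, hτ, rfl, rfl⟩
    exact ⟨h * g, τ, hτ, by group, by group⟩
  · rintro u v ⟨g, τ, hτ, rfl, rfl⟩
    exact ⟨g, τ * autX, mul_mem hτ hX, by simp, by simp [_root_.map_mul, mul_assoc]⟩
  · rintro u v ⟨g, τ, hτ, rfl, rfl⟩
    exact ⟨g, τ * autX⁻¹, mul_mem hτ (inv_mem hX), by rw [MulAut.mul_apply, autX_inv_genA],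
      by simp only [MulAut.mul_apply, autX_inv_genB, _root_.map_mul, _root_.map_inv]; group⟩
  · rintro u v ⟨g, τ, hτ, rfl, rfl⟩
    exact ⟨g, τ * autY⁻¹, mul_mem hτ (inv_mem hY),
      by simp only [MulAut.mul_apply, autY_inv_genA, _root_.map_mul]; group,
      by rw [MulAut.mul_apply, autY_inv_genB]⟩
  · rintro u v ⟨g, τ, hτ, rfl, rfl⟩
    exact ⟨g, τ * autY, mul_mem hτ hY, by simp [_root_.map_mul, mul_assoc], by simp⟩

theorem isConj_of_nielsenOrbit {ψ : F₂ →* F₂} (hψ : ψ boundaryWord = boundaryWord) {u v : F₂}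
    (h : NielsenOrbit ψ u v) : IsConj boundaryWord (u⁻¹ * v⁻¹ * u * v) := by
  obtain ⟨g, τ, hτ, rfl, rfl⟩ := h
  rw [isConj_iff]
  refine ⟨g, ?_⟩
  have h1 := congrArg ψ (apply_boundaryWord_of_mem_closure hτ)
  rw [hψ] at h1
  conv_lhs => rw [← h1]
  simp only [boundaryWord, _root_.map_mul, _root_.map_inv]
  group

theorem toHeisenberg_of_isConj {w : F₂} (h : IsConj boundaryWord w) :
    toHeisenberg w = ⟨0, 0, 1⟩ := by
  obtain ⟨g, rfl⟩ := isConj_iff.1 h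
  rw [_root_.map_mul, _root_.map_mul, toHeisenberg_boundaryWord, Heisenberg.commute_center,
    mul_assoc, ← _root_.map_mul, mul_inv_cancel, _root_.map_one, mul_one]

theorem toHeisenberg_mk (i : Fin 2) (e : Bool) : toHeisenberg (mk [(i, e)]) =
    cond e (![(⟨1, 0, 0⟩ : Heisenberg), ⟨0, 1, 0⟩] i) (![(⟨1, 0, 0⟩ : Heisenberg), ⟨0, 1, 0⟩] i)⁻¹ := by
  simp [toHeisenberg]

/-- Nielsen reduction of the pair `(ψ genA, ψ genB)` ends at two single letters, and the commutator
that is preserved up to conjugacy determines them up to a quarter turn. -/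
theorem nielsenOrbit_gens {ψ : F₂ →* F₂} (hψ : ψ boundaryWord = boundaryWord) :
    NielsenOrbit ψ genA genB := by
  have hO := nielsenClosed_nielsenOrbit ψ
  have h0 : NielsenOrbit ψ (ψ genA) (ψ genB) := ⟨1, 1, one_mem _, by simp, by simp⟩
  obtain ⟨u, v, huv⟩ := exists_minimalIn h0
  have hle := hO.norm_add_norm_le norm_boundaryWord_le boundaryWord_ne_one
    (fun _ _ h => isConj_of_nielsenOrbit hψ h) huv
  have hH := toHeisenberg_of_isConj (isConj_of_nielsenOrbit hψ huv.1)
  have hu : u ≠ 1 := by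
    rintro rfl
    exact absurd (congrArg Heisenberg.center hH) (by simp; decide)
  have hv : v ≠ 1 := by
    rintro rfl
    exact absurd (congrArg Heisenberg.center hH) (by simp; decide)
  have hu' : u.norm ≠ 0 := fun h => hu (norm_eq_zero.1 h)
  have hv' : v.norm ≠ 0 := fun h => hv (norm_eq_zero.1 h)
  obtain ⟨⟨i, e⟩, rfl⟩ := exists_of_norm_eq_one (u := u) (by omega)
  obtain ⟨⟨j, f⟩, rfl⟩ := exists_of_norm_eq_one (u := v) (by omega)
  have h := huv.1
  simp only [_root_.map_mul, _root_.map_inv, toHeisenberg_mk] at hH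
  clear huv hle hu hv hu' hv'
  have r := hO.rotate h
  have r2 := hO.rotate r
  have r3 := hO.rotate r2
  -- Of the sixteen pairs of letters, only the four quarter turns of `(genA, genB)` have a
  -- commutator with the right image in the Heisenberg group.
  fin_cases i <;> fin_cases j <;> cases e <;> cases f <;>
    first
    | exact absurd hH (by decide)
    | exact h
    | exact r
    | exact r2
    | exact r3

/-- An endomorphism of the free group that fixes the boundary word is generated by `autX` and
`autY`. -/
theorem exists_mem_closure_eq {ψ : F₂ →* F₂} (hψ : ψ boundaryWord = boundaryWord) :
    ∃ τ ∈ Subgroup.closure {autX, autY}, ∀ w, τ w = ψ w := by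
  have hδ : MulAut.conj boundaryWord⁻¹ ∈ Subgroup.closure {autX, autY} := by
    rw [← autX_mul_autY_pow_six]
    exact pow_mem (mul_mem (Subgroup.subset_closure (by simp)) (Subgroup.subset_closure (by simp))) 6
  obtain ⟨g, τ, hτ, ha, hb⟩ := nielsenOrbit_gens hψ
  -- The orbit statement says that `ψ ∘ τ` is inner. Both maps fix the boundary word, so the
  -- conjugator commutes with it and is one of its powers, and such conjugations are powers of
  -- `(autX * autY) ^ 6`.
  have h1 : ψ.comp τ.toMonoidHom = (MulAut.conj g⁻¹).toMonoidHom := by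
    refine hom_ext_gen ?_ ?_
    · change ψ (τ genA) = g⁻¹ * genA * g⁻¹⁻¹
      conv_rhs => rw [← ha]
      group
    · change ψ (τ genB) = g⁻¹ * genB * g⁻¹⁻¹
      conv_rhs => rw [← hb]
      group
  have h2 : ∀ w, ψ (τ w) = g⁻¹ * w * g := fun w => by
    have := DFunLike.congr_fun h1 w
    simpa using this
  have h3 : Commute g boundaryWord := by
    have := h2 boundaryWord
    rw [apply_boundaryWord_of_mem_closure hτ, hψ] at this
    change g * _ = _ * g
    nth_rw 1 [this]; group
  obtain ⟨n, rfl⟩ := exists_zpow_boundaryWord h3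
  refine ⟨MulAut.conj boundaryWord⁻¹ ^ n * τ⁻¹, mul_mem (zpow_mem hδ n) (inv_mem hτ), fun w => ?_⟩
  have h4 := h2 (τ⁻¹ w)
  rw [MulAut.apply_inv_self] at h4
  rw [h4, ← map_zpow, MulAut.mul_apply, MulAut.conj_apply, inv_zpow, inv_inv]

/-- The exponent sums of a word. -/
def expSum : F₂ →* Multiplicative (Fin 2 → ℤ) :=
  FreeGroup.lift fun i => Multiplicative.ofAdd (Pi.single i 1)

theorem expSum_of (i : Fin 2) : (expSum (of i)).toAdd = Pi.single i 1 := by simp [expSum]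

theorem expSum_apply_mulAut_aux (ψ : MulAut F₂) (w : F₂) : (expSum (ψ w)).toAdd =
    (Matrix.of fun i j => (expSum (ψ (of j))).toAdd i).mulVec (expSum w).toAdd := by
  induction w using FreeGroup.induction_on with
  | C1 => simp
  | of j =>
    ext i
    simp [expSum_of, Matrix.mulVec_single]
  | inv_of j hj => simp only [_root_.map_inv, toAdd_inv, hj, Matrix.mulVec_neg]
  | mul u v hu hv => simp only [_root_.map_mul, toAdd_mul, hu, hv, Matrix.mulVec_add]

/-- The matrix of exponent sums of an automorphism of the free group. -/
def abMatrix : MulAut F₂ →* Matrix (Fin 2) (Fin 2) ℤ where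
  toFun ψ := Matrix.of fun i j => (expSum (ψ (of j))).toAdd i
  map_one' := by
    ext i j
    simp [expSum, Matrix.one_apply, Pi.single_apply]
  map_mul' ψ ψ' := by
    ext i j
    exact congrFun (expSum_apply_mulAut_aux ψ (ψ' (of j))) i

theorem expSum_apply_mulAut (ψ : MulAut F₂) (w : F₂) :
    (expSum (ψ w)).toAdd = (abMatrix ψ).mulVec (expSum w).toAdd :=
  expSum_apply_mulAut_aux ψ w

theorem abMatrix_autX : abMatrix autX = !![1, 1; 0, 1] := by
  have h0 := autX_genA
  have h1 := autX_genB
  rw [genA] at h0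
  rw [genA, genB] at h1
  ext i j
  fin_cases i <;> fin_cases j <;> simp [abMatrix, h0, h1, expSum]

theorem abMatrix_autY : abMatrix autY = !![1, 0; -1, 1] := by
  have h0 := autY_genA
  have h1 := autY_genB
  rw [genA, genB] at h0
  rw [genB] at h1
  ext i j
  fin_cases i <;> fin_cases j <;> simp [abMatrix, h0, h1, expSum]

end OnceHoledTorus

/-! ### A convex thickening of the Cayley tree -/

namespace OnceHoledTorus

open FreeGroup

/-- The letters of the free group. -/
abbrev Letter : Type := Fin 2 × Bool

/-- The inverse letter. -/
def bar (l : Letter) : Letter := (l.1, !l.2)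

@[simp] theorem bar_bar (l : Letter) : bar (bar l) = l := by simp [bar]

theorem bar_ne (l : Letter) : bar l ≠ l := by simp [bar, Prod.ext_iff]

theorem mk_bar (l : Letter) : (mk [bar l] : F₂) = (mk [l])⁻¹ := by
  simp [bar, FreeGroup.invRev]

theorem isReduced_cons_cons' {l m : Letter} {L : List Letter} :
    IsReduced (l :: m :: L) ↔ m ≠ (bar l) ∧ IsReduced (m :: L) := by
  rw [FreeGroup.isReduced_cons_cons]
  refine and_congr_left fun _ => ?_
  obtain ⟨i, e⟩ := l
  obtain ⟨j, f⟩ := m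
  simp only [bar, ne_eq, Prod.mk.injEq, not_and]
  constructor
  · rintro h rfl rfl; cases e <;> simp at h
  · rintro h rfl; cases e <;> cases f <;> simp at h ⊢

/-- The points of a convex thickening of the Cayley tree of the free group: a function that
assigns to each vertex `g` and each letter `l` the signed distance that the point has from `g`
in the direction of `l`. -/
@[ext]
structure Potential where
  intro ::
  /-- The signed distance from `g` in the direction of `l`. -/
  toFun : F₂ → Letter → ℝ
  -- The first condition is affine and the second is convex, so straight segments between potentials
  -- stay in the space. This replaces geodesics in the tree.
  edge' : ∀ g l, toFun (mk [l] * g) (bar l) = 1 - toFun g l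
  add_nonpos' : ∀ g l m, l ≠ m → toFun g l + toFun g m ≤ 0

namespace Potential

instance : CoeFun Potential fun _ => F₂ → Letter → ℝ := ⟨toFun⟩

instance : TopologicalSpace Potential := TopologicalSpace.induced toFun inferInstance

theorem ext' {B B' : Potential} (h : ∀ g l, B g l = B' g l) : B = B' :=
  Potential.ext (funext fun g => funext (h g))

theorem edge (B : Potential) (g : F₂) (l : Letter) : B (mk [l] * g) (bar l) = 1 - B g l :=
  B.edge' g l

theorem add_nonpos (B : Potential) (g : F₂) {l m : Letter} (h : l ≠ m) : B g l + B g m ≤ 0 :=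
  B.add_nonpos' g l m h

theorem continuous_eval (g : F₂) (l : Letter) : Continuous fun B : Potential => B g l :=
  (continuous_apply l).comp ((continuous_apply g).comp continuous_induced_dom)

theorem continuous_iff {X : Type*} [TopologicalSpace X] {f : X → Potential} :
    Continuous f ↔ ∀ g l, Continuous fun x => f x g l := by
  refine ⟨fun h g l => (continuous_eval g l).comp h, fun h => ?_⟩
  exact continuous_induced_rng.2 (continuous_pi fun g => continuous_pi fun l => h g l)

/-- The free group acts by translation. -/
instance : MulAction F₂ Potential where
  smul h B :=
    { toFun := fun g => B (g * h)
      edge' := fun g l => by rw [mul_assoc]; exact B.edge _ l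
      add_nonpos' := fun g l m hlm => B.add_nonpos _ hlm }
  one_smul B := ext' fun g l => congrFun (congrArg B.toFun (mul_one g)) l
  mul_smul h k B := ext' fun g l => congrFun (congrArg B.toFun (mul_assoc g h k).symm) l

theorem smul_apply (h : F₂) (B : Potential) (g : F₂) (l : Letter) : (h • B) g l = B (g * h) l := rfl

instance : ContinuousConstSMul F₂ Potential where
  continuous_const_smul h := continuous_iff.2 fun g l => continuous_eval (g * h) l

/-- The segment from `B` to `B'`. -/
def segment (t : unitInterval) (B B' : Potential) : Potential where
  toFun g l := (1 - t.1) * B g l + t.1 * B' g l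
  edge' g l := by rw [B.edge, B'.edge]; ring
  add_nonpos' g l m h := by nlinarith [B.add_nonpos g h, B'.add_nonpos g h, t.2.1, t.2.2]

theorem segment_apply (t : unitInterval) (B B' : Potential) (g : F₂) (l : Letter) :
    segment t B B' g l = (1 - t.1) * B g l + t.1 * B' g l := rfl

theorem segment_zero (B B' : Potential) : segment 0 B B' = B := 
  ext' fun g l => by simp [segment_apply]
theorem segment_one (B B' : Potential) : segment 1 B B' = B' := 
  ext' fun g l => by simp [segment_apply]
theorem segment_self (t : unitInterval) (B : Potential) : segment t B B = B := by
  exact ext' fun g l => by simp only [segment_apply]; ring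

theorem smul_segment (h : F₂) (t : unitInterval) (B B' : Potential) :
    h • segment t B B' = segment t (h • B) (h • B') := rfl

theorem continuous_segment :
    Continuous fun x : unitInterval × Potential × Potential => segment x.1 x.2.1 x.2.2 := by
  refine continuous_iff.2 fun g l => ?_
  have h1 : Continuous fun x : unitInterval × Potential × Potential => x.2.1 g l :=
    (continuous_eval g l).comp (by fun_prop)
  have h2 : Continuous fun x : unitInterval × Potential × Potential => x.2.2 g l :=
    (continuous_eval g l).comp (by fun_prop)
  have h0 : Continuous fun x : unitInterval × Potential × Potential => x.1.1 :=
    continuous_subtype_val.comp continuous_fst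
  exact ((continuous_const.sub h0).mul h1).add (h0.mul h2)

/-- Two points of the thickening of the tree, far apart when seen from the ends of a path. -/
theorem length_le (B : Potential) (g : F₂) (L : List Letter) (hL : IsReduced L) (l m : Letter)
    (hl : (bar l) ∈ L.head?) (hm : m ∈ L.getLast?) :
    (L.length : ℝ) ≤ B g m + B (mk L * g) l := by
  induction L generalizing l with
  | nil => simp at hl
  | cons x L ih =>
    have hx : x = (bar l) := by simpa using hl
    subst hx
    match L with
    | [] =>
      have : m = (bar l) := by simpa using hm.symm
      subst this
      have := B.edge g (bar l)
      rw [bar_bar] at this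
      rw [this]; simp
    | y :: L =>
      rw [isReduced_cons_cons'] at hL
      have h1 := ih hL.2 (bar y) (by simp) (by simpa [List.getLast?_cons_cons] using hm)
      have e : (mk ((bar l) :: y :: L) : F₂) * g = mk [bar l] * (mk (y :: L) * g) := by
        rw [← mul_assoc, mul_mk]; rfl
      -- At the intermediate vertex, the direction back and the direction onward are distinct
      -- because the word is reduced. Their distances therefore have nonpositive sum, and each
      -- further edge contributes one.
      have h2 := B.edge (mk (y :: L) * g) (bar l)
      rw [bar_bar] at h2
      have h3 := B.add_nonpos (mk (y :: L) * g) (l := (bar y)) (m := (bar l)) (by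
        intro h
        exact hL.1 (by rw [← h]; simp))
      rw [e, h2]
      push_cast [List.length_cons] at h1 ⊢
      linarith

/-- Every point is within distance one of some vertex. -/
theorem exists_lt_one (B : Potential) : ∃ g, ∀ l, B g l < 1 := by
  suffices H : ∀ n : ℕ, ∀ g, (∀ l, B g l < n + 1) → ∃ g, ∀ l, B g l < 1 by
    obtain ⟨n, hn⟩ := exists_nat_gt (∑ l, |B 1 l|)
    refine H n 1 fun l => ?_
    have := Finset.single_le_sum (f := fun l => |B 1 l|) (fun _ _ => abs_nonneg _) (Finset.mem_univ l)
    have := le_abs_self (B 1 l)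
    linarith
  intro n
  induction n with
  | zero => intro g h; exact ⟨g, by simpa using h⟩
  | succ n ih =>
    intro g h
    by_cases h1 : ∀ l, B g l < 1
    · exact ⟨g, h1⟩
    push Not at h1
    obtain ⟨l, hl⟩ := h1
    -- A step across an edge in a direction of distance at least one lowers the bound by one: every
    -- new value is at most `B g l - 1`, or is the nonpositive value looking back.
    refine ih (mk [l] * g) fun m => ?_
    have h2 := B.edge g l
    have h3 := h l
    push_cast at h3
    by_cases hm : m = (bar l)
    · rw [hm, h2]; have : (0 : ℝ) ≤ n := n.cast_nonneg; linarith
    · have := B.add_nonpos (mk [l] * g) hm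
      rw [h2] at this
      linarith

/-- The vertex `1` of the tree. -/
def vertex : Potential where
  toFun g l := if g.toWord.head? = some (bar l) then (g.norm : ℝ) else -g.norm
  edge' g l := by
    by_cases h : g.toWord.head? = some (bar l)
    · obtain ⟨L, hL⟩ : ∃ L, g.toWord = (bar l) :: L := by
        obtain ⟨y, T, hT⟩ := List.exists_cons_of_ne_nil (l := g.toWord) (by rintro h'; simp [h'] at h)
        exact ⟨T, by rw [hT] at h ⊢; simpa using h⟩
      have hr : IsReduced ((bar l) :: L) := hL ▸ isReduced_toWord
      have hg : mk [l] * g = mk L := by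
        have : g = mk [bar l] * mk L := by rw [mul_mk, ← mk_toWord (x := g), hL]; rfl
        rw [this, mk_bar, mul_inv_cancel_left]
      have hrL : IsReduced L := by
        cases L with
        | nil => exact IsReduced.of_reduce_eq rfl
        | cons y T => exact (isReduced_cons_cons'.1 hr).2
      have hw : (mk [l] * g).toWord = L := by rw [hg, toWord_mk, hrL.reduce_eq]
      have h2 : ¬ (mk [l] * g).toWord.head? = some (bar (bar l)) := by
        rw [hw, bar_bar]
        cases L with
        | nil => simp
        | cons y T =>
          have := (isReduced_cons_cons'.1 hr).1
          simpa using this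
      rw [if_neg h2, if_pos h, FreeGroup.norm, FreeGroup.norm, hw, hL]
      push_cast [List.length_cons]; ring
    · have hr : IsReduced (l :: g.toWord) := by
        have hg : IsReduced g.toWord := isReduced_toWord
        cases hw : g.toWord with
        | nil => exact IsReduced.of_reduce_eq rfl
        | cons y T =>
          rw [hw] at h hg
          exact isReduced_cons_cons'.2 ⟨by simpa using h, hg⟩
      have hw : (mk [l] * g).toWord = l :: g.toWord := by
        rw [← hr.reduce_eq, ← toWord_mk]
        congr 1
        conv_lhs => rw [← mk_toWord (x := g)]
        rw [mul_mk]; rfl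
      rw [if_neg h, if_pos (by rw [hw, bar_bar]; rfl), FreeGroup.norm, FreeGroup.norm, hw]
      push_cast [List.length_cons]; ring
  add_nonpos' g l m hlm := by
    have h0 : (0 : ℝ) ≤ g.norm := Nat.cast_nonneg _
    by_cases h : g.toWord.head? = some (bar l)
    · have : ¬ g.toWord.head? = some (bar m) := by
        rw [h]
        intro h'
        apply hlm
        have := congrArg bar (Option.some.inj h')
        simpa using this
      rw [if_pos h, if_neg this]; simp
    · rw [if_neg h]; split_ifs <;> linarith

theorem vertex_one (l : Letter) : vertex 1 l = 0 := by simp [vertex]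

theorem vertex_letter (l m : Letter) : vertex (mk [l]) m = if m = (bar l) then 1 else -1 := by
  have h : (mk [l] : F₂).toWord = [l] := by rw [toWord_mk, reduce_singleton]
  have hn : (mk [l] : F₂).norm = 1 := by rw [FreeGroup.norm, h]; rfl
  have : (some l = some (bar m)) ↔ m = (bar l) := by
    rw [Option.some_inj]
    constructor
    · rintro rfl; simp
    · rintro rfl; simp
  simp only [vertex, h, hn, List.head?_cons, this]
  simp

/-- Near `B`, only the values at one nearby vertex `g` are prescribed up to `1 / 4`. If a nontrivial
translate met this neighbourhood, `length_le` would bound the length of the reduced word joining `g`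
to `g * h` below what its end letters force. -/
theorem exists_nhds_disjoint (B : Potential) :
    ∃ U ∈ nhds B, ∀ h : F₂, ((h • ·) '' U ∩ U).Nonempty → h = 1 := by
  obtain ⟨g, hg⟩ := B.exists_lt_one
  refine ⟨⋂ l, {B' : Potential | |B' g l - B g l| < 1 / 4}, ?_, ?_⟩
  · refine Filter.iInter_mem.2 fun l => ?_
    have : IsOpen {B' : Potential | |B' g l - B g l| < 1 / 4} :=
      isOpen_lt (((continuous_eval g l).sub continuous_const).abs) continuous_const
    exact this.mem_nhds (by simp)
  · rintro h ⟨_, ⟨B', hB', rfl⟩, hB''⟩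
    rw [Set.mem_iInter] at hB' hB''
    by_contra hne
    set k : F₂ := g * h * g⁻¹ with hk
    have hk1 : k ≠ 1 := fun h1 => hne (by
      rw [hk] at h1
      have : h = g⁻¹ * (g * h * g⁻¹) * g := by group
      rw [this, h1]; group)
    have hkg : mk k.toWord * g = g * h := by rw [mk_toWord, hk]; group
    have hr : IsReduced k.toWord := isReduced_toWord
    have hw : k.toWord ≠ [] := fun h' => hk1 (toWord_eq_nil_iff.1 h')
    have key := fun l m => B'.length_le g k.toWord hr l m
    rw [hkg] at key
    have est : ∀ l m, B' g m + B' (g * h) l < B g m + B g l + 1 / 2 := fun l m => by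
      have h1 := (abs_lt.1 (show |B' g m - B g m| < 1 / 4 from hB' m)).2
      have h2 := (abs_lt.1 (show |B' (g * h) l - B g l| < 1 / 4 from hB'' l)).2
      linarith
    obtain ⟨x, T, hT⟩ := List.exists_cons_of_ne_nil hw
    have k1 := key (bar x) (k.toWord.getLast hw) (by rw [hT]; simp) (by simp [List.getLast?_eq_some_getLast hw])
    have k2 := est (bar x) (k.toWord.getLast hw)
    -- If the end directions at `g` agree, the sum of distances is below `5 / 2`, but a reduced word
    -- ending with the inverse of its first letter has length at least three. If they differ, the
    -- sum is below `1 / 2`, but the word is nonempty.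
    by_cases hx : k.toWord.getLast hw = (bar x)
    · have h3 : 3 ≤ k.toWord.length := by
        simp only [hT] at hx
        match T, hT, hx with
        | [], hT, hx => exact absurd hx.symm (bar_ne x)
        | [y], hT, hx =>
          rw [hT, isReduced_cons_cons'] at hr
          exact absurd hx hr.1
        | y :: z :: T, hT, hx => rw [hT]; simp
      have h3' : (3 : ℝ) ≤ k.toWord.length := by exact_mod_cast h3
      rw [hx] at k1 k2
      linarith [hg (bar x)]
    · have h1 : (1 : ℝ) ≤ k.toWord.length := by rw [hT]; simp
      have := B.add_nonpos g hx
      linarith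

end Potential

/-- The quotient of the thickened tree by the free group. -/
def TreeQuotient : Type := MulAction.orbitRel.Quotient F₂ Potential

instance : TopologicalSpace TreeQuotient :=
  inferInstanceAs (TopologicalSpace (Quotient (MulAction.orbitRel F₂ Potential)))

/-- The projection to the quotient. -/
def proj : Potential → TreeQuotient := Quotient.mk (MulAction.orbitRel F₂ Potential)

theorem isQuotientCoveringMap_proj : IsQuotientCoveringMap proj F₂ where
  toIsQuotientMap := isQuotientMap_quotient_mk'
  toContinuousConstSMul := inferInstance
  apply_eq_iff_mem_orbit := Quotient.eq''
  disjoint := Potential.exists_nhds_disjoint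

theorem isCoveringMap_proj : IsCoveringMap proj := isQuotientCoveringMap_proj.isCoveringMap

theorem continuous_proj : Continuous proj := isCoveringMap_proj.continuous

theorem proj_smul (g : F₂) (B : Potential) : proj (g • B) = proj B :=
  isQuotientCoveringMap_proj.map_smul g

theorem proj_eq_iff {B B' : Potential} : proj B = proj B' ↔ ∃ g : F₂, g • B' = B :=
  isQuotientCoveringMap_proj.apply_eq_iff_mem_orbit

theorem smul_left_cancel_potential {g h : F₂} {B : Potential} (e : g • B = h • B) : g = h :=
  have := isQuotientCoveringMap_proj.isCancelSMul
  IsCancelSMul.right_cancel _ _ B e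

end OnceHoledTorus

namespace OnceHoledTorus

noncomputable section

open FreeGroup

theorem ramp_nonneg (u : ℝ) : 0 ≤ ramp u := le_max_left _ _

theorem ramp_le_one (u : ℝ) : ramp u ≤ 1 := max_le zero_le_one (min_le_left _ _)

theorem ramp_of_mem {u : ℝ} (h0 : 0 ≤ u) (h1 : u ≤ 1) : ramp u = u := by
  rw [ramp, min_eq_right h1, max_eq_right h0]

/-- The clamping of a real number to the unit interval. -/
def clamp (u : ℝ) : unitInterval := ⟨ramp u, ramp_nonneg u, ramp_le_one u⟩

theorem continuous_clamp : Continuous clamp := continuous_ramp.subtype_mk _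

theorem clamp_of_nonpos {u : ℝ} (h : u ≤ 0) : clamp u = 0 := Subtype.ext (ramp_of_nonpos h)

theorem clamp_of_one_le {u : ℝ} (h : 1 ≤ u) : clamp u = 1 := Subtype.ext (ramp_of_one_le h)

theorem coe_add_one (r : ℝ) : ((r + 1 : ℝ) : UnitAddCircle) = r := AddCircle.coe_add_period 1 r

theorem norm_coe_of_abs_le {r : ℝ} (h : |r| ≤ 1 / 2) : ‖(r : UnitAddCircle)‖ = |r| := by
  rw [AddCircle.norm_coe_eq_abs_iff 1 one_ne_zero]; simpa using h

theorem rep_mem (s : UnitAddCircle) : rep s ∈ Set.Ico (-1 / 2 : ℝ) (1 / 2) := by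
  have h := (AddCircle.equivIco 1 (-1 / 2) s).2
  exact ⟨h.1, by have := h.2; norm_num at this ⊢; exact this⟩

/-! ### The map to the quotient of the thickened tree -/

/-- The edge of the thickened tree from the vertex `1` in the direction of a generator. -/
def edgePoint (i : Fin 2) (u : unitInterval) : Potential :=
  Potential.segment u Potential.vertex ((of i : F₂) • Potential.vertex)

theorem continuous_edgePoint (i : Fin 2) : Continuous (edgePoint i) :=
  Potential.continuous_segment.comp (continuous_id.prodMk
    (continuous_const (y := (Potential.vertex, (of i : F₂) • Potential.vertex))))

theorem edgePoint_zero (i : Fin 2) : edgePoint i 0 = Potential.vertex := Potential.segment_zero _ _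

theorem edgePoint_one (i : Fin 2) : edgePoint i 1 = (of i : F₂) • Potential.vertex :=
  Potential.segment_one _ _

theorem proj_edgePoint_zero (i : Fin 2) : proj (edgePoint i 0) = proj Potential.vertex := by
  rw [edgePoint_zero]

theorem proj_edgePoint_one (i : Fin 2) : proj (edgePoint i 1) = proj Potential.vertex := by
  rw [edgePoint_one, proj_smul]

/-- The loop in the quotient that runs over an edge. -/
def edgeLoop (i : Fin 2) : UnitAddCircle → TreeQuotient :=
  AddCircle.liftIco 1 (-1 / 2) fun r : ℝ => proj (edgePoint i (clamp (4 * r + 1 / 2)))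

theorem continuous_edgeLoop (i : Fin 2) : Continuous (edgeLoop i) := by
  apply AddCircle.liftIco_continuous
  · rw [clamp_of_nonpos (by norm_num), clamp_of_one_le (by norm_num), proj_edgePoint_zero,
      proj_edgePoint_one]
  · exact (continuous_proj.comp ((continuous_edgePoint i).comp
      (continuous_clamp.comp (by fun_prop)))).continuousOn

theorem edgeLoop_coe {i : Fin 2} {r : ℝ} (h : |r| ≤ 1 / 2) :
    edgeLoop i r = proj (edgePoint i (clamp (4 * r + 1 / 2))) := by
  rw [abs_le] at h
  rcases eq_or_lt_of_le h.2 with h2 | h2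
  · have : (r : UnitAddCircle) = ((-1 / 2 : ℝ) : UnitAddCircle) := by
      rw [← coe_add_one (-1 / 2), h2]; norm_num
    rw [this, edgeLoop, AddCircle.liftIco_coe_apply (by norm_num), h2,
      clamp_of_nonpos (by norm_num), clamp_of_one_le (by norm_num), proj_edgePoint_zero,
      proj_edgePoint_one]
  · rw [edgeLoop, AddCircle.liftIco_coe_apply]
    constructor <;> linarith [h.1]

theorem edgeLoop_eq (i : Fin 2) (s : UnitAddCircle) :
    edgeLoop i s = proj (edgePoint i (clamp (4 * rep s + 1 / 2))) := by
  conv_lhs => rw [← coe_rep s]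
  have := rep_mem s
  exact edgeLoop_coe (abs_le.2 ⟨by linarith [this.1], this.2.le⟩)

theorem edgeLoop_of_le {i : Fin 2} {s : UnitAddCircle} (h : 1 / 8 ≤ ‖s‖) :
    edgeLoop i s = proj Potential.vertex := by
  rw [edgeLoop_eq]
  rw [← abs_rep] at h
  rcases le_abs.1 h with h | h
  · rw [clamp_of_one_le (by linarith), proj_edgePoint_one]
  · rw [clamp_of_nonpos (by linarith), proj_edgePoint_zero]

/-- The strips of half-width `1 / 8` about the two arcs overlap only inside the removed disc, so the
two formulas defining `crush` never conflict. -/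
theorem one_eighth_le_or {z : Torus} (h : 1 / 4 ≤ radius z) : ‖z.2‖ ≤ 1 / 8 → 1 / 8 ≤ ‖z.1‖ := by
  intro h2
  by_contra! h1
  rw [radius, Real.le_sqrt' (by norm_num)] at h
  nlinarith [norm_nonneg z.1, norm_nonneg z.2]

/-- The map from the surface to the quotient of the thickened tree that crushes the complement of
neighbourhoods of the two arcs `s = 0` and `t = 0`. -/
def crush : C(Surface, TreeQuotient) where
  toFun z := if 1 / 8 ≤ ‖z.1.2‖ then edgeLoop 0 z.1.1 else edgeLoop 1 z.1.2
  continuous_toFun := by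
    have := continuous_edgeLoop
    refine Continuous.if_le ?_ ?_ (by fun_prop) (by fun_prop) ?_
    · exact (this 0).comp (by fun_prop)
    · exact (this 1).comp (by fun_prop)
    · intro z hz
      rw [edgeLoop_of_le (one_eighth_le_or z.2 hz.symm.le), edgeLoop_of_le hz.le]

theorem crush_of_snd {z : Surface} (h : 1 / 8 ≤ ‖z.1.2‖) : crush z = edgeLoop 0 z.1.1 := if_pos h

theorem crush_of_fst {z : Surface} (h : 1 / 8 ≤ ‖z.1.1‖) : crush z = edgeLoop 1 z.1.2 := by
  by_cases h2 : 1 / 8 ≤ ‖z.1.2‖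
  · rw [crush_of_snd h2, edgeLoop_of_le h, edgeLoop_of_le h2]
  · exact if_neg h2

/-! ### The map back to the surface -/

/-- The displacement along the loops `x`, `y` of a point near the vertex `g`. -/
def displacement (B : Potential) (g : F₂) (i : Fin 2) : ℝ :=
  ramp (B g (i, false)) - ramp (B g (i, true))

/-- The displacement as a point of the torus. -/
def spreadAt (B : Potential) (g : F₂) : Torus :=
  (((1 / 2 + displacement B g 0 : ℝ) : UnitAddCircle),
   ((1 / 2 + displacement B g 1 : ℝ) : UnitAddCircle))

/-- When both ends of an edge are within distance one, the point is strictly between them, and only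
the direction along the edge has positive value. The positions measured from the two ends differ by
one full turn around the corresponding circle. -/
theorem displacement_adjacent (B : Potential) (g : F₂) (x : Letter) (h : ∀ l, B g l < 1)
    (h' : ∀ l, B (mk [x] * g) l < 1) (i : Fin 2) :
    ∃ n : ℤ, displacement B (mk [x] * g) i = displacement B g i + n := by
  have h1 := B.edge g x
  have h2 := h' (bar x)
  rw [h1] at h2
  have h3 := h x
  have z1 : ∀ m, m ≠ x → ramp (B g m) = 0 := fun m hm =>
    ramp_of_nonpos (by linarith [B.add_nonpos g hm])
  have z2 : ∀ m, m ≠ bar x → ramp (B (mk [x] * g) m) = 0 := fun m hm =>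
    ramp_of_nonpos (by have := B.add_nonpos (mk [x] * g) hm; rw [h1] at this; linarith)
  have e1 : ramp (B g x) = B g x := ramp_of_mem (by linarith) h3.le
  have e2 : ramp (B (mk [x] * g) (bar x)) = 1 - B g x := by
    rw [h1]; exact ramp_of_mem (by linarith) h2.le
  obtain ⟨k, e⟩ := x
  by_cases hk : i = k
  · subst hk
    cases e
    · refine ⟨-1, ?_⟩
      rw [displacement, displacement, z1 (i, true) (by simp), z2 (i, false) (by simp [bar]), e1]
      simp only [bar, Bool.not_false] at e2
      rw [e2]; push_cast; ring
    · refine ⟨1, ?_⟩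
      rw [displacement, displacement, z1 (i, false) (by simp), z2 (i, true) (by simp [bar]), e1]
      simp only [bar, Bool.not_true] at e2
      rw [e2]; push_cast; ring
  · refine ⟨0, ?_⟩
    simp only [displacement]
    rw [z1 _ (by simp [hk]), z1 _ (by simp [hk]), z2 _ (by simp [bar, hk]), z2 _ (by simp [bar, hk])]
    simp

theorem coe_eq_coe_add_int (r : ℝ) (n : ℤ) : ((r + n : ℝ) : UnitAddCircle) = r := by
  rw [AddCircle.coe_add]
  have : ((n : ℝ) : UnitAddCircle) = 0 := (AddCircle.coe_eq_zero_iff 1).2 ⟨n, by simp⟩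
  rw [this, add_zero]

/-- Vertices within distance one of the same point are equal or adjacent: by `length_le`, a word of
length two or more would make two distances below one add up to at least two. -/
theorem spreadAt_eq (B : Potential) {g g' : F₂} (h : ∀ l, B g l < 1) (h' : ∀ l, B g' l < 1) :
    spreadAt B g' = spreadAt B g := by
  obtain ⟨k, rfl⟩ : ∃ k, g' = k * g := ⟨g' * g⁻¹, by group⟩
  have hr : IsReduced k.toWord := isReduced_toWord
  match hk : k.toWord with
  | [] => rw [toWord_eq_nil_iff] at hk; rw [hk, one_mul]
  | [x] =>
    have : k = mk [x] := by rw [← hk, mk_toWord]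
    subst this
    obtain ⟨m, hm⟩ := displacement_adjacent B g x h h' 0
    obtain ⟨n, hn⟩ := displacement_adjacent B g x h h' 1
    rw [spreadAt, spreadAt, hm, hn, ← add_assoc, ← add_assoc, coe_eq_coe_add_int, coe_eq_coe_add_int]
  | x :: y :: L =>
    exfalso
    have hL : k.toWord.length = L.length + 2 := by rw [hk]; rfl
    have hne : k.toWord ≠ [] := by rw [hk]; simp
    have := B.length_le g k.toWord hr (bar x) (k.toWord.getLast hne) (by rw [hk]; simp)
      (by simp [List.getLast?_eq_some_getLast hne])
    rw [mk_toWord, hL] at this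
    push_cast at this
    have h1 := h (k.toWord.getLast hne)
    have h2 := h' (bar x)
    have : (0 : ℝ) ≤ L.length := Nat.cast_nonneg _
    linarith

/-- The spreading map on the thickened tree. -/
def spreadTree (B : Potential) : Torus := spreadAt B B.exists_lt_one.choose

theorem spreadTree_eq {B : Potential} {g : F₂} (h : ∀ l, B g l < 1) : spreadTree B = spreadAt B g :=
  spreadAt_eq B h B.exists_lt_one.choose_spec

theorem continuous_spreadTree : Continuous spreadTree := by
  rw [continuous_iff_continuousAt]
  intro B
  obtain ⟨g, hg⟩ := B.exists_lt_one
  have hU : {B' : Potential | ∀ l, B' g l < 1} ∈ nhds B := by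
    rw [Set.ofPred_forall]
    refine Filter.iInter_mem.2 fun l => ?_
    exact (isOpen_lt (Potential.continuous_eval g l) continuous_const).mem_nhds (hg l)
  have hc : Continuous fun B' : Potential => spreadAt B' g := by
    have hd : ∀ i, Continuous fun B' : Potential => displacement B' g i := fun i =>
      (continuous_ramp.comp (Potential.continuous_eval g _)).sub
        (continuous_ramp.comp (Potential.continuous_eval g _))
    exact ((AddCircle.continuous_mk' 1).comp (continuous_const.add (hd 0))).prodMk
      ((AddCircle.continuous_mk' 1).comp (continuous_const.add (hd 1)))
  exact hc.continuousAt.congr (Filter.eventuallyEq_of_mem hU fun B' hB' => (spreadTree_eq hB').symm)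

theorem spreadTree_smul (h : F₂) (B : Potential) : spreadTree (h • B) = spreadTree B := by
  obtain ⟨g, hg⟩ := (h • B).exists_lt_one
  rw [spreadTree_eq hg, spreadTree_eq (B := B) (g := g * h) hg]
  rfl

theorem norm_half : ‖((1 / 2 : ℝ) : UnitAddCircle)‖ = 1 / 2 := by
  rw [norm_coe_of_abs_le] <;> norm_num

theorem le_radius_spreadTree (B : Potential) : 1 / 4 ≤ radius (spreadTree B) := by
  obtain ⟨g, hg⟩ := B.exists_lt_one
  rw [spreadTree_eq hg]
  -- At most one direction at a vertex has positive value, so the image lies on the union of the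
  -- circles `s = 1 / 2` and `t = 1 / 2`, away from the disc.
  have key : displacement B g 0 = 0 ∨ displacement B g 1 = 0 := by
    by_contra! hne
    have pos : ∀ i, displacement B g i ≠ 0 → ∃ e, 0 < B g (i, e) := fun i hi => by
      by_contra! h
      exact hi (by rw [displacement, ramp_of_nonpos (h _), ramp_of_nonpos (h _), sub_zero])
    obtain ⟨e, he⟩ := pos 0 hne.1
    obtain ⟨f, hf⟩ := pos 1 hne.2
    have := B.add_nonpos g (l := (0, e)) (m := (1, f)) (by simp)
    linarith
  rcases key with h | h
  · refine le_trans ?_ (norm_fst_le_radius _)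
    rw [spreadAt, h, add_zero, norm_half]; norm_num
  · refine le_trans ?_ (norm_snd_le_radius _)
    rw [spreadAt, h, add_zero, norm_half]; norm_num

/-- The map from the quotient of the thickened tree back to the surface. -/
def spread : C(TreeQuotient, Surface) where
  toFun := Quotient.lift (fun B => (⟨spreadTree B, le_radius_spreadTree B⟩ : Surface)) (by
    rintro B B' ⟨g, rfl⟩
    exact Subtype.ext (spreadTree_smul g B'))
  continuous_toFun := (continuous_spreadTree.subtype_mk _).quotient_lift _

theorem coe_spread_proj (B : Potential) : (spread (proj B)).1 = spreadTree B := rfl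

theorem spreadTree_vertex : spreadTree Potential.vertex = (((1 / 2 : ℝ) : UnitAddCircle), ((1 / 2 : ℝ) : UnitAddCircle)) := by
  rw [spreadTree_eq (g := 1) (by simp [Potential.vertex_one])]
  simp [spreadAt, displacement, Potential.vertex_one]

theorem spreadTree_edgePoint (i : Fin 2) (u : unitInterval) : spreadTree (edgePoint i u) =
    (((1 / 2 + if i = 0 then u.1 else 0 : ℝ) : UnitAddCircle),
     ((1 / 2 + if i = 1 then u.1 else 0 : ℝ) : UnitAddCircle)) := by
  rcases eq_or_lt_of_le u.2.2 with h | h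
  · have : u = 1 := Subtype.ext h
    subst this
    rw [edgePoint_one, spreadTree_smul, spreadTree_vertex]
    obtain rfl | rfl : i = 0 ∨ i = 1 := by omega
    · simp
    · simp
  · have hB : ∀ l, edgePoint i u 1 l = if l = (i, false) then u.1 else -u.1 := fun l => by
      rw [edgePoint, Potential.segment_apply, Potential.vertex_one, Potential.smul_apply, one_mul, of,
        Potential.vertex_letter]
      simp only [bar, Bool.not_true]
      split_ifs <;> ring
    have h0 := u.2.1
    rw [spreadTree_eq (g := 1) (fun l => by rw [hB]; split_ifs <;> linarith)]
    have r0 : ramp (-u.1) = 0 := ramp_of_nonpos (by linarith)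
    have r1 : ramp u.1 = u.1 := ramp_of_mem h0 h.le
    obtain rfl | rfl : i = 0 ∨ i = 1 := by omega
    · simp [spreadAt, displacement, hB, r0, r1]
    · simp [spreadAt, displacement, hB, r0, r1]

/-! ### The homotopy from the identity to the composition -/

/-- The homotopy of the circle that stretches a neighbourhood of `0`. -/
def stretch : UnitAddCircle → C(unitInterval, UnitAddCircle) :=
  AddCircle.liftIco 1 (-1 / 2) fun r : ℝ =>
    ⟨fun τ => ((ramp ((1 + 3 * τ.1) * r + 1 / 2) + 1 / 2 : ℝ) : UnitAddCircle),
      (AddCircle.continuous_mk' 1).comp ((continuous_ramp.comp (by fun_prop)).add continuous_const)⟩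

theorem continuous_stretch : Continuous stretch := by
  apply AddCircle.liftIco_continuous
  · ext τ
    have := τ.2.1
    change ((ramp ((1 + 3 * τ.1) * (-1 / 2) + 1 / 2) + 1 / 2 : ℝ) : UnitAddCircle) =
      ((ramp ((1 + 3 * τ.1) * (-1 / 2 + 1) + 1 / 2) + 1 / 2 : ℝ) : UnitAddCircle)
    rw [ramp_of_nonpos (by linarith), ramp_of_one_le (by linarith), add_comm (1 : ℝ), coe_add_one, zero_add]
  · refine Continuous.continuousOn ?_
    refine ContinuousMap.continuous_of_continuous_uncurry _ ?_
    exact (AddCircle.continuous_mk' 1).comp ((continuous_ramp.comp (by fun_prop)).add continuous_const)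

theorem stretch_apply (s : UnitAddCircle) (τ : unitInterval) :
    stretch s τ = ((ramp ((1 + 3 * τ.1) * rep s + 1 / 2) + 1 / 2 : ℝ) : UnitAddCircle) := by
  conv_lhs => rw [← coe_rep s]
  have := rep_mem s
  rw [stretch, AddCircle.liftIco_coe_apply (by constructor <;> linarith [this.1, this.2])]
  rfl

theorem stretch_zero (s : UnitAddCircle) : stretch s 0 = s := by
  have := rep_mem s
  rw [stretch_apply, Set.Icc.coe_zero, ramp_of_mem (by linarith [this.1]) (by linarith [this.2])]
  conv_rhs => rw [← coe_rep s, ← coe_add_one]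
  congr 1; ring

/-- Stretching moves points away from `0` in each coordinate, which keeps the homotopy outside the
removed disc. -/
theorem norm_le_norm_stretch (s : UnitAddCircle) (τ : unitInterval) : ‖s‖ ≤ ‖stretch s τ‖ := by
  have hs := rep_mem s
  have hτ := τ.2.1
  set u := (1 + 3 * τ.1) * rep s + 1 / 2 with hu
  have e : stretch s τ = ((ramp u - 1 / 2 : ℝ) : UnitAddCircle) := by
    rw [stretch_apply, ← coe_add_one (ramp u - 1 / 2)]; congr 1; ring
  have h0 := ramp_nonneg u
  have h1 := ramp_le_one u
  rw [e, norm_coe_of_abs_le (abs_le.2 ⟨by linarith, by linarith⟩), ← abs_rep]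
  rcases le_total 0 (rep s) with h | h
  · rw [abs_of_nonneg h]
    refine le_trans ?_ (le_abs_self _)
    have : rep s + 1 / 2 ≤ ramp u := le_max_of_le_right (le_min (by linarith [hs.2]) (by
      rw [hu]; nlinarith))
    linarith
  · rw [abs_of_nonpos h]
    refine le_trans ?_ (neg_le_abs _)
    have : ramp u ≤ rep s + 1 / 2 := max_le (by linarith [hs.1]) ((min_le_right _ _).trans (by
      rw [hu]; nlinarith))
    linarith

theorem radius_mono {z w : Torus} (h1 : ‖z.1‖ ≤ ‖w.1‖) (h2 : ‖z.2‖ ≤ ‖w.2‖) :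
    radius z ≤ radius w := by
  unfold radius
  gcongr

/-- The homotopy from the identity of the surface to `spread ∘ crush`. -/
def stretchHomotopy :
    (ContinuousMap.id Surface).Homotopy (spread.comp crush) where
  toFun x := ⟨(stretch x.2.1.1 x.1, stretch x.2.1.2 x.1), x.2.2.trans
    (radius_mono (norm_le_norm_stretch _ _) (norm_le_norm_stretch _ _))⟩
  continuous_toFun := by
    have := continuous_stretch
    refine Continuous.subtype_mk ?_ _
    refine Continuous.prodMk ?_ ?_
    · exact ContinuousEval.continuous_eval.comp ((this.comp (by fun_prop)).prodMk (by fun_prop))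
    · exact ContinuousEval.continuous_eval.comp ((this.comp (by fun_prop)).prodMk (by fun_prop))
  map_zero_left z := Subtype.ext (Prod.ext (stretch_zero _) (stretch_zero _))
  map_one_left z := by
    have key : ∀ s : UnitAddCircle, stretch s 1 =
        ((1 / 2 + ramp (4 * rep s + 1 / 2) : ℝ) : UnitAddCircle) := fun s => by
      rw [stretch_apply, add_comm]; norm_num
    have key' : ∀ s : UnitAddCircle, 1 / 8 ≤ ‖s‖ → stretch s 1 = ((1 / 2 : ℝ) : UnitAddCircle) := by
      intro s hs
      rw [key]
      rw [← abs_rep] at hs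
      rcases le_abs.1 hs with h | h
      · rw [ramp_of_one_le (by linarith), coe_add_one]
      · rw [ramp_of_nonpos (by linarith), add_zero]
    apply Subtype.ext
    change (stretch z.1.1 1, stretch z.1.2 1) = (spread (crush z)).1
    by_cases h : 1 / 8 ≤ ‖z.1.2‖
    · rw [crush_of_snd h, edgeLoop_eq, coe_spread_proj, spreadTree_edgePoint, key, key' _ h]
      simp [clamp]
    · have h' := one_eighth_le_or z.2 (not_le.1 h).le
      rw [crush_of_fst h', edgeLoop_eq, coe_spread_proj, spreadTree_edgePoint, key' _ h', key]
      simp [clamp]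

end

end OnceHoledTorus

/-! ### Holonomy of paths in the surface -/

theorem Path.Homotopic.of_trans_right {X : Type*} [TopologicalSpace X] {x y z : X} {p q : Path x y}
    {r : Path y z} (h : (p.trans r).Homotopic (q.trans r)) : p.Homotopic q := by
  have e := Quotient.eq.2 (h.hcomp (refl r.symm))
  simp only [Quotient.mk_trans, Quotient.mk_symm, Quotient.trans_assoc, Quotient.trans_symm,
    Quotient.trans_refl] at e
  exact Quotient.eq.1 e

namespace OnceHoledTorus

noncomputable section

open FreeGroup unitInterval

namespace Potential

/-- The straight path between two points of the thickened tree. -/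
theorem paths_homotopic {B B' : Potential} (γ γ' : Path B B') : γ.Homotopic γ' := by
  refine ⟨⟨⟨⟨fun x => segment x.1 (γ x.2) (γ' x.2), ?_⟩, fun t => ?_, fun t => ?_⟩, ?_⟩⟩
  · exact continuous_segment.comp (continuous_fst.prodMk
      ((γ.continuous.comp continuous_snd).prodMk (γ'.continuous.comp continuous_snd)))
  · exact segment_zero _ _
  · exact segment_one _ _
  · rintro t x (rfl | rfl) <;> simp [segment_self]

end Potential

/-- The path `γ` in the surface has holonomy `g`: the lift to the thickened tree of its image that
starts at the vertex `1` ends at the translate by `g` of that vertex. -/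
def HasHol {x y : Surface} (γ : Path x y) (g : F₂) : Prop :=
  ∃ Γ : C(I, Potential), (∀ t, proj (Γ t) = crush (γ t)) ∧
    Γ 0 = Potential.vertex ∧ Γ 1 = g • Potential.vertex

namespace HasHol

variable {x y z : Surface}

theorem of_lift {γ : Path x y} (Γ : C(I, Potential)) (h : ∀ t, proj (Γ t) = crush (γ t)) {k m : F₂}
    (h0 : Γ 0 = k • Potential.vertex) (h1 : Γ 1 = m • Potential.vertex) : HasHol γ (k⁻¹ * m) := by
  refine ⟨⟨fun t => k⁻¹ • Γ t, (continuous_const_smul k⁻¹).comp Γ.continuous⟩, fun t => ?_, ?_, ?_⟩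
  · exact (proj_smul _ _).trans (h t)
  · change k⁻¹ • Γ 0 = _
    rw [h0, inv_smul_smul]
  · change k⁻¹ • Γ 1 = _
    rw [h1, mul_smul]

theorem exists_of_crush_eq (γ : Path x y) (hx : crush x = proj Potential.vertex)
    (hy : crush y = proj Potential.vertex) : ∃ g, HasHol γ g := by
  obtain ⟨Γ, h, h0⟩ := isCoveringMap_proj.exists_path_lifts (crush.comp γ.toContinuousMap)
    Potential.vertex (by simpa using hx)
  have h1 := congrFun h 1
  simp only [Function.comp_apply, ContinuousMap.comp_apply] at h1
  rw [show γ.toContinuousMap 1 = y from γ.target, hy] at h1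
  obtain ⟨g, hg⟩ := proj_eq_iff.1 h1
  exact ⟨g, Γ, fun t => congrFun h t, h0, hg.symm⟩

/-- Lifts of homotopic paths from one starting point end at the same point, and the deck action is
free. -/
theorem unique {γ γ' : Path x y} {g g' : F₂} (h : HasHol γ g) (h' : HasHol γ' g')
    (e : γ.Homotopic γ') : g = g' := by
  obtain ⟨Γ, hΓ, h0, h1⟩ := h
  obtain ⟨Γ', hΓ', h0', h1'⟩ := h'
  have e' := e.map crush
  have a0 : (γ.map crush.continuous).toContinuousMap 0 = proj Potential.vertex := by
    rw [← h0, hΓ]; rfl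
  have a0' : (γ'.map crush.continuous).toContinuousMap 0 = proj Potential.vertex := by
    rw [← h0', hΓ']; rfl
  have key := isCoveringMap_proj.liftPath_apply_one_eq_of_homotopicRel e' Potential.vertex a0 a0'
  have k1 : Γ = isCoveringMap_proj.liftPath (γ.map crush.continuous).toContinuousMap Potential.vertex a0 :=
    (isCoveringMap_proj.eq_liftPath_iff' _).2 ⟨funext hΓ, h0⟩
  have k2 : Γ' = isCoveringMap_proj.liftPath (γ'.map crush.continuous).toContinuousMap Potential.vertex a0' :=
    (isCoveringMap_proj.eq_liftPath_iff' _).2 ⟨funext hΓ', h0'⟩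
  rw [← k1, ← k2, h1, h1'] at key
  exact smul_left_cancel_potential key

/-- The second lift is translated by `g` so that it starts where the first one ends; this fixes the
order of the product. -/
theorem trans {γ : Path x y} {γ' : Path y z} {g g' : F₂} (h : HasHol γ g) (h' : HasHol γ' g') :
    HasHol (γ.trans γ') (g * g') := by
  obtain ⟨Γ, hΓ, h0, h1⟩ := h
  obtain ⟨Γ', hΓ', h0', h1'⟩ := h'
  let q : Path Potential.vertex (g • Potential.vertex) := ⟨Γ, h0, h1⟩
  let q' : Path (g • Potential.vertex) ((g * g') • Potential.vertex) :=
    ⟨⟨fun t => g • Γ' t, (continuous_const_smul g).comp Γ'.continuous⟩, congrArg (g • ·) h0',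
      (congrArg (g • ·) h1').trans (mul_smul _ _ _).symm⟩
  refine ⟨(q.trans q').toContinuousMap, fun t => ?_, (q.trans q').source, (q.trans q').target⟩
  change proj ((q.trans q') t) = crush (γ.trans γ' t)
  rw [Path.trans_apply, Path.trans_apply]
  split_ifs
  · exact hΓ _
  · exact (proj_smul _ _).trans (hΓ' _)

theorem symm {γ : Path x y} {g : F₂} (h : HasHol γ g) : HasHol γ.symm g⁻¹ := by
  obtain ⟨Γ, hΓ, h0, h1⟩ := h
  have := of_lift (γ := γ.symm) ⟨fun t => Γ (σ t), by fun_prop⟩ (fun t => hΓ _) (k := g) (m := 1)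
    (by simpa using h1) (by simpa using h0)
  simpa using this

theorem cast {x' y' : Surface} {γ : Path x y} {g : F₂} (h : HasHol γ g) (hx : x' = x) (hy : y' = y) :
    HasHol (γ.cast hx hy) g := by
  subst hx hy
  exact h

/-- Two paths with the same holonomy are homotopic. -/
theorem homotopic {γ γ' : Path x y} {g : F₂} (h : HasHol γ g) (h' : HasHol γ' g) :
    γ.Homotopic γ' := by
  obtain ⟨Γ, hΓ, h0, h1⟩ := h
  obtain ⟨Γ', hΓ', h0', h1'⟩ := h'
  let q : Path Potential.vertex (g • Potential.vertex) := ⟨Γ, h0, h1⟩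
  let q' : Path Potential.vertex (g • Potential.vertex) := ⟨Γ', h0', h1'⟩
  have hx : crush x = proj Potential.vertex := by
    rw [← h0, hΓ]; simp
  have hy : crush y = proj (g • Potential.vertex) := by
    rw [← h1, hΓ]; simp
  -- Lifts with common ends are homotopic by convexity, hence so are the crushed paths.
  have e1 := ((Potential.paths_homotopic q q').map ⟨proj, continuous_proj⟩).pathCast hx hy
  have c1 : (q.map continuous_proj).cast hx hy = γ.map crush.continuous := by
    ext t; exact hΓ t
  have c2 : (q'.map continuous_proj).cast hx hy = γ'.map crush.continuous := by
    ext t; exact hΓ' t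
  change ((q.map continuous_proj).cast hx hy).Homotopic ((q'.map continuous_proj).cast hx hy) at e1
  rw [c1, c2] at e1
  have e2 := e1.map spread
  -- Naturality of the homotopy from the identity to `spread ∘ crush` transports the homotopy back
  -- to the surface, up to the tracks of the endpoints, which cancel.
  have m := Path.Homotopic.map_trans_evalAt stretchHomotopy γ
  have m' := Path.Homotopic.map_trans_evalAt stretchHomotopy γ'
  have e3 : ((γ.map (map_continuous (ContinuousMap.id Surface))).trans
      (stretchHomotopy.evalAt y)).Homotopic ((γ'.map (map_continuous
        (ContinuousMap.id Surface))).trans (stretchHomotopy.evalAt y)) :=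
    m.trans (((Path.Homotopic.refl _).hcomp e2).trans m'.symm)
  simpa using e3.of_trans_right

theorem of_homotopic {γ γ' : Path x y} {g : F₂} (h : HasHol γ g) (e : γ.Homotopic γ') :
    HasHol γ' g := by
  have hx : crush x = proj Potential.vertex := by
    obtain ⟨Γ, hΓ, h0, h1⟩ := h
    rw [← h0, hΓ]; simp
  have hy : crush y = proj Potential.vertex := by
    obtain ⟨Γ, hΓ, h0, h1⟩ := h
    rw [← proj_smul g, ← h1, hΓ]; simp
  obtain ⟨g', h'⟩ := exists_of_crush_eq γ' hx hy
  rwa [h.unique h' e]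

end HasHol

/-- The range goes beyond a fundamental interval up to the next crossing zone, so that a lift
following a full turn of a twist is covered by one formula. -/
theorem edgeLoop_coe' {i : Fin 2} {r : ℝ} (h : |r| ≤ 7 / 8) :
    edgeLoop i r = proj (edgePoint i (clamp (4 * r + 1 / 2))) := by
  rcases le_or_gt |r| (1 / 2) with h2 | h2
  · exact edgeLoop_coe h2
  have key : ∀ r : ℝ, 1 / 2 < r → r ≤ 7 / 8 → 1 / 8 ≤ ‖(r : UnitAddCircle)‖ := fun r h1 h2 => by
    have e : (r : UnitAddCircle) = ((r - 1 : ℝ) : UnitAddCircle) := by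
      rw [← coe_add_one (r - 1), sub_add_cancel]
    have : |r - 1| = 1 - r := by rw [abs_of_nonpos (by linarith)]; ring
    rw [e, norm_coe_of_abs_le (by rw [this]; linarith), this]
    linarith
  rcases lt_abs.1 h2 with h3 | h3
  · rw [edgeLoop_of_le (key r h3 ((le_abs_self r).trans h)), clamp_of_one_le (by linarith),
      proj_edgePoint_one]
  · have := key (-r) h3 ((neg_le_abs r).trans h)
    rw [AddCircle.coe_neg, norm_neg] at this
    rw [edgeLoop_of_le this, clamp_of_nonpos (by linarith), proj_edgePoint_zero]

/-- A real lift of the relevant coordinate that passes from below `-1 / 8` to above `1 / 8`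
traverses the edge of the tree once; the lifted path is written down explicitly. -/
theorem hasHol_of_lift {x y : Surface} (γ : Path x y) {i : Fin 2} {r : I → ℝ} (hr : Continuous r)
    (h : ∀ t, crush (γ t) = edgeLoop i (r t)) (hr' : ∀ t, |r t| ≤ 7 / 8)
    (h0 : r 0 ≤ -1 / 8) (h1 : 1 / 8 ≤ r 1) : HasHol γ (of i) := by
  refine ⟨⟨fun t => edgePoint i (clamp (4 * r t + 1 / 2)), (continuous_edgePoint i).comp
    (continuous_clamp.comp (by fun_prop))⟩, fun t => ?_, ?_, ?_⟩
  · rw [h, edgeLoop_coe' (hr' t)]; rfl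
  · change edgePoint i (clamp _) = _
    rw [clamp_of_nonpos (by linarith), edgePoint_zero]
  · change edgePoint i (clamp _) = _
    rw [clamp_of_one_le (by linarith), edgePoint_one]

theorem hasHol_of_lift_inv {x y : Surface} (γ : Path x y) {i : Fin 2} {r : I → ℝ} (hr : Continuous r)
    (h : ∀ t, crush (γ t) = edgeLoop i (r t)) (hr' : ∀ t, |r t| ≤ 7 / 8)
    (h0 : 1 / 8 ≤ r 0) (h1 : r 1 ≤ -1 / 8) : HasHol γ (of i)⁻¹ := by
  have := (hasHol_of_lift γ.symm (i := i) (r := fun t => r (σ t)) (by fun_prop) (fun t => h _)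
    (fun t => hr' _) (by simpa using h1) (by simpa using h0)).symm
  simpa using this

theorem hasHol_one {x y : Surface} (γ : Path x y) (h1 : ∀ t, 1 / 8 ≤ ‖(γ t).1.1‖)
    (h2 : ∀ t, 1 / 8 ≤ ‖(γ t).1.2‖) : HasHol γ 1 := by
  refine ⟨ContinuousMap.const _ Potential.vertex, fun t => ?_, rfl, by rw [one_smul]; rfl⟩
  rw [crush_of_snd (h2 t), edgeLoop_of_le (h1 t)]; rfl

end

end OnceHoledTorus

namespace OnceHoledTorus

noncomputable section

open FreeGroup unitInterval

/-! ### The boundary circle -/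

theorem abs_div_four_le {c : ℝ} (h : |c| ≤ 1) : |c / 4| ≤ 1 / 2 := by
  rw [abs_div]; norm_num; linarith

theorem norm_coe_div_four {c : ℝ} (h : |c| ≤ 1) : ‖((c / 4 : ℝ) : UnitAddCircle)‖ = |c| / 4 := by
  rw [norm_coe_of_abs_le (abs_div_four_le h), abs_div]; norm_num

theorem radius_cos_sin (θ : ℝ) : radius (((Real.cos θ / 4 : ℝ) : UnitAddCircle),
    ((Real.sin θ / 4 : ℝ) : UnitAddCircle)) = 1 / 4 := by
  rw [radius, norm_coe_div_four (Real.abs_cos_le_one θ), norm_coe_div_four (Real.abs_sin_le_one θ),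
    Real.sqrt_eq_iff_mul_self_eq_of_pos (by norm_num)]
  have := Real.sin_sq_add_cos_sq θ
  rw [div_pow, div_pow, sq_abs, sq_abs]
  linarith

/-- The boundary circle, by the angle. -/
def circ : C(ℝ, Surface) where
  toFun θ := ⟨(((Real.cos θ / 4 : ℝ) : UnitAddCircle), ((Real.sin θ / 4 : ℝ) : UnitAddCircle)),
    (radius_cos_sin θ).ge⟩
  continuous_toFun := by
    refine Continuous.subtype_mk (Continuous.prodMk ?_ ?_) _
    · exact (AddCircle.continuous_mk' 1).comp (Real.continuous_cos.div_const 4)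
    · exact (AddCircle.continuous_mk' 1).comp (Real.continuous_sin.div_const 4)

theorem circ_mem_boundary (θ : ℝ) : circ θ ∈ boundary := radius_cos_sin θ

theorem circ_fst (θ : ℝ) : (circ θ).1.1 = ((Real.cos θ / 4 : ℝ) : UnitAddCircle) := rfl
theorem circ_snd (θ : ℝ) : (circ θ).1.2 = ((Real.sin θ / 4 : ℝ) : UnitAddCircle) := rfl

theorem norm_circ_fst (θ : ℝ) : ‖(circ θ).1.1‖ = |Real.cos θ| / 4 :=
  norm_coe_div_four (Real.abs_cos_le_one θ)

theorem norm_circ_snd (θ : ℝ) : ‖(circ θ).1.2‖ = |Real.sin θ| / 4 :=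
  norm_coe_div_four (Real.abs_sin_le_one θ)

/-- The arc of the boundary circle between two angles. -/
def arc (θ θ' : ℝ) : Path (circ θ) (circ θ') :=
  (⟨⟨fun t => θ + (θ' - θ) * t.1, by fun_prop⟩, by simp, by simp⟩ : Path θ θ').map circ.continuous

theorem arc_apply (θ θ' : ℝ) (t : I) : arc θ θ' t = circ (θ + (θ' - θ) * t.1) := rfl

theorem arc_trans (θ θ' θ'' : ℝ) : ((arc θ θ').trans (arc θ' θ'')).Homotopic (arc θ θ'') := by
  unfold arc
  rw [← Path.map_trans]
  exact (SimplyConnectedSpace.paths_homotopic _ _).map circ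

theorem arc_symm (θ θ' : ℝ) : (arc θ θ').symm.Homotopic (arc θ' θ) := by
  unfold arc
  rw [Path.map_symm]
  exact (SimplyConnectedSpace.paths_homotopic _ _).map circ

/-- The angle of the base point. -/
def baseAngle : ℝ := Real.arccos (3 / 5)

theorem cos_baseAngle : Real.cos baseAngle = 3 / 5 := Real.cos_arccos (by norm_num) (by norm_num)

theorem sin_baseAngle : Real.sin baseAngle = 4 / 5 := by
  rw [baseAngle, Real.sin_arccos, Real.sqrt_eq_iff_mul_self_eq_of_pos] <;> norm_num

theorem baseAngle_nonneg : 0 ≤ baseAngle := Real.arccos_nonneg _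

theorem baseAngle_le : baseAngle ≤ Real.pi / 2 := Real.arccos_le_pi_div_two.2 (by norm_num)

theorem le_cos_of_abs_le_baseAngle {θ : ℝ} (h : |θ| ≤ baseAngle) : 3 / 5 ≤ Real.cos θ := by
  rw [← cos_baseAngle, ← Real.cos_abs θ]
  exact Real.cos_le_cos_of_nonneg_of_le_pi (abs_nonneg _) (by linarith [baseAngle_le, Real.pi_pos]) h

theorem le_sin_of_abs_sub_le {θ : ℝ} (h : |θ - Real.pi / 2| ≤ Real.pi / 2 - baseAngle) :
    4 / 5 ≤ Real.sin θ := by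
  rw [← sin_baseAngle, ← Real.cos_pi_div_two_sub baseAngle, ← Real.cos_sub_pi_div_two θ,
    ← Real.cos_abs (θ - _)]
  exact Real.cos_le_cos_of_nonneg_of_le_pi (abs_nonneg _)
    (by linarith [baseAngle_nonneg, Real.pi_pos]) h

theorem abs_add_mul_sub_le {u v c r : ℝ} (hu : |u - c| ≤ r) (hv : |v - c| ≤ r) (t : I) :
    |u + (v - u) * t.1 - c| ≤ r := by
  have h0 := t.2.1
  have h1 := t.2.2
  rw [abs_le] at *
  constructor <;> nlinarith

/-- The base point. -/
def base : Surface := circ baseAngle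

theorem base_mem_boundary : base ∈ boundary := circ_mem_boundary _

theorem base_fst : base.1.1 = ((3 / 20 : ℝ) : UnitAddCircle) := by
  rw [base, circ_fst, cos_baseAngle]; norm_num

theorem base_snd : base.1.2 = ((1 / 5 : ℝ) : UnitAddCircle) := by
  rw [base, circ_snd, sin_baseAngle]; norm_num

/-- The coordinates `3 / 20` and `1 / 5` are both above the strip width `1 / 8`, so the base point
lies on the boundary circle but off both crossing zones. The triple 3, 4, 5 keeps them rational. -/
theorem crush_base : crush base = proj Potential.vertex := by
  rw [crush_of_snd, edgeLoop_of_le]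
  · rw [base, norm_circ_fst, cos_baseAngle]; norm_num
  · rw [base, norm_circ_snd, sin_baseAngle]; norm_num

/-! ### Arcs of the boundary -/

/-- The arc of the boundary across `s = 0` above the disc. -/
def topArc : Path (circ (Real.pi - baseAngle)) base := arc (Real.pi - baseAngle) baseAngle

/-- The arc of the boundary across `t = 0` to the right of the disc. -/
def rightArc : Path (circ (-baseAngle)) base := arc (-baseAngle) baseAngle

theorem hasHol_arc_of_sin {θ θ' : ℝ} {e : ℝ} (he : |e| = 1)
    (h : ∀ t : I, 1 / 2 ≤ e * Real.sin (θ + (θ' - θ) * t.1))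
    (h0 : Real.cos θ ≤ -1 / 2) (h1 : 1 / 2 ≤ Real.cos θ') : HasHol (arc θ θ') genA := by
  refine hasHol_of_lift (arc θ θ') (i := 0) (r := fun t => Real.cos (θ + (θ' - θ) * t.1) / 4)
    (by fun_prop) (fun t => ?_) (fun t => ?_) ?_ ?_
  · rw [arc_apply, crush_of_snd, circ_fst]
    rw [norm_circ_snd]
    have := (h t).trans (le_abs_self _)
    rw [abs_mul, he, one_mul] at this
    linarith
  · exact (abs_div_four_le (Real.abs_cos_le_one _)).trans (by norm_num)
  · simp; linarith
  · simp; linarith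

theorem hasHol_arc_of_cos {θ θ' : ℝ} {e : ℝ} (he : |e| = 1)
    (h : ∀ t : I, 1 / 2 ≤ e * Real.cos (θ + (θ' - θ) * t.1))
    (h0 : Real.sin θ ≤ -1 / 2) (h1 : 1 / 2 ≤ Real.sin θ') : HasHol (arc θ θ') genB := by
  refine hasHol_of_lift (arc θ θ') (i := 1) (r := fun t => Real.sin (θ + (θ' - θ) * t.1) / 4)
    (by fun_prop) (fun t => ?_) (fun t => ?_) ?_ ?_
  · rw [arc_apply, crush_of_fst, circ_snd]
    rw [norm_circ_fst]
    have := (h t).trans (le_abs_self _)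
    rw [abs_mul, he, one_mul] at this
    linarith
  · exact (abs_div_four_le (Real.abs_sin_le_one _)).trans (by norm_num)
  · simp; linarith
  · simp; linarith

theorem hasHol_topArc : HasHol topArc genA := by
  refine hasHol_arc_of_sin (e := 1) (by simp) (fun t => ?_) ?_ ?_
  · rw [one_mul]
    refine le_trans (by norm_num) (le_sin_of_abs_sub_le (abs_add_mul_sub_le ?_ ?_ t))
    · rw [abs_of_nonneg] <;> linarith [baseAngle_le]
    · rw [abs_of_nonpos] <;> linarith [baseAngle_le]
  · rw [Real.cos_pi_sub, cos_baseAngle]; norm_num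
  · rw [cos_baseAngle]; norm_num

theorem hasHol_rightArc : HasHol rightArc genB := by
  refine hasHol_arc_of_cos (e := 1) (by simp) (fun t => ?_) ?_ ?_
  · rw [one_mul]
    refine le_trans (by norm_num) (le_cos_of_abs_le_baseAngle ?_)
    have := abs_add_mul_sub_le (u := -baseAngle) (v := baseAngle) (c := 0) (r := baseAngle)
      (by simp [abs_of_nonneg baseAngle_nonneg]) (by simp [abs_of_nonneg baseAngle_nonneg]) t
    simpa using this
  · rw [Real.sin_neg, sin_baseAngle]; norm_num
  · rw [sin_baseAngle]; norm_num

theorem hasHol_bottomArc : HasHol (arc (-Real.pi + baseAngle) (-baseAngle)) genA := by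
  refine hasHol_arc_of_sin (e := -1) (by simp) (fun t => ?_) ?_ ?_
  · have := le_sin_of_abs_sub_le (θ := -(-Real.pi + baseAngle + (-baseAngle - (-Real.pi + baseAngle)) * t.1)) ?_
    · rw [Real.sin_neg] at this; linarith
    have := abs_add_mul_sub_le (u := -Real.pi + baseAngle) (v := -baseAngle) (c := -(Real.pi / 2))
      (r := Real.pi / 2 - baseAngle)
      (by rw [abs_of_nonpos] <;> linarith [baseAngle_le])
      (by rw [abs_of_nonneg] <;> linarith [baseAngle_le]) t
    rw [← abs_neg]
    convert this using 2
    ring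
  · rw [show -Real.pi + baseAngle = -(Real.pi - baseAngle) by ring, Real.cos_neg, Real.cos_pi_sub,
      cos_baseAngle]; norm_num
  · rw [Real.cos_neg, cos_baseAngle]; norm_num

theorem hasHol_leftArc : HasHol (arc (-Real.pi + baseAngle) (-Real.pi - baseAngle)) genB := by
  refine hasHol_arc_of_cos (e := -1) (by simp) (fun t => ?_) ?_ ?_
  · have := le_cos_of_abs_le_baseAngle (θ := -Real.pi + baseAngle +
      (-Real.pi - baseAngle - (-Real.pi + baseAngle)) * t.1 + Real.pi) ?_
    · rw [Real.cos_add_pi] at this; linarith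
    have := abs_add_mul_sub_le (u := -Real.pi + baseAngle) (v := -Real.pi - baseAngle)
      (c := -Real.pi) (r := baseAngle)
      (by rw [abs_of_nonneg] <;> linarith [baseAngle_nonneg])
      (by rw [abs_of_nonpos] <;> linarith [baseAngle_nonneg]) t
    rwa [sub_neg_eq_add] at this
  · rw [show -Real.pi + baseAngle = -(Real.pi - baseAngle) by ring, Real.sin_neg, Real.sin_pi_sub,
      sin_baseAngle]; norm_num
  · rw [show -Real.pi - baseAngle = -(baseAngle + Real.pi) by ring, Real.sin_neg, Real.sin_add_pi,
      sin_baseAngle]; norm_num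

/-- The holonomy of the boundary circle, clockwise. -/
theorem hasHol_boundary : HasHol ((arc baseAngle (baseAngle - 2 * Real.pi))) boundaryWord⁻¹ := by
  have h4 : HasHol (arc (-Real.pi - baseAngle) (baseAngle - 2 * Real.pi)) genA := by
    refine hasHol_arc_of_sin (e := 1) (by simp) (fun t => ?_) ?_ ?_
    · have := le_sin_of_abs_sub_le (θ := -Real.pi - baseAngle +
        (baseAngle - 2 * Real.pi - (-Real.pi - baseAngle)) * t.1 + 2 * Real.pi) ?_
      · rw [Real.sin_add_two_pi] at this; linarith
      have := abs_add_mul_sub_le (u := -Real.pi - baseAngle) (v := baseAngle - 2 * Real.pi)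
        (c := Real.pi / 2 - 2 * Real.pi) (r := Real.pi / 2 - baseAngle)
        (by rw [abs_of_nonneg] <;> linarith [baseAngle_le])
        (by rw [abs_of_nonpos] <;> linarith [baseAngle_le]) t
      convert this using 2
      ring
    · rw [show -Real.pi - baseAngle = -(baseAngle + Real.pi) by ring, Real.cos_neg,
        Real.cos_add_pi, cos_baseAngle]; norm_num
    · rw [Real.cos_sub_two_pi, cos_baseAngle]; norm_num
  have h1 := hasHol_rightArc.symm.of_homotopic (arc_symm _ _)
  have h2 := hasHol_bottomArc.symm.of_homotopic (arc_symm _ _)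
  -- Clockwise from the base point, the arcs cross the right, bottom, left and top of the disc,
  -- contributing `genB⁻¹`, `genA⁻¹`, `genB`, `genA`.
  have e1 := ((h1.trans h2).of_homotopic (arc_trans _ _ _)).trans hasHol_leftArc
  have e2 := ((e1.of_homotopic (arc_trans _ _ _)).trans h4).of_homotopic (arc_trans _ _ _)
  have e : boundaryWord⁻¹ = genB⁻¹ * genA⁻¹ * genB * genA := by simp [boundaryWord, mul_assoc]
  rw [e]
  exact e2

end

end OnceHoledTorus

namespace OnceHoledTorus

noncomputable section

open FreeGroup unitInterval

/-! ### Generators of the fundamental group -/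

theorem circ_pi_sub_fst : (circ (Real.pi - baseAngle)).1.1 = ((-(3 / 20) : ℝ) : UnitAddCircle) := by
  rw [circ_fst, Real.cos_pi_sub, cos_baseAngle]; norm_num

theorem circ_pi_sub_snd : (circ (Real.pi - baseAngle)).1.2 = ((1 / 5 : ℝ) : UnitAddCircle) := by
  rw [circ_snd, Real.sin_pi_sub, sin_baseAngle]; norm_num

theorem circ_neg_fst : (circ (-baseAngle)).1.1 = ((3 / 20 : ℝ) : UnitAddCircle) := by
  rw [circ_fst, Real.cos_neg, cos_baseAngle]; norm_num

theorem circ_neg_snd : (circ (-baseAngle)).1.2 = ((-(1 / 5) : ℝ) : UnitAddCircle) := by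
  rw [circ_snd, Real.sin_neg, sin_baseAngle]; norm_num

theorem le_norm_coe {r c : ℝ} (h0 : c ≤ r) (h1 : r ≤ 1 - c) : c ≤ ‖(r : UnitAddCircle)‖ := by
  rcases le_or_gt c 0 with hc | hc
  · exact hc.trans (norm_nonneg _)
  rcases le_total r (1 / 2) with h | h
  · rw [norm_coe_of_abs_le (by rw [abs_of_nonneg] <;> linarith), abs_of_nonneg] <;> linarith
  · have e : (r : UnitAddCircle) = ((r - 1 : ℝ) : UnitAddCircle) := by
      rw [← coe_add_one (r - 1), sub_add_cancel]
    rw [e, norm_coe_of_abs_le (by rw [abs_of_nonpos] <;> linarith), abs_of_nonpos] <;> linarith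

theorem le_radius {z : Torus} (h1 : 3 / 20 ≤ ‖z.1‖) (h2 : 1 / 5 ≤ ‖z.2‖) : 1 / 4 ≤ radius z := by
  rw [radius, Real.le_sqrt' (by norm_num)]
  nlinarith

/-- The horizontal segment from the base point around the torus. -/
def horizontal : Path base (circ (Real.pi - baseAngle)) where
  toFun t := ⟨(((3 / 20 + 7 / 10 * t.1 : ℝ) : UnitAddCircle), ((1 / 5 : ℝ) : UnitAddCircle)), le_radius
    (le_norm_coe (by linarith [t.2.1]) (by linarith [t.2.2])) (le_norm_coe (by norm_num) (by norm_num))⟩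
  continuous_toFun := by
    refine Continuous.subtype_mk (Continuous.prodMk ?_ continuous_const) _
    exact (AddCircle.continuous_mk' 1).comp (by fun_prop)
  source' := Subtype.ext (Prod.ext (by rw [base_fst]; simp) base_snd.symm)
  target' := Subtype.ext (Prod.ext (by
    rw [circ_pi_sub_fst, ← coe_add_one (-(3 / 20))]; norm_num) circ_pi_sub_snd.symm)

/-- The vertical segment from the base point around the torus. -/
def vertical : Path base (circ (-baseAngle)) where
  toFun t := ⟨(((3 / 20 : ℝ) : UnitAddCircle), ((1 / 5 + 3 / 5 * t.1 : ℝ) : UnitAddCircle)), le_radius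
    (le_norm_coe (by norm_num) (by norm_num)) (le_norm_coe (by linarith [t.2.1]) (by linarith [t.2.2]))⟩
  continuous_toFun := by
    refine Continuous.subtype_mk (Continuous.prodMk continuous_const ?_) _
    exact (AddCircle.continuous_mk' 1).comp (by fun_prop)
  source' := Subtype.ext (Prod.ext base_fst.symm (by rw [base_snd]; simp))
  target' := Subtype.ext (Prod.ext circ_neg_fst.symm (by
    rw [circ_neg_snd, ← coe_add_one (-(1 / 5))]; norm_num))

theorem hasHol_horizontal : HasHol horizontal 1 :=
  hasHol_one _ (fun t => (by norm_num : (1 / 8 : ℝ) ≤ 3 / 20).trans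
      (le_norm_coe (by linarith [t.2.1]) (by linarith [t.2.2])))
    (fun _ => (by norm_num : (1 / 8 : ℝ) ≤ 1 / 5).trans (le_norm_coe (by norm_num) (by norm_num)))

theorem hasHol_vertical : HasHol vertical 1 :=
  hasHol_one _ (fun _ => (by norm_num : (1 / 8 : ℝ) ≤ 3 / 20).trans
      (le_norm_coe (by norm_num) (by norm_num)))
    (fun t => (by norm_num : (1 / 8 : ℝ) ≤ 1 / 5).trans
      (le_norm_coe (by linarith [t.2.1]) (by linarith [t.2.2])))

/-- The loop parallel to the curve `x`. -/
def loopA : Path base base := horizontal.trans topArc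

/-- The loop parallel to the curve `y`. -/
def loopB : Path base base := vertical.trans rightArc

theorem hasHol_loopA : HasHol loopA genA := by
  have := hasHol_horizontal.trans hasHol_topArc
  rwa [one_mul] at this

theorem hasHol_loopB : HasHol loopB genB := by
  have := hasHol_vertical.trans hasHol_rightArc
  rwa [one_mul] at this

theorem exists_hasHol (w : F₂) : ∃ γ : Path base base, HasHol γ w := by
  induction w using FreeGroup.induction_on with
  | C1 =>
    refine ⟨Path.refl base, ContinuousMap.const _ Potential.vertex, fun t => ?_, rfl, ?_⟩
    · exact crush_base.symm
    · rw [one_smul]; rfl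
  | of i =>
    obtain rfl | rfl : i = 0 ∨ i = 1 := by omega
    · exact ⟨loopA, hasHol_loopA⟩
    · exact ⟨loopB, hasHol_loopB⟩
  | inv_of i h =>
    obtain ⟨γ, hγ⟩ := h
    exact ⟨γ.symm, hγ.symm⟩
  | mul u v hu hv =>
    obtain ⟨γ, hγ⟩ := hu
    obtain ⟨γ', hγ'⟩ := hv
    exact ⟨γ.trans γ', hγ.trans hγ'⟩

/-! ### The action of the mapping class group -/

/-- The image of a loop at the base point under a boundary-fixing homeomorphism. -/
def mapLoop (f : BoundaryFixing) (γ : Path base base) : Path base base :=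
  (γ.map (toMap f).continuous).cast (f.2 base base_mem_boundary).symm (f.2 base base_mem_boundary).symm

theorem mapLoop_apply (f : BoundaryFixing) (γ : Path base base) (t : I) : mapLoop f γ t = f.1 (γ t) := rfl

theorem mapLoop_comp (f g : BoundaryFixing) (γ : Path base base) :
    mapLoop (f * g) γ = mapLoop f (mapLoop g γ) :=
  Path.ext (funext fun _ => rfl)

theorem mapLoop_one (γ : Path base base) : mapLoop 1 γ = γ := Path.ext (funext fun _ => rfl)

theorem exists_hasHol_mapLoop (f : BoundaryFixing) (γ : Path base base) :
    ∃ g, HasHol (mapLoop f γ) g :=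
  HasHol.exists_of_crush_eq _ crush_base crush_base

theorem mapLoop_homotopic (f : BoundaryFixing) {γ γ' : Path base base} (h : γ.Homotopic γ') :
    (mapLoop f γ).Homotopic (mapLoop f γ') :=
  (h.map (toMap f)).pathCast _ _

theorem mapLoop_homotopic_of_homotopicRel {f g : BoundaryFixing}
    (h : (toMap f).HomotopicRel (toMap g) boundary) (γ : Path base base) :
    (mapLoop f γ).Homotopic (mapLoop g γ) := by
  obtain ⟨F⟩ := h
  refine ⟨⟨⟨⟨fun x => F (x.1, γ x.2), by fun_prop⟩, fun t => ?_, fun t => ?_⟩, ?_⟩⟩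
  · exact F.map_zero_left _
  · exact F.map_one_left _
  · rintro t x hx
    have hb : γ x ∈ boundary := by
      rcases hx with rfl | rfl
      · rw [γ.source]; exact base_mem_boundary
      · rw [γ.target]; exact base_mem_boundary
    exact F.eq_fst t hb

/-- The action of a boundary-fixing homeomorphism on the free group, as a function. -/
def actFun (f : BoundaryFixing) (w : F₂) : F₂ :=
  (exists_hasHol_mapLoop f (exists_hasHol w).choose).choose

theorem hasHol_mapLoop (f : BoundaryFixing) {γ : Path base base} {w : F₂} (h : HasHol γ w) :
    HasHol (mapLoop f γ) (actFun f w) :=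
  (exists_hasHol_mapLoop f (exists_hasHol w).choose).choose_spec.of_homotopic
    (mapLoop_homotopic f ((exists_hasHol w).choose_spec.homotopic h))

theorem actFun_eq {f : BoundaryFixing} {γ : Path base base} {w v : F₂} (h : HasHol γ w)
    (h' : HasHol (mapLoop f γ) v) : actFun f w = v :=
  (hasHol_mapLoop f h).unique h' (Path.Homotopic.refl _)

theorem actFun_mul (f : BoundaryFixing) (w v : F₂) : actFun f (w * v) = actFun f w * actFun f v := by
  obtain ⟨γ, hγ⟩ := exists_hasHol w
  obtain ⟨γ', hγ'⟩ := exists_hasHol v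
  refine actFun_eq (hγ.trans hγ') ?_
  have : mapLoop f (γ.trans γ') = (mapLoop f γ).trans (mapLoop f γ') := by
    refine Path.ext (funext fun t => ?_)
    rw [mapLoop_apply, Path.trans_apply, Path.trans_apply]
    split_ifs <;> rfl
  rw [this]
  exact (hasHol_mapLoop f hγ).trans (hasHol_mapLoop f hγ')

theorem actFun_comp (f g : BoundaryFixing) (w : F₂) : actFun (f * g) w = actFun f (actFun g w) := by
  obtain ⟨γ, hγ⟩ := exists_hasHol w
  refine actFun_eq hγ ?_
  rw [mapLoop_comp]
  exact hasHol_mapLoop f (hasHol_mapLoop g hγ)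

theorem actFun_one (w : F₂) : actFun 1 w = w := by
  obtain ⟨γ, hγ⟩ := exists_hasHol w
  refine actFun_eq hγ ?_
  rwa [mapLoop_one]

theorem actFun_congr {f g : BoundaryFixing} (h : (toMap f).HomotopicRel (toMap g) boundary) (w : F₂) :
    actFun f w = actFun g w := by
  obtain ⟨γ, hγ⟩ := exists_hasHol w
  exact actFun_eq hγ ((hasHol_mapLoop g hγ).of_homotopic (mapLoop_homotopic_of_homotopicRel h γ).symm)

/-- The action of the boundary-fixing homeomorphisms on the free group. -/
def act : BoundaryFixing →* MulAut F₂ where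
  toFun f :=
    { toFun := actFun f
      invFun := actFun f⁻¹
      left_inv := fun w => by rw [← actFun_comp, inv_mul_cancel, actFun_one]
      right_inv := fun w => by rw [← actFun_comp, mul_inv_cancel, actFun_one]
      map_mul' := actFun_mul f }
  map_one' := MulEquiv.ext actFun_one
  map_mul' f g := MulEquiv.ext (actFun_comp f g)

theorem act_eq {f : BoundaryFixing} {γ : Path base base} {w v : F₂} (h : HasHol γ w)
    (h' : HasHol (mapLoop f γ) v) : act f w = v := actFun_eq h h'

theorem hasHol_act (f : BoundaryFixing) {γ : Path base base} {w : F₂} (h : HasHol γ w) :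
    HasHol (mapLoop f γ) (act f w) := hasHol_mapLoop f h

theorem act_of_mem_trivial {f : BoundaryFixing} (h : f ∈ Trivial) : act f = 1 :=
  MulEquiv.ext fun w => (actFun_congr (g := 1) h w).trans (actFun_one w)

theorem mapLoop_of_mem_boundary (f : BoundaryFixing) {γ : Path base base}
    (h : ∀ t, γ t ∈ boundary) : mapLoop f γ = γ :=
  Path.ext (funext fun t => f.2 _ (h t))

theorem base_eq_circ : base = circ (baseAngle - 2 * Real.pi) := by
  refine Subtype.ext (Prod.ext ?_ ?_)
  · rw [base, circ_fst, circ_fst, Real.cos_sub_two_pi]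
  · rw [base, circ_snd, circ_snd, Real.sin_sub_two_pi]

/-- The boundary, as a clockwise loop. -/
def boundaryLoop : Path base base := (arc baseAngle (baseAngle - 2 * Real.pi)).cast rfl base_eq_circ

theorem boundaryLoop_apply (t : I) : boundaryLoop t = circ (baseAngle - 2 * Real.pi * t.1) := by
  have h : boundaryLoop t = arc baseAngle (baseAngle - 2 * Real.pi) t := rfl
  rw [h, arc_apply]
  exact congrArg circ (by ring)

theorem boundaryLoop_mem_boundary (t : I) : boundaryLoop t ∈ boundary := by
  rw [boundaryLoop_apply]
  exact circ_mem_boundary _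

theorem hasHol_boundaryLoop : HasHol boundaryLoop boundaryWord⁻¹ := hasHol_boundary.cast rfl base_eq_circ

/-- The boundary loop is fixed pointwise, so its holonomy is too. -/
theorem act_boundaryWord (f : BoundaryFixing) : act f boundaryWord = boundaryWord := by
  have := act_eq (f := f) hasHol_boundaryLoop (by
    rw [mapLoop_of_mem_boundary f boundaryLoop_mem_boundary]
    exact hasHol_boundaryLoop)
  rwa [_root_.map_inv, inv_inj] at this

/-! ### The action of the Dehn twists -/

theorem twistX_apply (z : Surface) : (twistX.1 z).1 = (z.1.1 + shear z.1.2, z.1.2) := rfl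
theorem twistY_apply (z : Surface) : (twistY.1 z).1 = (z.1.1, z.1.2 - shear z.1.1) := rfl

theorem shear_coe {r : ℝ} (h0 : 0 ≤ r) (h1 : r < 1) :
    shear (r : UnitAddCircle) = (ramp (2 * r - 1 / 2) : UnitAddCircle) := by
  rw [shear, AddCircle.liftIco_coe_apply (by simp [h0, h1])]

theorem twistX_of_norm_le {z : Surface} (h : ‖z.1.2‖ ≤ 1 / 4) : twistX.1 z = z :=
  Subtype.ext (by rw [twistX_apply, shear_eq_zero h, add_zero])

theorem twistY_of_norm_le {z : Surface} (h : ‖z.1.1‖ ≤ 1 / 4) : twistY.1 z = z :=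
  Subtype.ext (by rw [twistY_apply, shear_eq_zero h, sub_zero])

theorem norm_circ_fst_le (θ : ℝ) : ‖(circ θ).1.1‖ ≤ 1 / 4 := by
  rw [norm_circ_fst]; linarith [Real.abs_cos_le_one θ]

theorem norm_circ_snd_le (θ : ℝ) : ‖(circ θ).1.2‖ ≤ 1 / 4 := by
  rw [norm_circ_snd]; linarith [Real.abs_sin_le_one θ]

theorem mapLoop_trans_arc (f : BoundaryFixing) {θ : ℝ} (q : Path base (circ θ))
    (r : Path (circ θ) base) (hr : ∀ t, r t ∈ boundary) :
    mapLoop f (q.trans r) = ((q.map (toMap f).continuous).cast (f.2 base base_mem_boundary).symm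
      (f.2 _ (circ_mem_boundary θ)).symm).trans r := by
  refine Path.ext (funext fun t => ?_)
  rw [mapLoop_apply, Path.trans_apply, Path.trans_apply]
  split_ifs
  · rfl
  · exact f.2 _ (hr _)

theorem topArc_mem_boundary (t : I) : topArc t ∈ boundary := circ_mem_boundary _

theorem rightArc_mem_boundary (t : I) : rightArc t ∈ boundary := circ_mem_boundary _

/-- The loop parallel to `x` misses the support of the twist, and the vertical loop acquires one
full horizontal turn. -/
theorem act_twistX : act twistX = autX := by
  refine mulAut_ext_gen ?_ ?_
  · rw [autX_genA]
    refine act_eq hasHol_loopA ?_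
    have : mapLoop twistX loopA = loopA := by
      refine Path.ext (funext fun t => ?_)
      refine twistX_of_norm_le ?_
      rw [loopA, Path.trans_apply]
      split_ifs
      · change ‖((1 / 5 : ℝ) : UnitAddCircle)‖ ≤ 1 / 4
        rw [norm_coe_of_abs_le] <;> norm_num [abs_of_pos]
      · exact norm_circ_snd_le _
    rw [this]
    exact hasHol_loopA
  · rw [autX_genB]
    refine act_eq hasHol_loopB ?_
    rw [loopB, mapLoop_trans_arc twistX _ _ rightArc_mem_boundary]
    refine HasHol.trans ?_ hasHol_rightArc
    -- The lift of the `s`-coordinate is shifted by `-1`, running from `-17 / 20` to `3 / 20`, so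
    -- that it crosses `0` once in the positive direction.
    refine hasHol_of_lift _ (i := 0)
      (r := fun t => 3 / 20 - 1 + ramp (2 * (1 / 5 + 3 / 5 * t.1) - 1 / 2)) ?_ (fun t => ?_)
      (fun t => ?_) ?_ ?_
    · exact continuous_const.add (continuous_ramp.comp (by fun_prop))
    · have h0 := t.2.1
      have h1 := t.2.2
      have e : (twistX.1 (vertical t)).1 =
          (((3 / 20 : ℝ) : UnitAddCircle) + shear ((1 / 5 + 3 / 5 * t.1 : ℝ) : UnitAddCircle),
            ((1 / 5 + 3 / 5 * t.1 : ℝ) : UnitAddCircle)) := rfl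
      change crush (twistX.1 (vertical t)) = _
      rw [crush_of_snd, e]
      · rw [shear_coe (by linarith) (by linarith), ← AddCircle.coe_add, ← coe_add_one (_ - 1 + _)]
        exact congrArg (fun u : ℝ => edgeLoop 0 u) (by ring)
      · rw [e]
        exact (by norm_num : (1 / 8 : ℝ) ≤ 1 / 5).trans (le_norm_coe (by linarith) (by linarith))
    · have h0 := ramp_nonneg (2 * (1 / 5 + 3 / 5 * t.1) - 1 / 2)
      have h1 := ramp_le_one (2 * (1 / 5 + 3 / 5 * t.1) - 1 / 2)
      rw [abs_le]
      constructor <;> linarith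
    · rw [ramp_of_nonpos] <;> norm_num
    · rw [ramp_of_one_le] <;> norm_num

theorem act_twistY : act twistY = autY := by
  refine mulAut_ext_gen ?_ ?_
  · rw [autY_genA]
    refine act_eq hasHol_loopA ?_
    rw [loopA, mapLoop_trans_arc twistY _ _ topArc_mem_boundary]
    refine HasHol.trans ?_ hasHol_topArc
    -- The `t`-coordinate runs down from `1 / 5` to `-4 / 5`, crossing `0` once in the negative
    -- direction.
    refine hasHol_of_lift_inv _ (i := 1)
      (r := fun t => 1 / 5 - ramp (2 * (3 / 20 + 7 / 10 * t.1) - 1 / 2)) ?_ (fun t => ?_)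
      (fun t => ?_) ?_ ?_
    · exact continuous_const.sub (continuous_ramp.comp (by fun_prop))
    · have h0 := t.2.1
      have h1 := t.2.2
      have e : (twistY.1 (horizontal t)).1 = (((3 / 20 + 7 / 10 * t.1 : ℝ) : UnitAddCircle),
          ((1 / 5 : ℝ) : UnitAddCircle) - shear ((3 / 20 + 7 / 10 * t.1 : ℝ) : UnitAddCircle)) := rfl
      change crush (twistY.1 (horizontal t)) = _
      rw [crush_of_fst, e]
      · rw [shear_coe (by linarith) (by linarith), ← AddCircle.coe_sub]
      · rw [e]
        exact (by norm_num : (1 / 8 : ℝ) ≤ 3 / 20).trans (le_norm_coe (by linarith) (by linarith))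
    · have h0 := ramp_nonneg (2 * (3 / 20 + 7 / 10 * t.1) - 1 / 2)
      have h1 := ramp_le_one (2 * (3 / 20 + 7 / 10 * t.1) - 1 / 2)
      rw [abs_le]
      constructor <;> linarith
    · rw [ramp_of_nonpos] <;> norm_num
    · rw [ramp_of_one_le] <;> norm_num
  · rw [autY_genB]
    refine act_eq hasHol_loopB ?_
    have : mapLoop twistY loopB = loopB := by
      refine Path.ext (funext fun t => ?_)
      refine twistY_of_norm_le ?_
      rw [loopB, Path.trans_apply]
      split_ifs
      · change ‖((3 / 20 : ℝ) : UnitAddCircle)‖ ≤ 1 / 4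
        rw [norm_coe_of_abs_le] <;> norm_num [abs_of_pos]
      · exact norm_circ_fst_le _
    rw [this]
    exact hasHol_loopB

end

end OnceHoledTorus

/-! ### The boundary twist acts by an inner automorphism -/

namespace OnceHoledTorus

noncomputable section

open FreeGroup unitInterval

/-- The clockwise rotation by an angle of the disc of radius `1/2` about the origin. -/
def rotateBy (φ : ℝ) (p : Torus) : Torus :=
  (((rep p.1 * Real.cos φ + rep p.2 * Real.sin φ : ℝ) : UnitAddCircle),
   ((-rep p.1 * Real.sin φ + rep p.2 * Real.cos φ : ℝ) : UnitAddCircle))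

theorem rotateBy_two_pi (p : Torus) : rotateBy (2 * Real.pi) p = p := by
  simp [rotateBy, coe_rep]

theorem radius_rotateBy (φ : ℝ) {p : Torus} (h : radius p < 1 / 2) :
    radius (rotateBy φ p) = radius p := by
  have hr : rep p.1 ^ 2 + rep p.2 ^ 2 < (1 / 2) ^ 2 := by
    rw [radius_eq, Real.sqrt_lt' (by norm_num)] at h; exact h
  have hcs := Real.sin_sq_add_cos_sq φ
  have key : (rep p.1 * Real.cos φ + rep p.2 * Real.sin φ) ^ 2 +
      (-rep p.1 * Real.sin φ + rep p.2 * Real.cos φ) ^ 2 = rep p.1 ^ 2 + rep p.2 ^ 2 := by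
    linear_combination (rep p.1 ^ 2 + rep p.2 ^ 2) * hcs
  rw [radius_eq, radius_eq, rotateBy, rep_coe (abs_lt_of_sq_lt_sq (by nlinarith) (by norm_num)),
    rep_coe (abs_lt_of_sq_lt_sq (by nlinarith) (by norm_num)), key]

theorem rotateBy_circ (φ θ : ℝ) : rotateBy φ (circ θ).1 = (circ (θ - φ)).1 := by
  have h1 : rep (circ θ).1.1 = Real.cos θ / 4 := rep_coe (by
    rw [abs_div]; have := Real.abs_cos_le_one θ; norm_num; linarith)
  have h2 : rep (circ θ).1.2 = Real.sin θ / 4 := rep_coe (by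
    rw [abs_div]; have := Real.abs_sin_le_one θ; norm_num; linarith)
  refine Prod.ext ?_ ?_
  · rw [rotateBy, h1, h2, circ_fst, Real.cos_sub]
    exact congrArg (fun u : ℝ => (u : UnitAddCircle)) (by ring)
  · rw [rotateBy, h1, h2, circ_snd, Real.sin_sub]
    exact congrArg (fun u : ℝ => (u : UnitAddCircle)) (by ring)

/-- The angle of rotation at time `τ` of the homotopy that unwinds the boundary twist. -/
def unwindAngle (τ : I) (p : Torus) : ℝ := 2 * Real.pi * max (ramp (8 * radius p - 2)) τ.1

theorem unwind_outer (τ : I) {p : Torus} (h : 3 / 8 ≤ radius p) :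
    rotateBy (unwindAngle τ p) p = p := by
  rw [unwindAngle, ramp_of_one_le (by linarith), max_eq_left τ.2.2, mul_one, rotateBy_two_pi]

theorem continuous_unwind : Continuous fun x : I × Torus => rotateBy (unwindAngle x.1 x.2) x.2 := by
  rw [continuous_iff_continuousAt]
  rintro ⟨τ, p⟩
  rcases lt_or_ge (3 / 8) (radius p) with h | h
  · have ho : IsOpen {x : I × Torus | 3 / 8 < radius x.2} :=
      isOpen_lt continuous_const (continuous_radius.comp continuous_snd)
    refine continuousAt_snd.congr (Filter.eventuallyEq_of_mem (ho.mem_nhds h) ?_)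
    intro x hx
    exact (unwind_outer x.1 (le_of_lt hx)).symm
  · have c1 : ContinuousAt (fun x : I × Torus => rep x.2.1) (τ, p) :=
      ContinuousAt.comp (f := fun x : I × Torus => x.2.1)
        (continuousAt_rep (by linarith [norm_fst_le_radius p])) (by fun_prop)
    have c2 : ContinuousAt (fun x : I × Torus => rep x.2.2) (τ, p) :=
      ContinuousAt.comp (f := fun x : I × Torus => x.2.2)
        (continuousAt_rep (by linarith [norm_snd_le_radius p])) (by fun_prop)
    have ca : ContinuousAt (fun x : I × Torus => unwindAngle x.1 x.2) (τ, p) := by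
      have := continuous_radius
      have := continuous_ramp
      unfold unwindAngle
      fun_prop
    have cc := Real.continuous_cos.continuousAt.comp ca
    have cs := Real.continuous_sin.continuousAt.comp ca
    have cq : Continuous (fun u : ℝ => (u : UnitAddCircle)) := AddCircle.continuous_mk' 1
    exact (cq.continuousAt.comp ((c1.mul cc).add (c2.mul cs))).prodMk
      (cq.continuousAt.comp ((c1.neg.mul cs).add (c2.mul cc)))

theorem radius_unwind (τ : I) (p : Torus) : radius (rotateBy (unwindAngle τ p) p) = radius p := by
  rcases le_or_gt (3 / 8) (radius p) with h | h
  · rw [unwind_outer τ h]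
  · exact radius_rotateBy _ (by linarith)

/-- The free homotopy from the boundary twist to the identity. -/
def unwind : (toMap twistDelta).Homotopy (ContinuousMap.id Surface) where
  toFun x := ⟨rotateBy (unwindAngle x.1 x.2.1) x.2.1, by rw [radius_unwind]; exact x.2.2⟩
  continuous_toFun := by
    refine Continuous.subtype_mk ?_ _
    exact continuous_unwind.comp
      (continuous_fst.prodMk (continuous_subtype_val.comp continuous_snd))
  map_zero_left z := by
    apply Subtype.ext
    change rotateBy (unwindAngle 0 z.1) z.1 = rotate 1 z.1
    have : unwindAngle 0 z.1 = angle 1 z.1 := by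
      rw [unwindAngle, angle, Set.Icc.coe_zero, max_eq_left (ramp_nonneg _)]; simp
    rw [this]; rfl
  map_one_left z := by
    apply Subtype.ext
    change rotateBy (unwindAngle 1 z.1) z.1 = z.1
    rw [unwindAngle, Set.Icc.coe_one, max_eq_right (ramp_le_one _), mul_one, rotateBy_two_pi]

theorem unwind_apply (τ : I) (z : Surface) :
    (unwind (τ, z)).1 = rotateBy (unwindAngle τ z.1) z.1 := rfl

theorem unwind_base (τ : I) : unwind (τ, base) = boundaryLoop τ := by
  apply Subtype.ext
  rw [boundaryLoop_apply, unwind_apply]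
  have hb : radius base.1 = 1 / 4 := base_mem_boundary
  rw [base, rotateBy_circ, ← base, unwindAngle, hb, ramp_of_nonpos (by norm_num), max_eq_right τ.2.1]

/-- The twist is freely homotopic to the identity by rotating the collar, and the base point then
runs once clockwise around the boundary. A free homotopy acts on loops by conjugation with the track
of the base point. -/
theorem act_twistDelta : act twistDelta = MulAut.conj boundaryWord⁻¹ := by
  refine MulEquiv.ext fun w => ?_
  obtain ⟨γ, hγ⟩ := exists_hasHol w
  have hb : toMap twistDelta base = base := twistDelta.2 base base_mem_boundary
  have h := (Path.Homotopic.map_trans_evalAt unwind γ).pathCast hb.symm rfl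
  have e1 : (((γ.map (map_continuous (toMap twistDelta))).trans (unwind.evalAt base)).cast hb.symm rfl) =
      (mapLoop twistDelta γ).trans boundaryLoop := by
    refine Path.ext (funext fun t => ?_)
    rw [Path.cast_coe]
    refine (Path.trans_apply _ _ t).trans (Eq.trans ?_ (Path.trans_apply _ _ t).symm)
    split_ifs
    · rfl
    · exact unwind_base _
  have e2 : (((unwind.evalAt base).trans (γ.map (map_continuous (ContinuousMap.id Surface)))).cast
      hb.symm rfl) = boundaryLoop.trans γ := by
    refine Path.ext (funext fun t => ?_)
    rw [Path.cast_coe]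
    refine (Path.trans_apply _ _ t).trans (Eq.trans ?_ (Path.trans_apply _ _ t).symm)
    split_ifs
    · exact unwind_base _
    · rfl
  have h' : ((mapLoop twistDelta γ).trans boundaryLoop).Homotopic (boundaryLoop.trans γ) := by
    rw [← e1, ← e2]; exact h
  have key := ((hasHol_act twistDelta hγ).trans hasHol_boundaryLoop).unique
    (hasHol_boundaryLoop.trans hγ) h'
  rw [MulAut.conj_apply, ← key]
  group

end

end OnceHoledTorus

namespace OnceHoledTorus

noncomputable section

open FreeGroup unitInterval

/-! ### The surface as a quotient of a square with corners cut off -/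

/-- The fundamental square of the torus without the points over the disc. -/
abbrev Square : Type := {q : ℝ × ℝ // (q.1 ∈ Set.Icc (0 : ℝ) 1 ∧ q.2 ∈ Set.Icc (0 : ℝ) 1) ∧
  1 / 4 ≤ radius ((q.1 : UnitAddCircle), (q.2 : UnitAddCircle))}

theorem continuous_coe_torus :
    Continuous fun q : ℝ × ℝ => (((q.1 : UnitAddCircle), (q.2 : UnitAddCircle)) : Torus) :=
  ((AddCircle.continuous_mk' 1).comp continuous_fst).prodMk
    ((AddCircle.continuous_mk' 1).comp continuous_snd)

instance : CompactSpace Square := by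
  refine isCompact_iff_compactSpace.1 ?_
  have h1 : IsCompact (Set.Icc (0 : ℝ) 1 ×ˢ Set.Icc (0 : ℝ) 1) := isCompact_Icc.prod isCompact_Icc
  have h2 : IsClosed {q : ℝ × ℝ | 1 / 4 ≤ radius ((q.1 : UnitAddCircle), (q.2 : UnitAddCircle))} :=
    isClosed_le continuous_const (continuous_radius.comp continuous_coe_torus)
  exact h1.inter_right h2

/-- The projection of the square to the surface. -/
def glue : C(Square, Surface) where
  toFun q := ⟨((q.1.1 : UnitAddCircle), (q.1.2 : UnitAddCircle)), q.2.2⟩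
  continuous_toFun := (continuous_coe_torus.comp continuous_subtype_val).subtype_mk _

theorem glue_surjective : Function.Surjective glue := by
  rintro ⟨⟨s, t⟩, h⟩
  obtain ⟨u, hu, rfl⟩ := AddCircle.eq_coe_Ico s
  obtain ⟨v, hv, rfl⟩ := AddCircle.eq_coe_Ico t
  exact ⟨⟨(u, v), ⟨⟨hu.1, hu.2.le⟩, ⟨hv.1, hv.2.le⟩⟩, h⟩, rfl⟩

theorem norm_coe_of_mem {u : ℝ} (hu : u ∈ Set.Icc (0 : ℝ) 1) :
    ‖(u : UnitAddCircle)‖ = 1 / 2 - |u - 1 / 2| := by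
  rcases le_total u (1 / 2) with h | h
  · rw [norm_coe_of_abs_le (by rw [abs_of_nonneg hu.1]; exact h), abs_of_nonneg hu.1,
      abs_of_nonpos (by linarith)]
    ring
  · have e : (u : UnitAddCircle) = ((u - 1 : ℝ) : UnitAddCircle) := by
      rw [← coe_add_one (u - 1), sub_add_cancel]
    rw [e, norm_coe_of_abs_le (by rw [abs_of_nonpos] <;> linarith [hu.2]),
      abs_of_nonpos (by linarith [hu.2]), abs_of_nonneg (by linarith)]
    ring

theorem pull_mem (l : I) {u : ℝ} (hu : u ∈ Set.Icc (0 : ℝ) 1) :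
    1 / 2 + l.1 * (u - 1 / 2) ∈ Set.Icc (0 : ℝ) 1 := by
  have h0 := l.2.1
  have h1 := l.2.2
  obtain ⟨h2, h3⟩ := hu
  constructor <;> nlinarith

theorem norm_le_norm_pull (l : I) {u : ℝ} (hu : u ∈ Set.Icc (0 : ℝ) 1) :
    ‖(u : UnitAddCircle)‖ ≤ ‖((1 / 2 + l.1 * (u - 1 / 2) : ℝ) : UnitAddCircle)‖ := by
  rw [norm_coe_of_mem hu, norm_coe_of_mem (pull_mem l hu), add_sub_cancel_left, abs_mul,
    abs_of_nonneg l.2.1]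
  nlinarith [abs_nonneg (u - 1 / 2), l.2.2]

/-- The contraction of the square to its center. -/
def pull (l : I) (q : Square) : Square :=
  ⟨(1 / 2 + l.1 * (q.1.1 - 1 / 2), 1 / 2 + l.1 * (q.1.2 - 1 / 2)),
    ⟨pull_mem l q.2.1.1, pull_mem l q.2.1.2⟩,
    q.2.2.trans (radius_mono (norm_le_norm_pull l q.2.1.1) (norm_le_norm_pull l q.2.1.2))⟩

theorem continuous_pull : Continuous fun x : I × Square => pull x.1 x.2 := by
  refine Continuous.subtype_mk ?_ _
  fun_prop

theorem pull_one (q : Square) : pull 1 q = q := by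
  apply Subtype.ext
  simp [pull]

/-- The center of the square. -/
def center : Square := ⟨(1 / 2, 1 / 2), ⟨by norm_num, by norm_num⟩, by
  refine le_trans ?_ (norm_fst_le_radius _)
  rw [norm_half]; norm_num⟩

theorem pull_zero (q : Square) : pull 0 q = center := by
  apply Subtype.ext
  simp [pull, center]

/-- The path from the center of the square to a point. -/
def ray (q : Square) : Path center q where
  toFun l := pull l q
  continuous_toFun := continuous_pull.comp (continuous_id.prodMk continuous_const)
  source' := pull_zero q
  target' := pull_one q

instance : PathConnectedSpace Square where
  nonempty := ⟨center⟩
  joined q q' := ⟨(ray q).symm.trans (ray q')⟩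

instance : PathConnectedSpace Surface := glue_surjective.pathConnectedSpace glue.continuous

/-- A continuous surjection from a compact space to a Hausdorff space is a quotient map, so
homotopies on the surface may be defined on the square. -/
theorem isQuotientMap_prodMap_glue :
    Topology.IsQuotientMap (Prod.map id glue : I × Square → I × Surface) := by
  have hc : Continuous (Prod.map id glue : I × Square → I × Surface) :=
    continuous_id.prodMap glue.continuous
  exact hc.isClosedMap.isQuotientMap hc (Function.surjective_id.prodMap glue_surjective)

/-- A map from the surface to the quotient of the tree lifts to the square. -/
theorem exists_lift_square (φ : C(Surface, TreeQuotient)) (q : Square)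
    (hq : φ (glue q) = proj Potential.vertex) :
    ∃ F : C(Square, Potential), (∀ q, proj (F q) = φ (glue q)) ∧ F q = Potential.vertex := by
  obtain ⟨B, hB⟩ := isQuotientCoveringMap_proj.surjective (φ (glue center))
  -- The square contracts radially to its center without entering the removed corners. Lifting this
  -- homotopy from a constant lift at the center gives a lift over the whole square.
  let H : C(I × Square, TreeQuotient) :=
    ⟨fun x => φ (glue (pull x.1 x.2)), by have := continuous_pull; fun_prop⟩
  have H0 : ∀ q, H (0, q) = proj (ContinuousMap.const Square B q) := fun q => by
    change φ (glue (pull 0 q)) = proj B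
    rw [pull_zero, hB]
  let L := isCoveringMap_proj.liftHomotopy H (ContinuousMap.const Square B) H0
  have hL : ∀ q, proj (L (1, q)) = φ (glue q) := fun q => by
    refine (congrFun (isCoveringMap_proj.liftHomotopy_lifts H (ContinuousMap.const Square B) H0)
      (1, q)).trans ?_
    change φ (glue (pull 1 q)) = _
    rw [pull_one]
  obtain ⟨g, hg⟩ := proj_eq_iff.1 (hq.symm.trans (hL q).symm)
  refine ⟨⟨fun q => g • L (1, q), (continuous_const_smul g).comp (by fun_prop)⟩, fun q => ?_, hg⟩
  exact (proj_smul g _).trans (hL q)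

/-! ### Faithfulness of the action -/

theorem hasHol_of_lifts {z : Surface} {x y : Path base z} (X Y : C(I, Potential))
    (hX : ∀ t, proj (X t) = crush (x t)) (hY : ∀ t, proj (Y t) = crush (y t))
    (hX0 : X 0 = Potential.vertex) (hY0 : Y 0 = Potential.vertex) {m : F₂} (h : X 1 = m • Y 1) :
    HasHol (x.trans y.symm) m := by
  let P : Path Potential.vertex (X 1) := ⟨X, hX0, rfl⟩
  let R : Path (m • Potential.vertex) (X 1) :=
    ⟨⟨fun t => m • Y t, (continuous_const_smul m).comp Y.continuous⟩, congrArg (m • ·) hY0, h.symm⟩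
  refine ⟨(P.trans R.symm).toContinuousMap, fun t => ?_, (P.trans R.symm).source,
    (P.trans R.symm).target⟩
  change proj ((P.trans R.symm) t) = crush ((x.trans y.symm) t)
  rw [Path.trans_apply, Path.trans_apply]
  split_ifs
  · exact hX _
  · exact (proj_smul _ _).trans (hY _)

/-- The discrepancy `m` between the ends of two lifts is the holonomy of the loop formed by the two
paths, and `f` preserves holonomy. Lifts of the image paths therefore have the same discrepancy. -/
theorem lift_eq_of_act_eq_one {f : BoundaryFixing} (hf : act f = 1) {z : Surface} {x y : Path base z}
    (X Y X' Y' : C(I, Potential))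
    (hX : ∀ t, proj (X t) = crush (x t)) (hY : ∀ t, proj (Y t) = crush (y t))
    (hX' : ∀ t, proj (X' t) = crush (f.1 (x t))) (hY' : ∀ t, proj (Y' t) = crush (f.1 (y t)))
    (hX0 : X 0 = Potential.vertex) (hY0 : Y 0 = Potential.vertex)
    (hX0' : X' 0 = Potential.vertex) (hY0' : Y' 0 = Potential.vertex)
    {m : F₂} (h : X 1 = m • Y 1) : X' 1 = m • Y' 1 := by
  have hb : toMap f base = base := f.2 base base_mem_boundary
  obtain ⟨m', hm'⟩ : ∃ m', m' • Y' 1 = X' 1 := proj_eq_iff.1 (by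
    rw [hX', hY', x.target, y.target])
  have h1 := hasHol_act f (hasHol_of_lifts X Y hX hY hX0 hY0 h)
  have h2 := hasHol_of_lifts (x := (x.map (toMap f).continuous).cast hb.symm rfl)
    (y := (y.map (toMap f).continuous).cast hb.symm rfl) X' Y' hX' hY' hX0' hY0' hm'.symm
  have e : mapLoop f (x.trans y.symm) = ((x.map (toMap f).continuous).cast hb.symm rfl).trans
      ((y.map (toMap f).continuous).cast hb.symm rfl).symm := by
    refine Path.ext (funext fun t => ?_)
    rw [mapLoop_apply, Path.trans_apply, Path.trans_apply]
    split_ifs <;> rfl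
  rw [e] at h1
  have := h1.unique h2 (Path.Homotopic.refl _)
  rw [hf] at this
  rw [← hm', ← this]
  rfl

/-- The base point in the square. -/
def baseSquare : Square := ⟨(3 / 20, 1 / 5), ⟨by norm_num, by norm_num⟩, by
  rw [← base_fst, ← base_snd]; exact base.2⟩

theorem glue_baseSquare : glue baseSquare = base :=
  Subtype.ext (Prod.ext base_fst.symm base_snd.symm)

theorem exists_boundary_path {z : Surface} (hz : z ∈ boundary) :
    ∃ γ : Path base z, ∀ t, γ t ∈ boundary := by
  obtain ⟨θ, rfl⟩ : ∃ θ, circ θ = z := by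
    have hz' : radius z.1 = 1 / 4 := hz
    rw [radius_eq, Real.sqrt_eq_iff_mul_self_eq_of_pos (by norm_num)] at hz'
    set w : ℂ := ⟨4 * rep z.1.1, 4 * rep z.1.2⟩ with hw
    have hn : ‖w‖ = 1 := by
      rw [Complex.norm_def, Real.sqrt_eq_one, Complex.normSq_mk]
      linarith
    have h0 : w ≠ 0 := by rw [← norm_ne_zero_iff, hn]; exact one_ne_zero
    refine ⟨w.arg, Subtype.ext (Prod.ext ?_ ?_)⟩
    · rw [circ_fst, Complex.cos_arg h0, hn, ← coe_rep z.1.1]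
      exact congrArg (fun u : ℝ => (u : UnitAddCircle)) (by simp [hw])
    · rw [circ_snd, Complex.sin_arg, hn, ← coe_rep z.1.2]
      exact congrArg (fun u : ℝ => (u : UnitAddCircle)) (by simp [hw])
  exact ⟨arc baseAngle θ, fun t =>
    circ_mem_boundary (baseAngle + (θ - baseAngle) * t.1)⟩

/-- Over the square both maps lift to a convex space, where the straight homotopy joins the lifts.
It descends to the surface because the lifts transform alike under gluing, and it is relative to the
boundary because they agree there. -/
theorem crush_homotopicRel {f : BoundaryFixing} (hf : act f = 1) :
    (crush.comp (toMap f)).HomotopicRel crush boundary := by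
  have hb : f.1 base = base := f.2 base base_mem_boundary
  obtain ⟨F, hF, hF0⟩ := exists_lift_square (crush.comp (toMap f)) baseSquare (by
    rw [glue_baseSquare, ← crush_base]; exact congrArg crush hb)
  obtain ⟨G, hG, hG0⟩ := exists_lift_square crush baseSquare (by rw [glue_baseSquare, crush_base])
  have hF' : ∀ q, proj (F q) = crush (f.1 (glue q)) := hF
  let η : ∀ q, Path baseSquare q := fun q => PathConnectedSpace.somePath baseSquare q
  let x : ∀ q, Path base (glue q) := fun q => ((η q).map glue.continuous).cast glue_baseSquare.symm rfl
  have hsame : ∀ {q q' : Square} {m : F₂}, glue q = glue q' → G q = m • G q' → F q = m • F q' := by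
    intro q q' m hqq hm
    have := lift_eq_of_act_eq_one hf (x := x q) (y := (x q').cast rfl hqq)
      (G.comp (η q).toContinuousMap) (G.comp (η q').toContinuousMap)
      (F.comp (η q).toContinuousMap) (F.comp (η q').toContinuousMap)
      (fun _ => hG _) (fun _ => hG _) (fun _ => hF' _) (fun _ => hF' _)
      (by simpa using hG0) (by simpa using hG0) (by simpa using hF0) (by simpa using hF0)
      (m := m) (by simpa using hm)
    simpa using this
  have hbd : ∀ {q : Square}, glue q ∈ boundary → F q = G q := by
    intro q hq
    obtain ⟨γ, hγ⟩ := exists_boundary_path hq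
    obtain ⟨Δ, hΔ, hΔ0⟩ := isCoveringMap_proj.exists_path_lifts (crush.comp γ.toContinuousMap)
      Potential.vertex (by simpa using crush_base)
    have hΔ' : ∀ t, proj (Δ t) = crush (γ t) := fun t => congrFun hΔ t
    obtain ⟨m, hm⟩ : ∃ m, m • Δ 1 = G q := proj_eq_iff.1 (by rw [hG, hΔ', γ.target])
    have := lift_eq_of_act_eq_one hf (x := x q) (y := γ)
      -- A path along the boundary is fixed by `f`, so one lift of it serves on both sides of the
      -- comparison.
      (G.comp (η q).toContinuousMap) Δ (F.comp (η q).toContinuousMap) Δ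
      (fun _ => hG _) hΔ' (fun _ => hF' _) (fun t => by rw [hΔ', f.2 _ (hγ t)])
      (by simpa using hG0) hΔ0 (by simpa using hF0) hΔ0 (m := m) (by simpa using hm.symm)
    rw [← hm, ← this]
    simp
  let K₀ : C(I × Square, TreeQuotient) :=
    ⟨fun x => proj (Potential.segment x.1 (F x.2) (G x.2)), continuous_proj.comp
      (Potential.continuous_segment.comp (continuous_fst.prodMk
        ((F.continuous.comp continuous_snd).prodMk (G.continuous.comp continuous_snd))))⟩
  have hK₀ : Function.FactorsThrough K₀ (Prod.map id glue : I × Square → I × Surface) := by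
    rintro ⟨t, q⟩ ⟨t', q'⟩ h
    simp only [Prod.map_apply, id_eq, Prod.mk.injEq] at h
    obtain ⟨rfl, hqq⟩ := h
    obtain ⟨m, hm⟩ : ∃ m, m • G q' = G q := proj_eq_iff.1 (by rw [hG, hG, hqq])
    change proj (Potential.segment t (F q) (G q)) = proj (Potential.segment t (F q') (G q'))
    rw [hsame hqq hm.symm, ← hm, ← Potential.smul_segment, proj_smul]
  let K : C(I × Surface, TreeQuotient) := isQuotientMap_prodMap_glue.lift
    (f := ⟨Prod.map id glue, continuous_id.prodMap glue.continuous⟩) K₀ hK₀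
  have hK : ∀ t q, K (t, glue q) = proj (Potential.segment t (F q) (G q)) := fun t q =>
    DFunLike.congr_fun (isQuotientMap_prodMap_glue.lift_comp
      (f := ⟨Prod.map id glue, continuous_id.prodMap glue.continuous⟩) K₀ hK₀) (t, q)
  refine ⟨⟨⟨K, fun z => ?_, fun z => ?_⟩, fun t z hz => ?_⟩⟩
  · obtain ⟨q, rfl⟩ := glue_surjective z
    exact (hK 0 q).trans (by rw [Potential.segment_zero, hF])
  · obtain ⟨q, rfl⟩ := glue_surjective z
    exact (hK 1 q).trans (by rw [Potential.segment_one, hG])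
  · obtain ⟨q, rfl⟩ := glue_surjective z
    refine (hK t q).trans ?_
    rw [← hbd hz, Potential.segment_self, hF]

end

end OnceHoledTorus

namespace OnceHoledTorus

noncomputable section

open FreeGroup unitInterval

/-! ### The collar of the boundary -/

/-- The radius to which the points at distance `ρ` are moved at time `τ`. -/
def collarRadius (τ : I) (ρ : ℝ) : ℝ := max (1 / 4) (ρ - τ.1 * max 0 (3 / 8 - ρ))

theorem collarRadius_outer (τ : I) {ρ : ℝ} (h : 3 / 8 ≤ ρ) : collarRadius τ ρ = ρ := by
  rw [collarRadius, max_eq_left (by linarith : 3 / 8 - ρ ≤ 0), mul_zero, sub_zero,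
    max_eq_right (by linarith)]

theorem collarRadius_le (τ : I) {ρ : ℝ} (h : 1 / 4 ≤ ρ) : collarRadius τ ρ ≤ ρ :=
  max_le h (by have := mul_nonneg τ.2.1 (le_max_left 0 (3 / 8 - ρ)); linarith)

theorem collarRadius_zero {ρ : ℝ} (h : 1 / 4 ≤ ρ) : collarRadius 0 ρ = ρ := by
  rw [collarRadius, Set.Icc.coe_zero, zero_mul, sub_zero, max_eq_right h]

theorem collarRadius_quarter (τ : I) : collarRadius τ (1 / 4) = 1 / 4 :=
  le_antisymm (collarRadius_le τ le_rfl) (le_max_left _ _)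

theorem collarRadius_one {ρ : ℝ} (h : ρ ≤ 5 / 16) : collarRadius 1 ρ = 1 / 4 := by
  rw [collarRadius, Set.Icc.coe_one, one_mul, max_eq_right (by linarith : (0 : ℝ) ≤ 3 / 8 - ρ),
    max_eq_left (by linarith)]

/-- The homothety that changes the radius of `p` by the factor `l`. -/
def scale (l : ℝ) (p : Torus) : Torus :=
  (((l * rep p.1 : ℝ) : UnitAddCircle), ((l * rep p.2 : ℝ) : UnitAddCircle))

theorem scale_one (p : Torus) : scale 1 p = p := by simp [scale, coe_rep]

theorem radius_scale {l : ℝ} (h0 : 0 ≤ l) (h1 : l ≤ 1) (p : Torus) :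
    radius (scale l p) = l * radius p := by
  have key : ∀ s : UnitAddCircle, ‖((l * rep s : ℝ) : UnitAddCircle)‖ = l * ‖s‖ := fun s => by
    have hs := rep_mem s
    have : |rep s| ≤ 1 / 2 := abs_le.2 ⟨by linarith [hs.1], hs.2.le⟩
    rw [norm_coe_of_abs_le, abs_mul, abs_rep, abs_of_nonneg h0]
    rw [abs_mul, abs_of_nonneg h0]
    nlinarith [abs_nonneg (rep s)]
  rw [radius, scale, key, key, radius, ← Real.sqrt_sq h0, ← Real.sqrt_mul (sq_nonneg l),
    Real.sqrt_sq h0]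
  congr 1; ring

/-- The collapse of the collar on the torus. -/
def collarTorus (τ : I) (p : Torus) : Torus := scale (collarRadius τ (radius p) / radius p) p

theorem collarTorus_outer (τ : I) {p : Torus} (h : 3 / 8 ≤ radius p) : collarTorus τ p = p := by
  rw [collarTorus, collarRadius_outer τ h, div_self (by linarith), scale_one]

theorem radius_collarTorus (τ : I) {p : Torus} (h : 1 / 4 ≤ radius p) :
    radius (collarTorus τ p) = collarRadius τ (radius p) := by
  have h0 : 0 < radius p := by linarith
  have h1 : 1 / 4 ≤ collarRadius τ (radius p) := le_max_left _ _
  rw [collarTorus, radius_scale (by positivity) ((div_le_one h0).2 (collarRadius_le τ h)),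
    div_mul_cancel₀ _ h0.ne']

/-- The collapse of the collar. -/
def collar (τ : I) (z : Surface) : Surface :=
  ⟨collarTorus τ z.1, by rw [radius_collarTorus τ z.2]; exact le_max_left _ _⟩

theorem continuous_collarRadius : Continuous fun x : I × ℝ => collarRadius x.1 x.2 := by
  unfold collarRadius
  fun_prop

theorem continuous_collar : Continuous fun x : I × Surface => collar x.1 x.2 := by
  refine Continuous.subtype_mk ?_ _
  rw [continuous_iff_continuousAt]
  rintro ⟨τ, p⟩
  have hr : Continuous fun x : I × Surface => radius x.2.1 :=
    continuous_radius.comp (continuous_subtype_val.comp continuous_snd)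
  rcases lt_or_ge (3 / 8) (radius p.1) with h | h
  · have ho : IsOpen {x : I × Surface | 3 / 8 < radius x.2.1} := isOpen_lt continuous_const hr
    have hc : ContinuousAt (fun x : I × Surface => x.2.1) (τ, p) := by fun_prop
    refine hc.congr (Filter.eventuallyEq_of_mem (ho.mem_nhds h) ?_)
    intro x hx
    exact (collarTorus_outer x.1 (le_of_lt hx)).symm
  · have c1 : ContinuousAt (fun x : I × Surface => rep x.2.1.1) (τ, p) :=
      ContinuousAt.comp (f := fun x : I × Surface => x.2.1.1)
        (continuousAt_rep (by linarith [norm_fst_le_radius p.1])) (by fun_prop)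
    have c2 : ContinuousAt (fun x : I × Surface => rep x.2.1.2) (τ, p) :=
      ContinuousAt.comp (f := fun x : I × Surface => x.2.1.2)
        (continuousAt_rep (by linarith [norm_snd_le_radius p.1])) (by fun_prop)
    have ca : ContinuousAt (fun x : I × Surface =>
        collarRadius x.1 (radius x.2.1) / radius x.2.1) (τ, p) :=
      ((continuous_collarRadius.comp (continuous_fst.prodMk hr)).continuousAt).div hr.continuousAt
        (by have := p.2; dsimp only; linarith)
    have cq : Continuous (fun u : ℝ => (u : UnitAddCircle)) := AddCircle.continuous_mk' 1
    exact (cq.continuousAt.comp (ca.mul c1)).prodMk (cq.continuousAt.comp (ca.mul c2))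

theorem collar_zero (z : Surface) : collar 0 z = z := by
  apply Subtype.ext
  have h := z.2
  change scale (collarRadius 0 (radius z.1) / radius z.1) z.1 = z.1
  rw [collarRadius_zero h, div_self (by linarith), scale_one]

theorem collar_of_mem_boundary (τ : I) {z : Surface} (hz : z ∈ boundary) : collar τ z = z := by
  apply Subtype.ext
  have h : radius z.1 = 1 / 4 := hz
  change scale (collarRadius τ (radius z.1) / radius z.1) z.1 = z.1
  rw [h, collarRadius_quarter, div_self (by norm_num), scale_one]

theorem collar_one_mem_boundary {z : Surface} (h : radius z.1 ≤ 5 / 16) : collar 1 z ∈ boundary := by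
  change radius (collarTorus 1 z.1) = 1 / 4
  rw [radius_collarTorus 1 z.2, collarRadius_one h]

/-- The time to which the stretching homotopy runs at the point `z`. -/
def collarTime (z : Surface) : I := clamp (16 * radius z.1 - 4)

theorem continuous_collarTime : Continuous collarTime :=
  continuous_clamp.comp (((continuous_radius.comp continuous_subtype_val).const_mul 16).sub
    continuous_const)

theorem collarTime_of_mem_boundary {z : Surface} (hz : z ∈ boundary) : collarTime z = 0 := by
  have h : radius z.1 = 1 / 4 := hz
  rw [collarTime, h, clamp_of_nonpos (by norm_num)]

theorem collarTime_of_le {z : Surface} (h : 5 / 16 ≤ radius z.1) : collarTime z = 1 :=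
  clamp_of_one_le (by linarith)

/-- A map is homotopic relative to the boundary to its composition with the collapse of the collar and the
stretching homotopy. -/
theorem homotopicRel_stretch {f : C(Surface, Surface)} :
    f.HomotopicRel ⟨fun z => stretchHomotopy (collarTime z, f (collar 1 z)), by
      have := continuous_collarTime
      have := continuous_collar
      fun_prop⟩ boundary := by
  have h1 := continuous_collarTime
  have h2 := continuous_collar
  have e1 : f.HomotopicRel ⟨fun z => f (collar 1 z), by fun_prop⟩ boundary := by
    refine ⟨⟨⟨⟨fun x => f (collar x.1 x.2), by fun_prop⟩, fun z => ?_, fun z => rfl⟩, fun t z hz => ?_⟩⟩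
    · exact congrArg f (collar_zero z)
    · exact congrArg f (collar_of_mem_boundary t hz)
  refine e1.trans ⟨⟨⟨⟨fun x => stretchHomotopy (x.1 * collarTime x.2, f (collar 1 x.2)), by fun_prop⟩,
    fun z => ?_, fun z => ?_⟩, fun t z hz => ?_⟩⟩
  · change stretchHomotopy (0 * collarTime z, f (collar 1 z)) = f (collar 1 z)
    rw [zero_mul]
    exact stretchHomotopy.map_zero_left _
  · change stretchHomotopy (1 * collarTime z, f (collar 1 z)) = _
    rw [one_mul]
    rfl
  · change stretchHomotopy (t * collarTime z, f (collar 1 z)) = f (collar 1 z)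
    rw [collarTime_of_mem_boundary hz, mul_zero]
    exact stretchHomotopy.map_zero_left _

/-- The action of the mapping class group on the free group is faithful. -/
theorem mem_trivial_of_act_eq_one {f : BoundaryFixing} (hf : act f = 1) : f ∈ Trivial := by
  obtain ⟨K⟩ := crush_homotopicRel hf
  have h1 := continuous_collarTime
  have h2 := continuous_collar
  have hr : Continuous fun x : I × Surface => radius x.2.1 :=
    continuous_radius.comp (continuous_subtype_val.comp continuous_snd)
  have s1 : ∀ z, stretchHomotopy (1, z) = spread (crush z) := stretchHomotopy.map_one_left
  refine (homotopicRel_stretch (f := toMap f)).trans (ContinuousMap.HomotopicRel.trans ?_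
    (homotopicRel_stretch (f := ContinuousMap.id Surface)).symm)
  -- The stretching homotopy moves the boundary, so it is run gradually across the collar. For
  -- radius at most `5 / 16` the collar is collapsed to the boundary, where `f` is the identity and
  -- nothing has to move; outside, the stretching is complete and `spread ∘ K` interpolates.
  refine ⟨⟨⟨⟨fun x => if 5 / 16 ≤ radius x.2.1 then spread (K (x.1, collar 1 x.2)) else
    stretchHomotopy (collarTime x.2, collar 1 x.2), ?_⟩, fun z => ?_, fun z => ?_⟩, fun t z hz => ?_⟩⟩
  · refine Continuous.if_le ?_ ?_ continuous_const hr ?_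
    · fun_prop
    · fun_prop
    · intro x hx
      have hb := collar_one_mem_boundary (z := x.2) hx.symm.le
      rw [collarTime_of_le hx.le, s1]
      congr 1
      refine (K.eq_fst x.1 hb).trans ?_
      exact congrArg crush (f.2 _ hb)
  · change (if _ then _ else _) = stretchHomotopy (collarTime z, f.1 (collar 1 z))
    split_ifs with h
    · rw [collarTime_of_le h, s1]
      exact congrArg spread (K.map_zero_left _)
    · rw [f.2 _ (collar_one_mem_boundary (not_le.1 h).le)]
  · change (if _ then _ else _) = stretchHomotopy (collarTime z, collar 1 z)
    split_ifs with h
    · rw [collarTime_of_le h, s1]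
      exact congrArg spread (K.map_one_left _)
    · rfl
  · have hz' : radius z.1 = 1 / 4 := hz
    change (if 5 / 16 ≤ radius z.1 then _ else _) = stretchHomotopy (collarTime z, f.1 (collar 1 z))
    rw [if_neg (by rw [hz']; norm_num), f.2 _ (collar_one_mem_boundary (by rw [hz']; norm_num))]

/-- The action of the mapping class group on the free group. -/
def mcgAct : MappingClassGroup →* MulAut F₂ :=
  QuotientGroup.lift Trivial act fun _ h => act_of_mem_trivial h

theorem mcgAct_mappingClass (f : BoundaryFixing) : mcgAct (mappingClass f) = act f := rfl

theorem mcgAct_injective : Function.Injective mcgAct := by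
  rw [injective_iff_map_eq_one]
  intro g hg
  obtain ⟨f, rfl⟩ := QuotientGroup.mk_surjective g
  exact (QuotientGroup.eq_one_iff f).2 (mem_trivial_of_act_eq_one hg)

theorem mcgAct_x : mcgAct x = autX := act_twistX
theorem mcgAct_y : mcgAct y = autY := act_twistY
theorem mcgAct_δ : mcgAct δ = MulAut.conj boundaryWord⁻¹ := act_twistDelta

theorem braid_relation : x * y * x = y * x * y := by
  apply mcgAct_injective
  simp only [_root_.map_mul, mcgAct_x, mcgAct_y, autX_mul_autY_mul_autX]

theorem chain_relation : (x * y) ^ 6 = δ := by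
  apply mcgAct_injective
  rw [_root_.map_pow, _root_.map_mul, mcgAct_x, mcgAct_y, mcgAct_δ, autX_mul_autY_pow_six]

/-- The mapping class group is generated by the two Dehn twists. -/
theorem closure_x_y : Subgroup.closure {x, y} = ⊤ := by
  rw [eq_top_iff]
  intro g _
  obtain ⟨f, rfl⟩ := QuotientGroup.mk_surjective g
  -- The action fixes the boundary word, so it is a product of twist automorphisms and their
  -- inverses; faithfulness pulls this back to the mapping class group.
  obtain ⟨τ, hτ, h⟩ := exists_mem_closure_eq (ψ := (act f).toMonoidHom) (act_boundaryWord f)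
  have e : mcgAct (QuotientGroup.mk f) = τ := MulEquiv.ext fun w => (h w).symm
  have hmap : Subgroup.closure {autX, autY} = (Subgroup.closure {x, y}).map mcgAct := by
    rw [MonoidHom.map_closure, Set.image_pair, mcgAct_x, mcgAct_y]
  rw [hmap] at hτ
  obtain ⟨g, hg, hg'⟩ := hτ
  rw [← mcgAct_injective (hg'.trans e.symm)]
  exact hg

end

end OnceHoledTorus

/-! ### Singular one-chains modulo boundaries -/

namespace SingularOne

noncomputable section

open CategoryTheory Limits unitInterval
open scoped Simplicial

variable {X Y : TopCat.{0}}

/-- The singular chain complex of `X` with integral coefficients. -/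
abbrev chains (X : TopCat.{0}) : ChainComplex (ModuleCat.{0} ℤ) ℕ :=
  (TopCat.toSSet.obj X).chainComplex (ModuleCat.of ℤ ℤ)

/-- The inclusion of the summand of a simplex. -/
abbrev incl {n : ℕ} (s : TopCat.toSSet.obj X _⦋n⦌) : ModuleCat.of ℤ ℤ ⟶ (chains X).X n :=
  (TopCat.toSSet.obj X).ιChainComplex s

/-- The degree one singular chains of `X` modulo boundaries. -/
abbrev Coker (X : TopCat.{0}) : ModuleCat.{0} ℤ := (chains X).opcycles 1

/-- The singular `1`-simplex with a given parametrization by the unit interval. -/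
def simplex (c : C(I, X)) : TopCat.toSSet.obj X _⦋1⦌ :=
  (TopCat.toSSetObjEquiv X _).symm
    (c.comp (stdSimplexHomeomorphUnitInterval : C(stdSimplex ℝ (Fin 2), I)))

theorem simplex_surjective : Function.Surjective (simplex : C(I, X) → _) := by
  intro s
  refine ⟨(TopCat.toSSetObjEquiv X _ s).comp
    (stdSimplexHomeomorphUnitInterval.symm : C(I, stdSimplex ℝ (Fin 2))), ?_⟩
  rw [simplex, Equiv.symm_apply_eq]
  ext z
  exact congrArg (TopCat.toSSetObjEquiv X (.op ⦋1⦌) s)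
    (stdSimplexHomeomorphUnitInterval.symm_apply_apply z)

theorem simplex_injective : Function.Injective (simplex : C(I, X) → _) := by
  intro c c' h
  have h' := (TopCat.toSSetObjEquiv X _).symm.injective h
  ext t
  have e := DFunLike.congr_fun h' (stdSimplexHomeomorphUnitInterval.symm t)
  change c (stdSimplexHomeomorphUnitInterval _) = c' (stdSimplexHomeomorphUnitInterval _) at e
  rwa [Homeomorph.apply_symm_apply] at e

/-- The class of a singular `1`-simplex modulo boundaries. -/
def cls (c : C(I, X)) : Coker X := (incl (simplex c) ≫ (chains X).pOpcycles 1).hom (1 : ℤ)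

/-- The `0`-chain given by a point. -/
def pt (z : X) : (chains X).X 0 := (incl (TopCat.toSSetObj₀Equiv.symm z)).hom (1 : ℤ)

theorem hom_ext {M : ModuleCat.{0} ℤ} {f g : Coker X ⟶ M}
    (h : ∀ c : C(I, X), f.hom (cls c) = g.hom (cls c)) : f = g := by
  rw [← cancel_epi ((chains X).pOpcycles 1)]
  refine SSet.chainComplex_hom_ext fun s => ?_
  obtain ⟨c, rfl⟩ := simplex_surjective s
  refine ModuleCat.hom_ext (LinearMap.ext_ring ?_)
  exact h c

/-- The faces of a singular `2`-simplex, parametrized by the unit interval. -/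
def face (i : Fin 3) (s : C(stdSimplex ℝ (Fin 3), X)) : C(I, X) :=
  s.comp ⟨fun t => stdSimplex.map i.succAbove (stdSimplexHomeomorphUnitInterval.symm t),
    (stdSimplex.continuous_map _).comp (Homeomorph.continuous _)⟩

theorem δ_symm (i : Fin 3) (s : C(stdSimplex ℝ (Fin 3), X)) :
    (TopCat.toSSet.obj X).δ i ((TopCat.toSSetObjEquiv X (.op ⦋2⦌)).symm s) =
      simplex (face i s) := by
  refine (TopCat.toSSetObjEquiv X _).injective ?_
  ext z
  exact congrArg (fun w => s (stdSimplex.map i.succAbove w))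
    (stdSimplexHomeomorphUnitInterval.symm_apply_apply z).symm

theorem incl_d (s : C(stdSimplex ℝ (Fin 3), X)) :
    incl ((TopCat.toSSetObjEquiv X (.op ⦋2⦌)).symm s) ≫ (chains X).d 2 1 =
      incl (simplex (face 0 s)) - incl (simplex (face 1 s)) + incl (simplex (face 2 s)) := by
  rw [SSet.ιChainComplex_d, Fin.sum_univ_three, δ_symm, δ_symm, δ_symm]
  simp [sub_eq_add_neg]

/-- The boundary of a singular triangle vanishes in the quotient; homotopy invariance and additivity
of paths come from suitable triangles. -/
theorem cls_face (s : C(stdSimplex ℝ (Fin 3), X)) :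
    cls (face 1 s) = cls (face 2 s) + cls (face 0 s) := by
  have h : (incl ((TopCat.toSSetObjEquiv X (.op ⦋2⦌)).symm s) ≫ (chains X).d 2 1) ≫
      (chains X).pOpcycles 1 = 0 := by
    rw [Category.assoc, HomologicalComplex.d_pOpcycles, comp_zero]
  rw [incl_d, Preadditive.add_comp, Preadditive.sub_comp] at h
  have h' := congrArg (fun f => f.hom (1 : ℤ)) h
  change cls (face 0 s) - cls (face 1 s) + cls (face 2 s) = 0 at h'
  rw [← sub_eq_zero, ← neg_eq_zero, ← h']
  abel

theorem d_incl (c : C(I, X)) : incl (simplex c) ≫ (chains X).d 1 0 =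
    incl (TopCat.toSSetObj₀Equiv.symm (c 1)) - incl (TopCat.toSSetObj₀Equiv.symm (c 0)) := by
  rw [SSet.ιChainComplex_d, Fin.sum_univ_two]
  have h0 : (TopCat.toSSet.obj X).δ 0 (simplex c) = TopCat.toSSetObj₀Equiv.symm (c 1) := by
    rw [Equiv.eq_symm_apply, TopCat.toSSetObj₀Equiv_apply]
    refine congrArg c (Eq.trans (congrArg (fun w => stdSimplexHomeomorphUnitInterval
      (stdSimplex.map (Fin.succAbove 0) w)) (Subsingleton.elim _ (stdSimplex.vertex (0 : Fin 1)))) ?_)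
    rw [stdSimplex.map_vertex]
    rfl
  have h1 : (TopCat.toSSet.obj X).δ 1 (simplex c) = TopCat.toSSetObj₀Equiv.symm (c 0) := by
    rw [Equiv.eq_symm_apply, TopCat.toSSetObj₀Equiv_apply]
    refine congrArg c (Eq.trans (congrArg (fun w => stdSimplexHomeomorphUnitInterval
      (stdSimplex.map (Fin.succAbove 1) w)) (Subsingleton.elim _ (stdSimplex.vertex (0 : Fin 1)))) ?_)
    rw [stdSimplex.map_vertex]
    rfl
  rw [h0, h1]
  simp [sub_eq_add_neg]

theorem fromOpcycles_cls (c : C(I, X)) :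
    ((chains X).fromOpcycles 1 0).hom (cls c) = pt (c 1) - pt (c 0) := by
  have h : (incl (simplex c) ≫ (chains X).pOpcycles 1) ≫ (chains X).fromOpcycles 1 0 =
      incl (TopCat.toSSetObj₀Equiv.symm (c 1)) - incl (TopCat.toSSetObj₀Equiv.symm (c 0)) := by
    rw [Category.assoc, HomologicalComplex.p_fromOpcycles, d_incl]
  exact congrArg (fun f => f.hom (1 : ℤ)) h

theorem exists_desc_chains {M : ModuleCat.{0} ℤ} {n : ℕ} (u : TopCat.toSSet.obj X _⦋n⦌ → M) :
    ∃ f : (chains X).X n ⟶ M, ∀ s, f.hom ((incl s).hom (1 : ℤ)) = u s := by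
  refine ⟨Cofan.IsColimit.desc ((TopCat.toSSet.obj X).isColimitChainComplexXCofan _ n)
    fun s => ModuleCat.ofHom (LinearMap.toSpanSingleton ℤ M (u s)), fun s => ?_⟩
  have h := Cofan.IsColimit.fac
    ((TopCat.toSSet.obj X).isColimitChainComplexXCofan (ModuleCat.of ℤ ℤ) n)
    (fun s => ModuleCat.ofHom (LinearMap.toSpanSingleton ℤ M (u s))) s
  have e : LinearMap.toSpanSingleton ℤ M (u s) 1 = u s :=
    (LinearMap.toSpanSingleton_apply ℤ M (u s) 1).trans
      (M.isModule.toDistribMulAction.toMulAction.one_smul (u s))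
  exact (congrArg (fun f => f.hom (1 : ℤ)) h).trans e

theorem exists_desc₀ {M : ModuleCat.{0} ℤ} (u : X → M) :
    ∃ f : (chains X).X 0 ⟶ M, ∀ z, f.hom (pt z) = u z := by
  obtain ⟨f, hf⟩ := exists_desc_chains fun s => u (TopCat.toSSetObj₀Equiv s)
  refine ⟨f, fun z => (hf _).trans ?_⟩
  rw [Equiv.apply_symm_apply]

/-- Chains are free on simplices, so a function on paths extends; the triangle relation is exactly
what lets it descend modulo boundaries. -/
theorem exists_desc {M : ModuleCat.{0} ℤ} (u : C(I, X) → M)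
    (h : ∀ s, u (face 1 s) = u (face 2 s) + u (face 0 s)) :
    ∃ f : Coker X ⟶ M, ∀ c, f.hom (cls c) = u c := by
  obtain ⟨v, hv⟩ := simplex_surjective.hasRightInverse (α := C(I, X))
  have hv' : ∀ c, v (simplex c) = c := fun c => simplex_injective (hv _)
  obtain ⟨f, hf⟩ := exists_desc_chains fun s => u (v s)
  have hd : (chains X).d 2 1 ≫ f = 0 := by
    refine SSet.chainComplex_hom_ext fun t => ?_
    obtain ⟨s, rfl⟩ := (TopCat.toSSetObjEquiv X (.op ⦋2⦌)).symm.surjective t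
    rw [← Category.assoc, incl_d, Preadditive.add_comp, Preadditive.sub_comp, comp_zero]
    refine ModuleCat.hom_ext (LinearMap.ext_ring ?_)
    change f.hom ((incl (simplex (face 0 s))).hom (1 : ℤ)) -
      f.hom ((incl (simplex (face 1 s))).hom (1 : ℤ)) +
      f.hom ((incl (simplex (face 2 s))).hom (1 : ℤ)) = 0
    rw [hf, hf, hf, hv', hv', hv', h]
    abel
  refine ⟨(chains X).descOpcycles f 2 (by simp) hd, fun c => ?_⟩
  have e : (incl (simplex c) ≫ (chains X).pOpcycles 1) ≫ (chains X).descOpcycles f 2 (by simp) hd =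
      incl (simplex c) ≫ f := by
    rw [Category.assoc, HomologicalComplex.p_descOpcycles]
  refine (congrArg (fun f => f.hom (1 : ℤ)) e).trans ((hf _).trans ?_)
  rw [hv']

theorem opcyclesMap_cls (f : X ⟶ Y) (c : C(I, X)) :
    (HomologicalComplex.opcyclesMap (SSet.chainComplexMap (TopCat.toSSet.map f) (ModuleCat.of ℤ ℤ)) 1).hom
      (cls c) = cls (f.hom.comp c) := by
  have h : (incl (simplex c) ≫ (chains X).pOpcycles 1) ≫ HomologicalComplex.opcyclesMap
      (SSet.chainComplexMap (TopCat.toSSet.map f) (ModuleCat.of ℤ ℤ)) 1 =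
      incl (simplex (f.hom.comp c)) ≫ (chains Y).pOpcycles 1 := by
    rw [Category.assoc, HomologicalComplex.p_opcyclesMap, SSet.ι_chainComplexMap_f_assoc]
    rfl
  exact congrArg (fun f => f.hom (1 : ℤ)) h

theorem exists_homology_of_loop {c : C(I, X)} (h : c 0 = c 1) :
    ∃ z : (chains X).homology 1, ((chains X).homologyι 1).hom z = cls c := by
  have hd : incl (simplex c) ≫ (chains X).d 1 0 = 0 := by
    rw [d_incl, h, sub_self]
  refine ⟨((chains X).liftCycles (incl (simplex c)) 0 (by simp) hd ≫
    (chains X).homologyπ 1).hom (1 : ℤ), ?_⟩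
  have : ((chains X).liftCycles (incl (simplex c)) 0 (by simp) hd ≫
    (chains X).homologyπ 1) ≫ (chains X).homologyι 1 = incl (simplex c) ≫ (chains X).pOpcycles 1 := by
    simp
  exact congrArg (fun f => f.hom (1 : ℤ)) this

/-! ### Chains of paths -/

theorem map_symm_apply (t : I) :
    (⇑(stdSimplex.map (Fin.succAbove 0) (stdSimplexHomeomorphUnitInterval.symm t)) =
      (![0, 1 - t, t] : Fin 3 → ℝ)) ∧
    (⇑(stdSimplex.map (Fin.succAbove 1) (stdSimplexHomeomorphUnitInterval.symm t)) =
      (![1 - t, 0, t] : Fin 3 → ℝ)) ∧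
    (⇑(stdSimplex.map (Fin.succAbove 2) (stdSimplexHomeomorphUnitInterval.symm t)) =
      (![1 - t, t, 0] : Fin 3 → ℝ)) := by
  have h0 : stdSimplexHomeomorphUnitInterval.symm t 0 = 1 - t.1 := rfl
  have h1 : stdSimplexHomeomorphUnitInterval.symm t 1 = t.1 := rfl
  refine ⟨?_, ?_, ?_⟩ <;> ext j <;> fin_cases j <;>
    rw [stdSimplex.map_coe, FunOnFinite.linearMap_apply_apply, Finset.sum_filter, Fin.sum_univ_two,
      h0, h1] <;> simp [Fin.succAbove]

theorem exists_face_eq (F : C(ℝ × ℝ, X)) : ∃ s : C(stdSimplex ℝ (Fin 3), X),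
    (∀ t, face 0 s t = F (1 - t, t)) ∧ (∀ t, face 1 s t = F (0, t)) ∧
      (∀ t, face 2 s t = F (t, 0)) := by
  refine ⟨F.comp ⟨fun p => (p.1 1, p.1 2),
    ((continuous_apply 1).comp continuous_subtype_val).prodMk
      ((continuous_apply 2).comp continuous_subtype_val)⟩, fun t => ?_, fun t => ?_, fun t => ?_⟩
  · refine congrArg F (Prod.ext ?_ ?_)
    · exact congrFun (map_symm_apply t).1 1
    · exact congrFun (map_symm_apply t).1 2
  · refine congrArg F (Prod.ext ?_ ?_)
    · exact congrFun (map_symm_apply t).2.1 1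
    · exact congrFun (map_symm_apply t).2.1 2
  · refine congrArg F (Prod.ext ?_ ?_)
    · exact congrFun (map_symm_apply t).2.2 1
    · exact congrFun (map_symm_apply t).2.2 2

theorem cls_const (z : X) : cls (ContinuousMap.const I z) = 0 := by
  have h := cls_face (ContinuousMap.const (stdSimplex ℝ (Fin 3)) z)
  exact left_eq_add.1 h

theorem cls_trans {x y z : X} (γ : Path x y) (γ' : Path y z) :
    cls (γ.trans γ').toContinuousMap = cls γ.toContinuousMap + cls γ'.toContinuousMap := by
  -- This triangle factors through the concatenated path by an affine function taking the vertices
  -- to times `0`, `1 / 2` and `1`.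
  obtain ⟨s, h0, h1, h2⟩ := exists_face_eq (X := X)
    ⟨fun p => (γ.trans γ').extend (p.1 / 2 + p.2), by fun_prop⟩
  have e0 : face 0 s = γ'.toContinuousMap := by
    ext t
    rw [h0]
    change (γ.trans γ').extend ((1 - t.1) / 2 + t.1) = γ' t
    have h : (1 - t.1) / 2 + t.1 ∈ I := ⟨by linarith [t.2.1], by linarith [t.2.2]⟩
    rw [Path.extend_apply _ h, Path.trans_apply]
    split_ifs with h'
    · obtain rfl : t = 0 := Subtype.ext (le_antisymm (by change t.1 ≤ 0; dsimp at h'; linarith) t.2.1)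
      rw [γ'.source]
      convert γ.target
      norm_num
    · congr 1
      exact Subtype.ext (by dsimp; ring)
  have e1 : face 1 s = (γ.trans γ').toContinuousMap := by
    ext t
    rw [h1]
    change (γ.trans γ').extend (0 / 2 + t.1) = γ.trans γ' t
    rw [zero_div, zero_add, Path.extend_apply _ t.2]
  have e2 : face 2 s = γ.toContinuousMap := by
    ext t
    rw [h2]
    change (γ.trans γ').extend (t.1 / 2 + 0) = γ t
    have h : t.1 / 2 + 0 ∈ I := ⟨by linarith [t.2.1], by linarith [t.2.2]⟩
    rw [Path.extend_apply _ h, Path.trans_apply, dif_pos (by dsimp; linarith [t.2.2])]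
    congr 1
    exact Subtype.ext (by dsimp; ring)
  rw [← e0, ← e1, ← e2, cls_face]

theorem cls_eq_of_homotopic {x y : X} {γ γ' : Path x y} (h : γ.Homotopic γ') :
    cls γ.toContinuousMap = cls γ'.toContinuousMap := by
  obtain ⟨F⟩ := h
  let P : C(ℝ × ℝ, X) := ⟨fun p => F (Set.projIcc 0 1 zero_le_one p.1, Set.projIcc 0 1 zero_le_one p.2),
    by fun_prop⟩
  have hP : ∀ a b : I, P (a, b) = F (a, b) := fun a b => by
    simp [P]
  -- The homotopy square is cut along its diagonal into two triangles; the sides on which the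
  -- homotopy is constant contribute zero.
  obtain ⟨s, h0, h1, h2⟩ := exists_face_eq (X := X)
    ⟨fun p => P (p.2, p.1 + p.2), by fun_prop⟩
  obtain ⟨s', h0', h1', h2'⟩ := exists_face_eq (X := X)
    ⟨fun p => P (p.1 + p.2, p.2), by fun_prop⟩
  have e0 : face 0 s = ContinuousMap.const I y := by
    ext t
    rw [h0]
    change P (t.1, 1 - t.1 + t.1) = y
    rw [sub_add_cancel]
    exact ((hP t 1).trans (F.target _))
  have e2 : face 2 s = γ.toContinuousMap := by
    ext t
    rw [h2]
    change P (0, t.1 + 0) = γ t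
    rw [add_zero]
    exact ((hP 0 t).trans (F.apply_zero _))
  have e0' : face 0 s' = γ'.toContinuousMap := by
    ext t
    rw [h0']
    change P (1 - t.1 + t.1, t.1) = γ' t
    rw [sub_add_cancel]
    exact ((hP 1 t).trans (F.apply_one _))
  have e2' : face 2 s' = ContinuousMap.const I x := by
    ext t
    rw [h2']
    change P (t.1 + 0, 0) = x
    rw [add_zero]
    exact ((hP t 0).trans (F.source _))
  have e1 : face 1 s = face 1 s' := by
    ext t
    rw [h1, h1']
    exact congrArg P (Prod.ext (show t.1 = 0 + t.1 by simp) (show 0 + t.1 = t.1 by simp))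
  have k := cls_face s
  have k' := cls_face s'
  rw [e0, e2, cls_const, add_zero] at k
  rw [e0', e2', cls_const, zero_add] at k'
  rw [← k, e1, k']

theorem cls_symm {x y : X} (γ : Path x y) :
    cls γ.symm.toContinuousMap = -cls γ.toContinuousMap := by
  have h := cls_eq_of_homotopic (Path.Homotopic.Quotient.exact
    (by simp : Path.Homotopic.Quotient.mk (γ.trans γ.symm) = Path.Homotopic.Quotient.mk (Path.refl x)))
  rw [cls_trans] at h
  exact eq_neg_of_add_eq_zero_right (h.trans (cls_const x))

instance : ContractibleSpace (stdSimplex ℝ (Fin 3)) :=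
  (convex_stdSimplex ℝ (Fin 3)).contractibleSpace ⟨_, single_mem_stdSimplex ℝ (0 : Fin 3)⟩

/-- The edges of the standard triangle. -/
theorem exists_paths_face (s : C(stdSimplex ℝ (Fin 3), X)) :
    ∃ (x y z : X) (γ : Path x y) (γ' : Path y z) (γ'' : Path x z), γ.toContinuousMap = face 2 s ∧
      γ'.toContinuousMap = face 0 s ∧ γ''.toContinuousMap = face 1 s ∧
      γ''.Homotopic (γ.trans γ') := by
  have hc : ∀ i : Fin 3, Continuous fun t : I =>
      stdSimplex.map (S := ℝ) i.succAbove (stdSimplexHomeomorphUnitInterval.symm t) := fun i =>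
    (stdSimplex.continuous_map _).comp (Homeomorph.continuous _)
  have hI : stdSimplexHomeomorphUnitInterval.symm 0 = stdSimplex.vertex 0 ∧
      stdSimplexHomeomorphUnitInterval.symm 1 = stdSimplex.vertex 1 :=
    ⟨(Homeomorph.symm_apply_eq _).2 rfl, (Homeomorph.symm_apply_eq _).2 rfl⟩
  let v : Fin 3 → stdSimplex ℝ (Fin 3) := fun i => stdSimplex.vertex i
  let e2 : Path (v 0) (v 1) := ⟨⟨_, hc 2⟩,
    (congrArg (stdSimplex.map (Fin.succAbove 2)) hI.1).trans (stdSimplex.map_vertex _ _),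
    (congrArg (stdSimplex.map (Fin.succAbove 2)) hI.2).trans (stdSimplex.map_vertex _ _)⟩
  let e0 : Path (v 1) (v 2) := ⟨⟨_, hc 0⟩,
    (congrArg (stdSimplex.map (Fin.succAbove 0)) hI.1).trans (stdSimplex.map_vertex _ _),
    (congrArg (stdSimplex.map (Fin.succAbove 0)) hI.2).trans (stdSimplex.map_vertex _ _)⟩
  let e1 : Path (v 0) (v 2) := ⟨⟨_, hc 1⟩,
    (congrArg (stdSimplex.map (Fin.succAbove 1)) hI.1).trans (stdSimplex.map_vertex _ _),
    (congrArg (stdSimplex.map (Fin.succAbove 1)) hI.2).trans (stdSimplex.map_vertex _ _)⟩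
  refine ⟨_, _, _, e2.map s.continuous, e0.map s.continuous, e1.map s.continuous, rfl, rfl, rfl, ?_⟩
  rw [← Path.map_trans]
  exact (SimplyConnectedSpace.paths_homotopic e1 (e2.trans e0)).map s

end

end SingularOne

/-! ### The first homology of the surface and the trace -/

namespace OnceHoledTorus

noncomputable section

open CategoryTheory FreeGroup unitInterval SingularOne

/-- The holonomy of a loop at the base point. -/
def hol (γ : Path base base) : F₂ := (HasHol.exists_of_crush_eq γ crush_base crush_base).choose

theorem hasHol_hol (γ : Path base base) : HasHol γ (hol γ) :=
  (HasHol.exists_of_crush_eq γ crush_base crush_base).choose_spec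

/-- The loop at the base point obtained from a path by joining its ends to the base point. -/
def closeUp {x y : Surface} (γ : Path x y) : Path base base :=
  (PathConnectedSpace.somePath base x).trans (γ.trans (PathConnectedSpace.somePath base y).symm)

theorem closeUp_homotopic {x y : Surface} {γ γ' : Path x y} (h : γ.Homotopic γ') :
    (closeUp γ).Homotopic (closeUp γ') :=
  (Path.Homotopic.refl _).hcomp (h.hcomp (Path.Homotopic.refl _))

theorem closeUp_trans {x y z : Surface} (γ : Path x y) (γ' : Path y z) :
    (closeUp (γ.trans γ')).Homotopic ((closeUp γ).trans (closeUp γ')) := by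
  have cancel : ∀ {a b c : Surface} (p : Path.Homotopic.Quotient a b)
      (q : Path.Homotopic.Quotient b c), p.symm.trans (p.trans q) = q := fun p q => by
    rw [← Path.Homotopic.Quotient.trans_assoc, Path.Homotopic.Quotient.symm_trans,
      Path.Homotopic.Quotient.refl_trans]
  refine Path.Homotopic.Quotient.exact ?_
  simp only [closeUp, Path.Homotopic.Quotient.mk_trans, Path.Homotopic.Quotient.mk_symm,
    Path.Homotopic.Quotient.trans_assoc, cancel]

/-- The exponent sums of the holonomy of a path. -/
def weight {x y : Surface} (γ : Path x y) : Fin 2 → ℤ := (expSum (hol (closeUp γ))).toAdd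

/-- Closing up through chosen paths to the base point makes the inner connecting paths cancel, so
additivity holds for paths and not only for loops. -/
theorem weight_trans {x y z : Surface} (γ : Path x y) (γ' : Path y z) :
    weight (γ.trans γ') = weight γ + weight γ' := by
  rw [weight, (hasHol_hol _).unique ((hasHol_hol (closeUp γ)).trans (hasHol_hol (closeUp γ')))
    (closeUp_trans γ γ'), _root_.map_mul, toAdd_mul, weight, weight]

theorem weight_eq_of_homotopic {x y : Surface} {γ γ' : Path x y} (h : γ.Homotopic γ') :
    weight γ = weight γ' := by
  rw [weight, (hasHol_hol _).unique (hasHol_hol (closeUp γ')) (closeUp_homotopic h), weight]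

theorem weight_of_hasHol {γ : Path base base} {g : F₂} (h : HasHol γ g) :
    weight γ = (expSum g).toAdd := by
  have hs := hasHol_hol (PathConnectedSpace.somePath base base)
  rw [weight, (hasHol_hol (closeUp γ)).unique (hs.trans (h.trans hs.symm)) (Path.Homotopic.refl _)]
  simp

/-- The homomorphism on chains modulo boundaries that is given by the weight on paths. -/
theorem exists_weightHom : ∃ W : Coker (TopCat.of Surface) ⟶ ModuleCat.of ℤ (Fin 2 → ℤ),
    ∀ {x y : Surface} (γ : Path x y), W.hom (cls (X := TopCat.of Surface) γ.toContinuousMap) = weight γ := by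
  let u : C(I, Surface) → Fin 2 → ℤ := fun c => weight (⟨c, rfl, rfl⟩ : Path (c 0) (c 1))
  have hu : ∀ {x y : Surface} (γ : Path x y), u γ.toContinuousMap = weight γ := by
    rintro x y ⟨c, rfl, rfl⟩
    rfl
  obtain ⟨W, hW⟩ := exists_desc (X := TopCat.of Surface) (M := ModuleCat.of ℤ (Fin 2 → ℤ)) u
    fun s => by
      obtain ⟨x, y, z, γ, γ', γ'', h, h', h'', e⟩ := exists_paths_face s
      rw [← h, ← h', ← h'']
      exact (hu γ'').trans ((weight_eq_of_homotopic e).trans ((weight_trans γ γ').trans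
        (congrArg₂ (· + ·) (hu γ).symm (hu γ').symm)))
  exact ⟨W, fun γ => (hW _).trans (hu γ)⟩

/-- The homomorphism from `ℤ²` to chains modulo boundaries given by the two standard loops. -/
def loopHom : (Fin 2 → ℤ) →ₗ[ℤ] Coker (TopCat.of Surface) :=
  Fintype.linearCombination ℤ ![cls (X := TopCat.of Surface) loopA.toContinuousMap,
    cls (X := TopCat.of Surface) loopB.toContinuousMap]

theorem cls_eq_loopHom {γ : Path base base} {g : F₂} (h : HasHol γ g) :
    cls (X := TopCat.of Surface) γ.toContinuousMap = loopHom (expSum g).toAdd := by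
  induction g using FreeGroup.induction_on generalizing γ with
  | C1 =>
    have h1 : HasHol (loopA.trans loopA.symm) 1 := by
      simpa using hasHol_loopA.trans hasHol_loopA.symm
    rw [cls_eq_of_homotopic (X := TopCat.of Surface) (h.homotopic h1),
      cls_trans (X := TopCat.of Surface), cls_symm (X := TopCat.of Surface)]
    simp
  | of i =>
    rw [expSum_of]
    fin_cases i
    · rw [cls_eq_of_homotopic (X := TopCat.of Surface) (h.homotopic hasHol_loopA)]
      simp only [loopHom, Fin.zero_eta, Fintype.linearCombination_apply_single]
      exact ((Coker _).isModule.toDistribMulAction.toMulAction.one_smul _).symm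
    · rw [cls_eq_of_homotopic (X := TopCat.of Surface) (h.homotopic hasHol_loopB)]
      simp only [loopHom, Fin.mk_one, Fintype.linearCombination_apply_single]
      exact ((Coker _).isModule.toDistribMulAction.toMulAction.one_smul _).symm
  | inv_of i ih =>
    have e := ih (by simpa using h.symm)
    rw [cls_symm (X := TopCat.of Surface)] at e
    rw [_root_.map_inv, toAdd_inv, _root_.map_neg, ← e, neg_neg]
  | mul g g' ih ih' =>
    obtain ⟨γ₁, h₁⟩ := exists_hasHol g
    obtain ⟨γ₂, h₂⟩ := exists_hasHol g'
    rw [cls_eq_of_homotopic (X := TopCat.of Surface) (h.homotopic (h₁.trans h₂)),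
      cls_trans (X := TopCat.of Surface), ih h₁, ih' h₂, _root_.map_mul, toAdd_mul, _root_.map_add]

/-- The correction terms depend only on the endpoints, so they factor through the boundary map and
vanish on cycles. -/
theorem cls_closeUp {x y : Surface} (γ : Path x y) :
    cls (X := TopCat.of Surface) γ.toContinuousMap = loopHom (weight γ) +
      (cls (X := TopCat.of Surface) (PathConnectedSpace.somePath base y).toContinuousMap -
        cls (X := TopCat.of Surface) (PathConnectedSpace.somePath base x).toContinuousMap) := by
  have h := cls_eq_loopHom (hasHol_hol (closeUp γ))
  rw [closeUp, cls_trans (X := TopCat.of Surface), cls_trans (X := TopCat.of Surface),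
    cls_symm (X := TopCat.of Surface)] at h
  rw [weight, closeUp, ← h]
  abel

theorem exists_homology_equiv : ∃ (W : Coker (TopCat.of Surface) ⟶ ModuleCat.of ℤ (Fin 2 → ℤ))
    (e : (chains (TopCat.of Surface)).homology 1 ≃ₗ[ℤ] (Fin 2 → ℤ)),
    (∀ {x y : Surface} (γ : Path x y), W.hom (cls (X := TopCat.of Surface) γ.toContinuousMap) = weight γ) ∧
    (∀ z, e z = W.hom (((chains (TopCat.of Surface)).homologyι 1).hom z)) ∧
    (∀ z, ((chains (TopCat.of Surface)).homologyι 1).hom z = loopHom (e z)) := by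
  obtain ⟨W, hW⟩ := exists_weightHom
  obtain ⟨T, hT⟩ := exists_desc₀ (X := TopCat.of Surface) fun z =>
    cls (X := TopCat.of Surface) (PathConnectedSpace.somePath base (z : Surface)).toContinuousMap
  -- Every chain modulo boundaries is a combination of the two standard loops plus a term depending
  -- on its boundary. On homology the second term dies, so `loopHom` inverts `W` there.
  have hid : 𝟙 (Coker (TopCat.of Surface)) = W ≫ ModuleCat.ofHom loopHom +
      (chains (TopCat.of Surface)).fromOpcycles 1 0 ≫ T := by
    refine hom_ext fun c => ?_
    change cls c = loopHom (W.hom (cls c)) + T.hom (((chains (TopCat.of Surface)).fromOpcycles 1 0).hom (cls c))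
    rw [fromOpcycles_cls, _root_.map_sub, hT, hT]
    have h := cls_closeUp (⟨c, rfl, rfl⟩ : Path (c 0 : Surface) (c 1))
    rw [← hW] at h
    exact h
  have hι : ∀ z, ((chains (TopCat.of Surface)).homologyι 1).hom z =
      loopHom (W.hom (((chains (TopCat.of Surface)).homologyι 1).hom z)) := by
    intro z
    have h1 := congrArg (fun f => f.hom (((chains (TopCat.of Surface)).homologyι 1).hom z)) hid
    have h2 := congrArg (fun f => f.hom z)
      ((chains (TopCat.of Surface)).homologyι_comp_fromOpcycles 1 0)
    change ((chains (TopCat.of Surface)).fromOpcycles 1 0).hom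
      (((chains (TopCat.of Surface)).homologyι 1).hom z) = 0 at h2
    refine h1.trans ?_
    change loopHom (W.hom _) + T.hom (((chains (TopCat.of Surface)).fromOpcycles 1 0).hom _) = _
    rw [h2, _root_.map_zero, add_zero]
  have hinj : Function.Injective ((chains (TopCat.of Surface)).homologyι 1).hom :=
    (ModuleCat.mono_iff_injective _).1 inferInstance
  obtain ⟨zA, hA⟩ := exists_homology_of_loop (X := TopCat.of Surface) (c := loopA.toContinuousMap)
    (loopA.source.trans loopA.target.symm)
  obtain ⟨zB, hB⟩ := exists_homology_of_loop (X := TopCat.of Surface) (c := loopB.toContinuousMap)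
    (loopB.source.trans loopB.target.symm)
  have wA : W.hom (((chains (TopCat.of Surface)).homologyι 1).hom zA) = Pi.single 0 1 := by
    rw [hA, hW, weight_of_hasHol hasHol_loopA]
    exact expSum_of 0
  have wB : W.hom (((chains (TopCat.of Surface)).homologyι 1).hom zB) = Pi.single 1 1 := by
    rw [hB, hW, weight_of_hasHol hasHol_loopB]
    exact expSum_of 1
  let L := W.hom ∘ₗ ((chains (TopCat.of Surface)).homologyι 1).hom
  refine ⟨W, LinearEquiv.ofBijective L ⟨fun z z' h => hinj ?_, fun v => ?_⟩, hW, fun z => rfl, hι⟩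
  · rw [hι z, hι z']
    exact congrArg loopHom h
  · refine ⟨Fintype.linearCombination ℤ ![zA, zB] v, ?_⟩
    have : L ∘ₗ Fintype.linearCombination ℤ ![zA, zB] = LinearMap.id := by
      refine LinearMap.pi_ext' fun i => LinearMap.ext_ring ?_
      fin_cases i
      · simpa [L] using wA
      · simpa [L] using wB
    exact LinearMap.congr_fun this v

/-- In the basis of the two standard loops, the induced map sends each loop to the exponent sums of
its image word, and a trace does not depend on the basis. -/
theorem homologyTrace_eq (f : BoundaryFixing) : homologyTrace f = (abMatrix (act f)).trace := by
  obtain ⟨W, e, hW, he, hι⟩ := exists_homology_equiv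
  have key : ∀ v, W.hom ((HomologicalComplex.opcyclesMap (SSet.chainComplexMap
      (TopCat.toSSet.map (TopCat.ofHom (toMap f))) (ModuleCat.of ℤ ℤ)) 1).hom (loopHom v)) =
      (abMatrix (act f)).mulVec v := by
    have hl : ∀ (i : Fin 2) (γ : Path base base), HasHol γ (of i) →
        W.hom ((HomologicalComplex.opcyclesMap (SSet.chainComplexMap
          (TopCat.toSSet.map (TopCat.ofHom (toMap f))) (ModuleCat.of ℤ ℤ)) 1).hom
            (cls (X := TopCat.of Surface) γ.toContinuousMap)) =
        (abMatrix (act f)).mulVec (Pi.single i 1) := by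
      intro i γ h
      rw [opcyclesMap_cls]
      have e1 : (TopCat.ofHom (toMap f)).hom.comp γ.toContinuousMap =
          (mapLoop f γ).toContinuousMap := ContinuousMap.ext fun t => (mapLoop_apply f γ t).symm
      rw [e1]
      refine (hW (mapLoop f γ)).trans ?_
      rw [weight_of_hasHol (hasHol_act f h), expSum_apply_mulAut, expSum_of]
    have : (W.hom ∘ₗ (HomologicalComplex.opcyclesMap (SSet.chainComplexMap
        (TopCat.toSSet.map (TopCat.ofHom (toMap f))) (ModuleCat.of ℤ ℤ)) 1).hom) ∘ₗ loopHom =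
        (abMatrix (act f)).toLin' := by
      refine LinearMap.pi_ext' fun i => LinearMap.ext_ring ?_
      fin_cases i
      · simpa [loopHom] using hl 0 _ hasHol_loopA
      · simpa [loopHom] using hl 1 _ hasHol_loopB
    exact fun v => LinearMap.congr_fun this v
  let F : (chains (TopCat.of Surface)).homology 1 →ₗ[ℤ] (chains (TopCat.of Surface)).homology 1 :=
    (HomologicalComplex.homologyMap (SSet.chainComplexMap
      (TopCat.toSSet.map (TopCat.ofHom (toMap f))) (ModuleCat.of ℤ ℤ)) 1).hom
  have hF : homologyTrace f = LinearMap.trace ℤ _ F := rfl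
  have hconj : e.conj F = (abMatrix (act f)).toLin' := by
    refine LinearMap.ext fun v => ?_
    obtain ⟨z, rfl⟩ := e.surjective v
    rw [LinearEquiv.conj_apply_apply, LinearEquiv.symm_apply_apply, he, Matrix.toLin'_apply, ← key,
      ← hι]
    exact congrArg (fun g => W.hom (g.hom z)) (HomologicalComplex.homologyι_naturality
      (SSet.chainComplexMap (TopCat.toSSet.map (TopCat.ofHom (toMap f))) (ModuleCat.of ℤ ℤ)) 1)
  rw [hF, ← LinearMap.trace_conj' F e, hconj, Matrix.trace_toLin'_eq]

end

end OnceHoledTorus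

theorem theorem1p1 (φ : OnceHoledTorus.BoundaryFixing) :
    (2 < OnceHoledTorus.homologyTrace φ →
      ∃ (k : ℤ) (n : ℕ) (a b : Fin n → ℕ), (∃ i, a i ≠ 0) ∧ (∃ j, b j ≠ 0) ∧
        OnceHoledTorus.SameOpenBook (OnceHoledTorus.mappingClass φ)
          (OnceHoledTorus.δ ^ k * OnceHoledTorus.word a b)) ∧
    (OnceHoledTorus.homologyTrace φ < -2 →
      ∃ (k : ℤ) (n : ℕ) (a b : Fin n → ℕ), (∃ i, a i ≠ 0) ∧ (∃ j, b j ≠ 0) ∧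
        OnceHoledTorus.SameOpenBook (OnceHoledTorus.mappingClass φ)
          (OnceHoledTorus.δ ^ k * (OnceHoledTorus.x * OnceHoledTorus.y) ^ 3 *
            OnceHoledTorus.word a b)) := by
  -- The braid result is applied to the mapping class group with its action on exponent sums;
  -- equality of open books is conjugacy.
  have h := exists_isConj_letterProd (ρ := OnceHoledTorus.abMatrix.comp OnceHoledTorus.mcgAct)
    (by rw [MonoidHom.comp_apply, OnceHoledTorus.mcgAct_x, OnceHoledTorus.abMatrix_autX])
    (by rw [MonoidHom.comp_apply, OnceHoledTorus.mcgAct_y, OnceHoledTorus.abMatrix_autY])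
    OnceHoledTorus.braid_relation OnceHoledTorus.closure_x_y OnceHoledTorus.chain_relation
    (OnceHoledTorus.mappingClass φ)
  rw [MonoidHom.comp_apply, OnceHoledTorus.mcgAct_mappingClass, ← OnceHoledTorus.homologyTrace_eq] at h
  refine ⟨fun ht => ?_, fun ht => ?_⟩
  · obtain ⟨k, l, hl, hl', hc⟩ := h.1 ht
    obtain ⟨n, a, b, ha, hb, e⟩ := OnceHoledTorus.exists_word_eq_letterProd l hl hl'
    exact ⟨k, n, a, b, ha, hb, by rw [e]; exact isConj_iff.1 hc⟩
  · obtain ⟨k, l, hl, hl', hc⟩ := h.2 ht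
    obtain ⟨n, a, b, ha, hb, e⟩ := OnceHoledTorus.exists_word_eq_letterProd l hl hl'
    exact ⟨k, n, a, b, ha, hb, by rw [e]; exact isConj_iff.1 hc⟩
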